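/- All graphs and matroids are finite, and graphs may contain loops and parallel edges. Cycles of a graph are identified with their edge sets; a loop is a cycle with one edge, and a pair of parallel non-loop edges is a cycle with two edges. A Hamiltonian cycle is a cycle that uses every vertex. A theta-subgraph consists of two distinct vertices $u\neq v$ and three distinct $u$–$v$ paths that pairwise share no vertices other than $u$ and $v$. A linear class of a graph $G$ is a set $\mathcal{B}$ of cycles of $G$ such that no theta-subgraph of $G$ contains exactly two cycles in $\mathcal{B}$; the cycles in $\mathcal{B}$ are called balanced, and the other cycles unbalanced. The lift matroid $L(G,\mathcal{B})$ is the matroid on the edge set of $G$ whose circuits are the edge sets of: the balanced cycles; the theta-subgraphs in which no cycle is balanced; and the unions of two distinct unbalanced cycles with at most one vertex in common. $M(G)$ is the cycle matroid of $G$ and $M^{*}(G)$ is its dual. For $r\geq 3$, let $\Delta_r$ be the graph obtained from a cycle with $r$ edges by replacing each edge with a parallel pair. For a non-negative integer $k$, let $\mathcal{S}_k$ be the class of matroids that are isomorphic to minors of matroids $L(\Delta_r,\mathcal{B})$ with $r\geq 3$, where $\mathcal{B}$ is a linear class of at most $k$ Hamiltonian cycles of $\Delta_r$. Let $\mathcal{G}$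 be the class of graphs containing: (i) any graph with a single vertex; (ii) any connected graph with exactly two vertices, and at most four edges joining them; (iii) any graph whose underlying simple graph is a cycle with at least three vertices, where at most two edges join any two distinct vertices. (In each case any number of loops is allowed.) **Proposition.** Let $k$ be a non-negative integer. A matroid $M$ belongs to $\mathcal{S}_k$ if and only if it satisfies at least one of the following statements. (A) $M=L(G,\mathcal{B})$, where $G\in\mathcal{G}$ has at least three vertices, and $\mathcal{B}$ is a linear class of at most $k$ Hamiltonian cycles of $G$. (B) $M=L(G,\mathcal{B})$, where $G\in\mathcal{G}$ has exactly two vertices, and $\mathcal{B}$ is a linear class of at most $k$ pairwise edge-disjoint Hamiltonian cycles of $G$. (C) $M=L(G,\mathcal{B})$, where $G\in\mathcal{G}$ has a single vertex, and $\mathcal{B}$ contains at most $\min\{k,1\}$ loops. (D) $M=M(G)$ for a graph $G\in\mathcal{G}$. (E) $M=M^{*}(G)$ for a graph $G\in\mathcal{G}$. (F) Every connected component of $M$ has size at most two. -/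

import Mathlib

open Set

namespace SpikeMinor

universe u v w

section Graphs

variable {V : Type u} {β : Type v}

/-- `C` is the edge set of a cycle of the multigraph `G`: there are `n ≥ 1` distinct vertices and
`n` distinct edges in cyclic order, each edge joining two consecutive vertices. A cycle with one
edge is a loop, and a cycle with two edges is a pair of parallel edges. Cycles are identified with
their edge sets, which determine them. -/
def IsCycle (G : Graph V β) (C : Set β) : Prop :=
  ∃ (n : ℕ) (x : ZMod n → V) (e : ZMod n → β), n ≠ 0 ∧ Function.Injective x ∧
    Function.Injective e ∧ (∀ i, G.IsLink (e i) (x i) (x (i + 1))) ∧ C = range e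

/-- The vertices of `G` that are incident with an edge in `X`. -/
def vertexSupport (G : Graph V β) (X : Set β) : Set V :=
  {x | ∃ e ∈ X, G.Inc e x}

/-- A Hamiltonian cycle is a cycle that goes through every vertex. -/
def IsHamiltonianCycle (G : Graph V β) (C : Set β) : Prop :=
  IsCycle G C ∧ vertexSupport G C = G.vertexSet

/-- `W` is the vertex set and `P` is the edge set of a path of `G` from `a` to `b`. -/
def IsPath (G : Graph V β) (a b : V) (W : Set V) (P : Set β) : Prop :=
  ∃ (n : ℕ) (x : Fin (n + 1) → V) (e : Fin n → β), Function.Injective x ∧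
    (∀ i : Fin n, G.IsLink (e i) (x i.castSucc) (x i.succ)) ∧
    x 0 = a ∧ x (Fin.last n) = b ∧ W = range x ∧ P = range e

/-- `X` is the edge set of a theta-subgraph of `G`: two distinct vertices joined by three paths
that pairwise share no edges, and no vertices except for their ends. -/
def IsTheta (G : Graph V β) (X : Set β) : Prop :=
  ∃ (a b : V) (W : Fin 3 → Set V) (P : Fin 3 → Set β), a ≠ b ∧
    (∀ i, IsPath G a b (W i) (P i)) ∧
    (∀ i j, i ≠ j → W i ∩ W j ⊆ {a, b} ∧ Disjoint (P i) (P j)) ∧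
    X = ⋃ i, P i

/-- A linear class of cycles: no theta-subgraph contains exactly two cycles of the class. -/
def IsLinearClass (G : Graph V β) (B : Set (Set β)) : Prop :=
  (∀ C ∈ B, IsCycle G C) ∧ ∀ X, IsTheta G X → {C | C ∈ B ∧ C ⊆ X}.encard ≠ 2

/-- The circuits of the lift matroid `L(G, B)`: the balanced cycles, the theta-subgraphs without
balanced cycles, and the unions of two unbalanced cycles with at most one common vertex. -/
def IsLiftCircuit (G : Graph V β) (B : Set (Set β)) (X : Set β) : Prop :=
  X ∈ B ∨
  (IsTheta G X ∧ ∀ C ∈ B, ¬ C ⊆ X) ∨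
  ∃ C D, IsCycle G C ∧ IsCycle G D ∧ C ∉ B ∧ D ∉ B ∧ C ≠ D ∧
    (vertexSupport G C ∩ vertexSupport G D).Subsingleton ∧ X = C ∪ D

/-- `M = L(G, B)`: a matroid is determined by its ground set and its circuits. -/
def IsLiftMatroid (G : Graph V β) (B : Set (Set β)) (M : Matroid β) : Prop :=
  M.E = G.edgeSet ∧ ∀ X, M.IsCircuit X ↔ IsLiftCircuit G B X

/-- `M = M(G)`: the circuits of the cycle matroid of `G` are the cycles of `G`. -/
def IsCycleMatroid (G : Graph V β) (M : Matroid β) : Prop :=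
  M.E = G.edgeSet ∧ ∀ X, M.IsCircuit X ↔ IsCycle G X

theorem IsLiftMatroid.unique {G : Graph V β} {B : Set (Set β)} {M N : Matroid β}
    (hM : IsLiftMatroid G B M) (hN : IsLiftMatroid G B N) : M = N :=
  Matroid.ext_isCircuit (hM.1.trans hN.1.symm) fun _ _ => (hM.2 _).trans (hN.2 _).symm

theorem IsCycleMatroid.unique {G : Graph V β} {M N : Matroid β}
    (hM : IsCycleMatroid G M) (hN : IsCycleMatroid G N) : M = N :=
  Matroid.ext_isCircuit (hM.1.trans hN.1.symm) fun _ _ => (hM.2 _).trans (hN.2 _).symm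

/-- Graphs with a single vertex (and any number of loops). -/
def IsOneVertex (G : Graph V β) : Prop :=
  ∃ a, G.vertexSet = {a}

/-- Connected graphs with exactly two vertices, and at most four edges joining them
(and any number of loops). -/
def IsTwoVertex (G : Graph V β) : Prop :=
  ∃ a b, a ≠ b ∧ G.vertexSet = {a, b} ∧
    {e | G.IsLink e a b}.Nonempty ∧ {e | G.IsLink e a b}.encard ≤ 4

/-- Graphs whose underlying simple graph is a cycle with at least three vertices, with at most two
edges between any two distinct vertices (and any number of loops). -/
def IsDoubledCycle (G : Graph V β) : Prop :=
  ∃ (n : ℕ) (x : ZMod n → V), 3 ≤ n ∧ Function.Injective x ∧ G.vertexSet = range x ∧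
    (∀ a b, a ≠ b →
      (G.Adj a b ↔ ∃ i, (a = x i ∧ b = x (i + 1)) ∨ (a = x (i + 1) ∧ b = x i))) ∧
    (∀ a b, a ≠ b → {e | G.IsLink e a b}.encard ≤ 2)

/-- The class `𝒢` of finite graphs. -/
def InClassG (G : Graph V β) : Prop :=
  G.edgeSet.Finite ∧ (IsOneVertex G ∨ IsTwoVertex G ∨ IsDoubledCycle G)

end Graphs

section Spikes

/-- The graph `Δ_r`, obtained from a cycle with `r` edges by replacing each edge with a parallel
pair: the vertices are the integers modulo `r`, and `(i, false)`, `(i, true)` join `i` to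
`i + 1`. -/
def doubledCycle (r : ℕ) : Graph (ZMod r) (ZMod r × Bool) where
  vertexSet := univ
  edgeSet := univ
  IsLink e a b := (a = e.1 ∧ b = e.1 + 1) ∨ (a = e.1 + 1 ∧ b = e.1)
  isLink_symm := by
    intro e _
    exact ⟨fun a b h => h.elim (fun h => Or.inr ⟨h.2, h.1⟩) (fun h => Or.inl ⟨h.2, h.1⟩)⟩
  eq_or_eq_of_isLink_of_isLink := by
    rintro e a b c d (⟨rfl, rfl⟩ | ⟨rfl, rfl⟩) (⟨rfl, rfl⟩ | ⟨rfl, rfl⟩) <;> simp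
  edge_mem_iff_exists_isLink := by
    intro e
    exact ⟨fun _ => ⟨_, _, Or.inl ⟨rfl, rfl⟩⟩, fun _ => mem_univ _⟩
  left_mem_of_isLink := by
    intro e a b _
    exact mem_univ _

/-- Isomorphism of matroids. -/
def Isomorphic {α : Type u} {β : Type v} (M : Matroid α) (N : Matroid β) : Prop :=
  ∃ f : M.E ≃ N.E, M.mapSetEquiv f = N

/-- The class `𝒮_k`: matroids that are isomorphic to a minor of a spike `L(Δ_r, B)`, with `r ≥ 3`
and `B` a linear class of at most `k` Hamiltonian cycles of `Δ_r`. -/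
def InClassS (k : ℕ) {α : Type u} (M : Matroid α) : Prop :=
  ∃ (r : ℕ) (B : Set (Set (ZMod r × Bool))) (L N : Matroid (ZMod r × Bool)),
    3 ≤ r ∧ IsLinearClass (doubledCycle r) B ∧
    (∀ C ∈ B, IsHamiltonianCycle (doubledCycle r) C) ∧ B.encard ≤ k ∧
    IsLiftMatroid (doubledCycle r) B L ∧ N ≤m L ∧ Isomorphic M N

end Spikes

section Categories

variable {α : Type u}

/-- `M = L(G, B)`, where `G ∈ 𝒢` has at least three vertices, and `B` is a linear class of at most
`k` Hamiltonian cycles. -/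
def CategoryA (k : ℕ) (M : Matroid α) : Prop :=
  ∃ (V : Type) (G : Graph V α) (B : Set (Set α)), InClassG G ∧ 3 ≤ G.vertexSet.encard ∧
    IsLinearClass G B ∧ (∀ C ∈ B, IsHamiltonianCycle G C) ∧ B.encard ≤ k ∧
    IsLiftMatroid G B M

/-- `M = L(G, B)`, where `G ∈ 𝒢` has exactly two vertices, and `B` is a linear class of at most
`k` pairwise edge-disjoint Hamiltonian cycles. -/
def CategoryB (k : ℕ) (M : Matroid α) : Prop :=
  ∃ (V : Type) (G : Graph V α) (B : Set (Set α)), InClassG G ∧ G.vertexSet.encard = 2 ∧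
    IsLinearClass G B ∧ (∀ C ∈ B, IsHamiltonianCycle G C) ∧
    (∀ C ∈ B, ∀ D ∈ B, C ≠ D → Disjoint C D) ∧ B.encard ≤ k ∧
    IsLiftMatroid G B M

/-- `M = L(G, B)`, where `G ∈ 𝒢` has a single vertex, and `B` contains at most `min {k, 1}` loops
(every cycle of a graph with one vertex is a loop). -/
def CategoryC (k : ℕ) (M : Matroid α) : Prop :=
  ∃ (V : Type) (G : Graph V α) (B : Set (Set α)), InClassG G ∧ G.vertexSet.encard = 1 ∧
    IsLinearClass G B ∧ B.encard ≤ (min k 1 : ℕ) ∧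
    IsLiftMatroid G B M

/-- `M = M(G)` for a graph `G ∈ 𝒢`. -/
def CategoryD (M : Matroid α) : Prop :=
  ∃ (V : Type) (G : Graph V α), InClassG G ∧ IsCycleMatroid G M

/-- `M` is the dual of `M(G)` for a graph `G ∈ 𝒢`. -/
def CategoryE (M : Matroid α) : Prop :=
  ∃ (V : Type) (G : Graph V α), InClassG G ∧ IsCycleMatroid G M.dual

/-- The connected component of `M` that contains the element `e`: it consists of `e` and of the
elements that lie in a circuit with `e`. -/
def component (M : Matroid α) (e : α) : Set α :=
  {f | f = e ∨ ∃ C, M.IsCircuit C ∧ e ∈ C ∧ f ∈ C}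

/-- Every connected component of `M` has size at most two. -/
def CategoryF (M : Matroid α) : Prop :=
  ∀ e ∈ M.E, (component M e).encard ≤ 2

end Categories

end SpikeMinor

namespace SpikeMinor

section Legs

universe x y

variable {α : Type x} {ι : Type y}

/-- The set `I` is full at the leg `i`, for a labelling `q` of the elements by legs, where the legs
in `T` have one contracted element, and those in `D` have two. -/
def FullLeg (q : α → ι) (T D : Set ι) (I : Set α) (i : ι) : Prop :=
  i ∈ D ∨ (i ∈ T ∧ ∃ e ∈ I, q e = i) ∨ ∃ e ∈ I, ∃ f ∈ I, e ≠ f ∧ q e = i ∧ q f = i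

/-- Dependence in a minor of a spike, in terms of legs. -/
def LegDep (q : α → ι) (T D : Set ι) (B : Set (Set α)) (I : Set α) : Prop :=
  (∃ i j, i ≠ j ∧ FullLeg q T D I i ∧ FullLeg q T D I j) ∨
  ((∃ i, FullLeg q T D I i) ∧ ∀ i ∉ T, ∃ e ∈ I, q e = i) ∨ ∃ b ∈ B, b ⊆ I

/-- Dependence in the cycle matroid of a cycle with doubled edges and loops. -/
def CycleDep (q : α → ι) (T : Set ι) (I : Set α) : Prop :=
  (∃ i, FullLeg q T ∅ I i) ∨ ∀ i ∉ T, ∃ e ∈ I, q e = i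

/-- Sets that contain one element of each leg outside `T`. -/
def IsTransversal (E : Set α) (q : α → ι) (T : Set ι) (b : Set α) : Prop :=
  b ⊆ E ∧ BijOn q b Tᶜ

/-- No two members differ in just one leg. -/
def Separated (q : α → ι) (B : Set (Set α)) : Prop :=
  ∀ b ∈ B, ∀ c ∈ B, ∀ i, (∀ e, q e ≠ i → (e ∈ b ↔ e ∈ c)) → b = c

structure IsLegLabelling (E : Set α) (q : α → ι) (T : Set ι) : Prop where
  fiber_two : ∀ e ∈ E, ∀ f ∈ E, ∀ g ∈ E, q e = q f → q e = q g → e = f ∨ e = g ∨ f = g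
  fiber_one : ∀ e ∈ E, ∀ f ∈ E, q e = q f → q e ∈ T → e = f

lemma FullLeg.mono {q : α → ι} {T D : Set ι} {I J : Set α} {i : ι} (h : FullLeg q T D I i)
    (hIJ : I ⊆ J) : FullLeg q T D J i := by
  rcases h with h | ⟨h, e, he, hq⟩ | ⟨e, he, f, hf, h⟩
  · exact Or.inl h
  · exact Or.inr (Or.inl ⟨h, e, hIJ he, hq⟩)
  · exact Or.inr (Or.inr ⟨e, hIJ he, f, hIJ hf, h⟩)

lemma LegDep.mono {q : α → ι} {T D : Set ι} {B : Set (Set α)} {I J : Set α}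
    (h : LegDep q T D B I) (hIJ : I ⊆ J) : LegDep q T D B J := by
  rcases h with ⟨i, j, hij, hi, hj⟩ | ⟨⟨i, hi⟩, h⟩ | ⟨b, hb, h⟩
  · exact Or.inl ⟨i, j, hij, hi.mono hIJ, hj.mono hIJ⟩
  · refine Or.inr (Or.inl ⟨⟨i, hi.mono hIJ⟩, fun j hj => ?_⟩)
    obtain ⟨e, he, h⟩ := h j hj
    exact ⟨e, hIJ he, h⟩
  · exact Or.inr (Or.inr ⟨b, hb, h.trans hIJ⟩)

lemma CycleDep.mono {q : α → ι} {T : Set ι} {I J : Set α}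
    (h : CycleDep q T I) (hIJ : I ⊆ J) : CycleDep q T J := by
  rcases h with ⟨i, hi⟩ | h
  · exact Or.inl ⟨i, hi.mono hIJ⟩
  · refine Or.inr fun j hj => ?_
    obtain ⟨e, he, h⟩ := h j hj
    exact ⟨e, hIJ he, h⟩

lemma IsTransversal.exists_mem {E : Set α} {q : α → ι} {T : Set ι} {b : Set α}
    (h : IsTransversal E q T b) {i : ι} (hi : i ∉ T) : ∃ e ∈ b, q e = i := h.2.surjOn hi

lemma IsTransversal.notMem {E : Set α} {q : α → ι} {T : Set ι} {b : Set α}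
    (h : IsTransversal E q T b) {e : α} (he : e ∈ b) : q e ∉ T := h.2.mapsTo he

lemma IsTransversal.inj {E : Set α} {q : α → ι} {T : Set ι} {b : Set α}
    (h : IsTransversal E q T b) {e f : α} (he : e ∈ b) (hf : f ∈ b) (hq : q e = q f) : e = f :=
  h.2.injOn he hf hq

lemma IsTransversal.eq_of_subset {E : Set α} {q : α → ι} {T : Set ι} {b c : Set α}
    (hb : IsTransversal E q T b) (hc : IsTransversal E q T c) (h : b ⊆ c) : b = c := by
  refine h.antisymm fun e he => ?_
  obtain ⟨f, hf, hq⟩ := hb.exists_mem (hc.notMem he)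
  rwa [← hc.inj (h hf) he hq]

/-- Replacing an element of a transversal by an element of the same leg. -/
lemma IsTransversal.exchange {E : Set α} {q : α → ι} {T : Set ι} {b : Set α}
    (hb : IsTransversal E q T b) {e f : α} (he : e ∈ E) (hf : f ∈ b)
    (hq : q e = q f) : IsTransversal E q T (insert e (b \ {f})) := by
  refine ⟨insert_subset he (sdiff_subset.trans hb.1), ?_, ?_, ?_⟩
  · rintro g (rfl | hg)
    · rw [hq]; exact hb.notMem hf
    · exact hb.notMem hg.1
  · rintro g (rfl | hg) g' (rfl | hg') hgg
    · rfl
    · exact (hg'.2 (hb.inj hg'.1 hf (hgg.symm.trans hq))).elim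
    · exact (hg.2 (hb.inj hg.1 hf (hgg.trans hq))).elim
    · exact hb.inj hg.1 hg'.1 hgg
  · intro i hi
    obtain ⟨g, hg, rfl⟩ := hb.exists_mem hi
    by_cases hgf : g = f
    · exact ⟨e, mem_insert _ _, by rw [hq, hgf]⟩
    · exact ⟨g, mem_insert_of_mem _ ⟨hg, hgf⟩, rfl⟩

lemma exists_transversal {E : Set α} {q : α → ι} {T : Set ι} {X : Set α} (hX : X ⊆ E)
    (h : ∀ i ∉ T, ∃ e ∈ X, q e = i) : ∃ b ⊆ X, IsTransversal E q T b := by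
  choose g hgX hg using h
  refine ⟨{e | ∃ i hi, g i hi = e}, ?_, ?_, ?_, ?_, ?_⟩
  · rintro _ ⟨i, hi, rfl⟩; exact hgX i hi
  · rintro _ ⟨i, hi, rfl⟩; exact hX (hgX i hi)
  · rintro _ ⟨i, hi, rfl⟩; rw [mem_compl_iff, hg i hi]; exact hi
  · rintro _ ⟨i, hi, rfl⟩ _ ⟨j, hj, rfl⟩ hij
    rw [hg i hi, hg j hj] at hij
    subst hij
    rfl
  · intro i hi
    exact ⟨g i hi, ⟨i, hi, rfl⟩, hg i hi⟩

end Legs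

section Circuits

variable {α : Type*}

/-- A monotone property describes the dependent sets if and only if its minimal members are the
circuits. -/
lemma indep_iff_iff_isCircuit_iff (M : Matroid α) [M.Finite] {P : Set α → Prop}
    (hP : ∀ X Y, P X → X ⊆ Y → P Y) :
    (∀ I ⊆ M.E, M.Indep I ↔ ¬ P I) ↔ ∀ X, M.IsCircuit X ↔ X ⊆ M.E ∧ Minimal P X := by
  refine ⟨fun h X => ?_, fun h I hI => ?_⟩
  · refine ⟨fun hX => ⟨hX.subset_ground, ?_⟩, fun hX => ?_⟩
    · refine ⟨by_contra fun hn => hX.not_indep ((h X hX.subset_ground).2 hn), fun Y hY hYX => ?_⟩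
      refine (hX.eq_of_not_indep_subset (fun hi => ?_) hYX).symm.le
      exact (h Y (hYX.trans hX.subset_ground)).1 hi hY
    · rw [Matroid.isCircuit_iff_minimal_not_indep hX.1]
      refine ⟨fun hi => (h X hX.1).1 hi hX.2.1, fun Y hY hYX => hX.2.2 ?_ hYX⟩
      exact by_contra fun hn => hY ((h Y (hYX.trans hX.1)).2 hn)
  · rw [Matroid.indep_iff_forall_subset_not_isCircuit hI]
    refine ⟨fun hc hPI => ?_, fun hn C hCI hC => hn (hP _ _ ((h C).1 hC).2.1 hCI)⟩
    have hfin : {Y | Y ⊆ I ∧ P Y}.Finite :=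
      ((M.ground_finite.subset hI).finite_subsets).subset fun Y hY => hY.1
    obtain ⟨Y, hYI, hY⟩ := hfin.exists_le_minimal (a := I) ⟨Subset.rfl, hPI⟩
    refine hc Y hYI ((h Y).2 ⟨hYI.trans hI, hY.1.2, fun Z hZ hZY => hY.2 ⟨hZY.trans hYI, hZ⟩ hZY⟩)

lemma subset_and_minimal_iff {E : Set α} {P L : Set α → Prop} (hP : ∀ X Y, P X → X ⊆ Y → P Y)
    (hL : ∀ X, L X → X ⊆ E ∧ P X ∧ ∀ e ∈ X, ¬ P (X \ {e}))
    (hex : ∀ X ⊆ E, P X → ∃ Y ⊆ X, L Y) (X : Set α) : (X ⊆ E ∧ Minimal P X) ↔ L X := by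
  refine ⟨fun h => ?_, fun h => ⟨(hL X h).1, (hL X h).2.1, fun Y hY hYX => ?_⟩⟩
  · obtain ⟨Y, hYX, hY⟩ := hex X h.1 h.2.1
    have := h.2.2 (hL Y hY).2.1 hYX
    rwa [← hYX.antisymm this]
  · intro e he
    by_contra heY
    exact (hL X h).2.2 e he (hP _ _ hY (subset_sdiff_singleton hYX heY))

end Circuits

section SpikeMatroid

variable {ι : Type*}

lemma fullLeg_fst_iff {X : Set (ι × Bool)} {i : ι} :
    FullLeg Prod.fst ∅ ∅ X i ↔ (i, false) ∈ X ∧ (i, true) ∈ X := by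
  constructor
  · rintro (h | ⟨h, -⟩ | ⟨⟨a, s⟩, he, ⟨b, t⟩, hf, hne, rfl, rfl⟩)
    · exact h.elim
    · exact h.elim
    · cases s <;> cases t <;> simp_all
  · rintro ⟨h, h'⟩
    exact Or.inr (Or.inr ⟨_, h, _, h', by simp, rfl, rfl⟩)

lemma ncard_of_no_fullLeg {X : Set (ι × Bool)} (h : ∀ i, ¬ FullLeg Prod.fst ∅ ∅ X i) :
    X.ncard = (Prod.fst '' X).ncard := by
  refine (InjOn.ncard_image fun e he f hf hef => ?_).symm
  by_contra hne
  exact h f.1 (Or.inr (Or.inr ⟨e, he, f, hf, hne, hef, rfl⟩))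

lemma ncard_of_unique_fullLeg [Finite ι] {X : Set (ι × Bool)} {i : ι} (hi : FullLeg Prod.fst ∅ ∅ X i)
    (h : ∀ j, FullLeg Prod.fst ∅ ∅ X j → j = i) :
    X.ncard = (Prod.fst '' X).ncard + 1 := by
  have hi' := fullLeg_fst_iff.1 hi
  have h1 : (X \ {(i, true)}).ncard = (Prod.fst '' (X \ {(i, true)})).ncard := by
    refine ncard_of_no_fullLeg fun j hj => ?_
    obtain rfl := h j (hj.mono sdiff_subset)
    exact (fullLeg_fst_iff.1 hj).2.2 rfl
  have h2 : Prod.fst '' (X \ {(i, true)}) = Prod.fst '' X := by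
    refine (image_mono sdiff_subset).antisymm ?_
    rintro _ ⟨⟨j, s⟩, he, rfl⟩
    by_cases hj : j = i
    · subst hj
      exact ⟨(j, false), ⟨hi'.1, by simp⟩, rfl⟩
    · exact ⟨(j, s), ⟨he, by simp [hj]⟩, rfl⟩
  rw [← h2, ← h1, ncard_sdiff_singleton_add_one hi'.2]

lemma spike_augment [Finite ι] {B : Set (Set (ι × Bool))} (hB : ∀ b ∈ B, IsTransversal univ Prod.fst ∅ b)
    (hsep : Separated Prod.fst B) {I J : Set (ι × Bool)} (hI : ¬ LegDep Prod.fst ∅ ∅ B I)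
    (hJ : ¬ LegDep Prod.fst ∅ ∅ B J) (hIJ : I.ncard < J.ncard) :
    ∃ e ∈ J, e ∉ I ∧ ¬ LegDep Prod.fst ∅ ∅ B (insert e I) := by
  classical
  have key : ∀ X : Set (ι × Bool), ¬ LegDep Prod.fst ∅ ∅ B X →
      (∀ i, ¬ FullLeg Prod.fst ∅ ∅ X i) ∧ X.ncard = (Prod.fst '' X).ncard ∨
      ∃ i l, FullLeg Prod.fst ∅ ∅ X i ∧ (∀ j, FullLeg Prod.fst ∅ ∅ X j → j = i) ∧
        X.ncard = (Prod.fst '' X).ncard + 1 ∧ l ∉ Prod.fst '' X := by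
    intro X hX
    by_cases h : ∃ i, FullLeg Prod.fst ∅ ∅ X i
    · obtain ⟨i, hi⟩ := h
      have hu : ∀ j, FullLeg Prod.fst ∅ ∅ X j → j = i := fun j hj =>
        by_contra fun hne => hX (Or.inl ⟨j, i, hne, hj, hi⟩)
      have : ∃ l, l ∉ Prod.fst '' X := by
        by_contra! hall
        exact hX (Or.inr (Or.inl ⟨⟨i, hi⟩, fun j _ => hall j⟩))
      obtain ⟨l, hl⟩ := this
      exact Or.inr ⟨i, l, hi, hu, ncard_of_unique_fullLeg hi hu, hl⟩
    · push Not at h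
      exact Or.inl ⟨h, ncard_of_no_fullLeg h⟩
  -- no balanced set lies in a set that misses a leg
  have hmiss : ∀ X : Set (ι × Bool), ∀ l ∉ Prod.fst '' X, ∀ b ∈ B, ¬ b ⊆ X := by
    intro X l hl b hb hbX
    obtain ⟨e, he, rfl⟩ := (hB b hb).exists_mem (i := l) (notMem_empty _)
    exact hl ⟨e, hbX he, rfl⟩
  -- a set with one full leg that misses some leg is independent
  have hone : ∀ X : Set (ι × Bool), ∀ i, (∀ j, FullLeg Prod.fst ∅ ∅ X j → j = i) →
      ∀ l ∉ Prod.fst '' X, ¬ LegDep Prod.fst ∅ ∅ B X := by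
    rintro X i hu l hl (⟨j, j', hne, hj, hj'⟩ | ⟨-, hall⟩ | ⟨b, hb, hbX⟩)
    · exact hne ((hu j hj).trans (hu j' hj').symm)
    · exact hl (hall l (notMem_empty _))
    · exact hmiss X l hl b hb hbX
  have hfull_insert : ∀ e j, FullLeg Prod.fst ∅ ∅ (insert e I) j → j ≠ e.1 →
      FullLeg Prod.fst ∅ ∅ I j := by
    intro e j hj hne
    rw [fullLeg_fst_iff] at hj ⊢
    refine ⟨hj.1.resolve_left ?_, hj.2.resolve_left ?_⟩ <;> rintro rfl <;> exact hne rfl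
  have hfull_new : ∀ e, e.1 ∉ Prod.fst '' I → ¬ FullLeg Prod.fst ∅ ∅ (insert e I) e.1 := by
    intro e he hf
    rw [fullLeg_fst_iff] at hf
    obtain ⟨i, s⟩ := e
    cases s
    · exact he ⟨_, hf.2.resolve_left (by simp), rfl⟩
    · exact he ⟨_, hf.1.resolve_left (by simp), rfl⟩
  have hcardle : ∀ X : Set (ι × Bool), (Prod.fst '' X).ncard ≤ Nat.card ι := fun X =>
    (ncard_le_ncard (subset_univ _)).trans (ncard_univ ι).le
  have hcardlt : ∀ X : Set (ι × Bool), ∀ l ∉ Prod.fst '' X, (Prod.fst '' X).ncard < Nat.card ι := by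
    intro X l hl
    rw [← ncard_univ ι]
    exact ncard_lt_ncard ⟨subset_univ _, fun h => hl (h (mem_univ l))⟩
  have hJle : J.ncard ≤ Nat.card ι := by
    rcases key J hJ with ⟨-, h⟩ | ⟨i, l, -, -, h, hl⟩
    · exact h ▸ hcardle J
    · have := hcardlt J l hl
      omega
  by_cases hA : ∃ e ∈ J, e.1 ∉ Prod.fst '' I
  · obtain ⟨e, heJ, he⟩ := hA
    have heI : e ∉ I := fun h => he ⟨e, h, rfl⟩
    have himg : Prod.fst '' insert e I = insert e.1 (Prod.fst '' I) := image_insert_eq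
    have himgc : (insert e.1 (Prod.fst '' I)).ncard = (Prod.fst '' I).ncard + 1 :=
      ncard_insert_of_notMem he
    rcases key I hI with ⟨hno, hc⟩ | ⟨i, l, hi, hu, hc, hl⟩
    · have hno' : ∀ j, ¬ FullLeg Prod.fst ∅ ∅ (insert e I) j := by
        intro j hj
        by_cases hje : j = e.1
        · subst hje; exact hfull_new e he hj
        · exact hno j (hfull_insert e j hj hje)
      by_cases hb : ∃ b ∈ B, b ⊆ insert e I
      · obtain ⟨b, hbB, hb⟩ := hb
        have heq : ∀ f, (∀ j, ¬ FullLeg Prod.fst ∅ ∅ (insert f I) j) → ∀ c ∈ B,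
            c ⊆ insert f I → c = insert f I := by
          intro f hf c hc hcf
          refine hcf.antisymm fun g hg => ?_
          obtain ⟨g', hg', hgg⟩ := (hB c hc).exists_mem (i := g.1) (notMem_empty _)
          by_contra hgc
          exact hf g.1 (Or.inr (Or.inr ⟨g, hg, g', hcf hg', fun h => hgc (h ▸ hg'), rfl, hgg⟩))
        have hbe := heq e hno' b hbB hb
        obtain ⟨f, hfJ, hfI⟩ : ∃ f ∈ J, f ∉ insert e I := by
          by_contra! hsub
          have h1 : (insert e I).ncard = I.ncard + 1 := ncard_insert_of_notMem heI
          have h2 : J = insert e I := eq_of_subset_of_ncard_le hsub (by omega)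
          exact hJ (Or.inr (Or.inr ⟨b, hbB, by rw [h2, hbe]⟩))
        have hfI' : f ∉ I := fun h => hfI (mem_insert_of_mem _ h)
        refine ⟨f, hfJ, hfI', ?_⟩
        by_cases hfe : f.1 = e.1
        · have hnof : ∀ j, ¬ FullLeg Prod.fst ∅ ∅ (insert f I) j := by
            intro j hj
            by_cases hje : j = f.1
            · subst hje; exact hfull_new f (hfe ▸ he) hj
            · exact hno j (hfull_insert f j hj hje)
          rintro (⟨j, -, -, hj, -⟩ | ⟨⟨j, hj⟩, -⟩ | ⟨c, hc, hcf⟩)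
          · exact hnof j hj
          · exact hnof j hj
          · have hcf := heq f hnof c hc hcf
            have : b = c := by
              refine hsep b hbB c hc e.1 fun g hg => ?_
              rw [hbe, hcf, mem_insert_iff, mem_insert_iff]
              constructor
              · rintro (rfl | h)
                · exact (hg rfl).elim
                · exact Or.inr h
              · rintro (rfl | h)
                · exact (hg hfe).elim
                · exact Or.inr h
            exact hfI (hbe ▸ this ▸ hcf ▸ mem_insert _ _)
        · have hfI1 : f.1 ∈ Prod.fst '' I := by
            obtain ⟨g, hg, hgf⟩ := (hB b hbB).exists_mem (i := f.1) (notMem_empty _)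
            rcases hb hg with rfl | hgI
            · exact (hfe hgf.symm).elim
            · exact ⟨g, hgI, hgf⟩
          refine hone _ f.1 (fun j hj => ?_) e.1 ?_
          · by_contra hjf
            exact hno j (hfull_insert f j hj hjf)
          · rw [image_insert_eq]
            rintro (h | h)
            · exact hfe h.symm
            · exact he h
      · refine ⟨e, heJ, heI, ?_⟩
        rintro (⟨j, -, -, hj, -⟩ | ⟨⟨j, hj⟩, -⟩ | hb')
        · exact hno' j hj
        · exact hno' j hj
        · exact hb hb'
    · refine ⟨e, heJ, heI, ?_⟩
      obtain ⟨l', hl'⟩ : ∃ l', l' ∉ Prod.fst '' insert e I := by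
        by_contra! hall
        have h1 : Prod.fst '' insert e I = univ := eq_univ_of_forall hall
        have h2 := ncard_univ ι
        rw [← h1, himg, himgc] at h2
        omega
      refine hone _ i (fun j hj => ?_) l' hl'
      by_cases hje : j = e.1
      · subst hje; exact (hfull_new e he hj).elim
      · exact hu j (hfull_insert e j hj hje)
  · push Not at hA
    have hsub : Prod.fst '' J ⊆ Prod.fst '' I := by
      rintro _ ⟨e, he, rfl⟩; exact hA e he
    have hle := ncard_le_ncard hsub
    rcases key J hJ with ⟨-, hcJ⟩ | ⟨i, l, hi, hu, hcJ, hl⟩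
    · rcases key I hI with ⟨-, hc⟩ | ⟨-, -, -, -, hc, -⟩ <;> omega
    · rcases key I hI with ⟨hno, hc⟩ | ⟨-, -, -, -, hc, -⟩
      · have hJI : Prod.fst '' J = Prod.fst '' I := eq_of_subset_of_ncard_le hsub (by omega)
        have hi' := fullLeg_fst_iff.1 hi
        obtain ⟨e, heJ, heI, hei⟩ : ∃ e ∈ J, e ∉ I ∧ e.1 = i := by
          by_contra! hcon
          refine hno i (fullLeg_fst_iff.2 ⟨?_, ?_⟩)
          · by_contra h; exact hcon _ hi'.1 h rfl
          · by_contra h; exact hcon _ hi'.2 h rfl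
        refine ⟨e, heJ, heI, hone _ i (fun j hj => ?_) l ?_⟩
        · by_contra hje
          exact hno j (hfull_insert e j hj (hei ▸ hje))
        · rw [image_insert_eq, ← hJI]
          rintro (h | h)
          · exact hl (h ▸ ⟨e, heJ, rfl⟩)
          · exact hl h
      · omega

theorem exists_spike_matroid [Finite ι] [Nonempty ι] {B : Set (Set (ι × Bool))}
    (hB : ∀ b ∈ B, IsTransversal univ Prod.fst ∅ b) (hsep : Separated Prod.fst B) :
    ∃ L : Matroid (ι × Bool), L.E = univ ∧ ∀ I, L.Indep I ↔ ¬ LegDep Prod.fst ∅ ∅ B I := by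
  refine ⟨(IndepMatroid.ofFinite (E := univ) finite_univ (fun I => ¬ LegDep Prod.fst ∅ ∅ B I)
    ?_ (fun I J hJ hIJ h => hJ (h.mono hIJ)) (fun I J hI hJ h => spike_augment hB hsep hI hJ h)
    (fun _ _ => subset_univ _)).matroid, rfl, fun I => Iff.rfl⟩
  have hno : ∀ i, ¬ FullLeg Prod.fst ∅ ∅ (∅ : Set (ι × Bool)) i := fun i h =>
    (fullLeg_fst_iff.1 h).1
  rintro (⟨j, -, -, hj, -⟩ | ⟨⟨j, hj⟩, -⟩ | ⟨b, hb, hb'⟩)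
  · exact hno j hj
  · exact hno j hj
  · obtain ⟨e, he, -⟩ := (hB b hb).exists_mem (i := Classical.arbitrary ι) (notMem_empty _)
    exact hb' he

end SpikeMatroid

end SpikeMinor

namespace SpikeMinor

section Gluing

universe x y

variable {V : Type x} {β : Type y} {G : Graph V β}

lemma IsCycle.of_nat {m : ℕ} (hm : m ≠ 0) {x : ℕ → V} {e : ℕ → β} (hx : InjOn x (Iio m))
    (he : InjOn e (Iio m)) (hlink : ∀ i < m, G.IsLink (e i) (x i) (x (i + 1)))
    (hclose : x m = x 0) : IsCycle G (e '' Iio m) := by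
  have : NeZero m := ⟨hm⟩
  refine ⟨m, fun k => x k.val, fun k => e k.val, hm, fun i j hij => ?_, fun i j hij => ?_,
    fun i => ?_, ?_⟩
  · exact ZMod.val_injective m (hx (ZMod.val_lt i) (ZMod.val_lt j) hij)
  · exact ZMod.val_injective m (he (ZMod.val_lt i) (ZMod.val_lt j) hij)
  · have h1 : (i + 1).val = (i.val + 1) % m := by
      rw [← ZMod.val_natCast]; simp
    have h2 := hlink i.val (ZMod.val_lt i)
    have h3 : x (i + 1).val = x (i.val + 1) := by
      rw [h1]
      rcases Nat.lt_or_ge (i.val + 1) m with h | h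
      · rw [Nat.mod_eq_of_lt h]
      · have : i.val + 1 = m := le_antisymm (ZMod.val_lt i) h
        rw [this, Nat.mod_self, hclose]
    change G.IsLink (e i.val) (x i.val) (x (i + 1).val)
    rwa [h3]
  · ext f
    constructor
    · rintro ⟨k, hk, rfl⟩
      exact ⟨(k : ZMod m), by simp only [ZMod.val_natCast, Nat.mod_eq_of_lt (show k < m from hk)]⟩
    · rintro ⟨i, rfl⟩
      exact ⟨i.val, ZMod.val_lt i, rfl⟩

lemma IsPath.exists_nat {a b : V} {W : Set V} {P : Set β} (h : IsPath G a b W P) (hab : a ≠ b) :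
    ∃ (n : ℕ) (x : ℕ → V) (e : ℕ → β), n ≠ 0 ∧ InjOn x (Iic n) ∧ InjOn e (Iio n) ∧
      (∀ i < n, G.IsLink (e i) (x i) (x (i + 1))) ∧ x 0 = a ∧ x n = b ∧
      W = x '' Iic n ∧ P = e '' Iio n := by
  obtain ⟨n, x, e, hx, hlink, rfl, rfl, rfl, rfl⟩ := h
  rcases n with _ | n
  · exact (hab rfl).elim
  refine ⟨n + 1, fun k => x (Fin.ofNat (n + 2) k), fun k => e (Fin.ofNat (n + 1) k), by simp,
    ?_, ?_, ?_, ?_, ?_, ?_, ?_⟩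
  · intro i hi j hj hij
    have := congrArg Fin.val (hx hij)
    simpa [Nat.mod_eq_of_lt (Nat.lt_succ_of_le hi), Nat.mod_eq_of_lt (Nat.lt_succ_of_le hj)]
      using this
  · have hinj : Function.Injective e := by
      intro i j hij
      have hi := hlink i
      rw [hij] at hi
      rcases hi.eq_and_eq_or_eq_and_eq (hlink j) with ⟨h1, -⟩ | ⟨h1, h2⟩
      · exact Fin.castSucc_injective _ (hx h1)
      · have h1 := congrArg Fin.val (hx h1)
        have h2 := congrArg Fin.val (hx h2)
        simp only [Fin.val_castSucc, Fin.val_succ] at h1 h2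
        omega
    intro i hi j hj hij
    have := congrArg Fin.val (hinj hij)
    simpa [Nat.mod_eq_of_lt (show i < n + 1 from hi), Nat.mod_eq_of_lt (show j < n + 1 from hj)]
      using this
  · intro i hi
    have := hlink ⟨i, hi⟩
    convert this using 2
    · ext; simp [Nat.mod_eq_of_lt hi]
    · ext; simp [Nat.mod_eq_of_lt (show i < n + 1 + 1 by omega)]
    · ext; simp [Nat.mod_eq_of_lt (show i + 1 < n + 1 + 1 by omega)]
  · congr 1
  · change x _ = x _
    congr 1
    ext
    simp
  · ext v
    constructor
    · rintro ⟨i, rfl⟩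
      exact ⟨i.val, Nat.le_of_lt_succ i.2, by
        change x _ = x _; congr 1; ext; simp⟩
    · rintro ⟨i, -, rfl⟩
      exact ⟨_, rfl⟩
  · ext v
    constructor
    · rintro ⟨i, rfl⟩
      exact ⟨i.val, i.2, by
        change e _ = e _; congr 1; ext; simp⟩
    · rintro ⟨i, -, rfl⟩
      exact ⟨_, rfl⟩

lemma IsPath.nonempty {a b : V} {W : Set V} {P : Set β} (h : IsPath G a b W P) (hab : a ≠ b) :
    P.Nonempty := by
  obtain ⟨n, x, e, hn, -, -, -, -, -, -, rfl⟩ := h.exists_nat hab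
  exact ⟨e 0, 0, Nat.pos_of_ne_zero hn, rfl⟩

/-- Two internally disjoint paths with the same ends form a cycle. -/
lemma IsPath.isCycle_union {a b : V} {W W' : Set V} {P P' : Set β} (hab : a ≠ b)
    (h : IsPath G a b W P) (h' : IsPath G a b W' P') (hW : W ∩ W' ⊆ {a, b})
    (hP : Disjoint P P') : IsCycle G (P ∪ P') := by
  obtain ⟨n, x, e, hn, hx, he, hl, ha, hb, rfl, rfl⟩ := h.exists_nat hab
  obtain ⟨m, x', e', hm, hx', he', hl', ha', hb', rfl, rfl⟩ := h'.exists_nat hab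
  have hcross : ∀ k ≤ n, ∀ l, n < l → l < n + m → x k ≠ x' (n + m - l) := by
    intro k hk l hl hlm hkl
    have hmem : x k ∈ ({a, b} : Set V) := hW ⟨⟨k, hk, rfl⟩, hkl ▸ ⟨n + m - l, by simp; omega, rfl⟩⟩
    rw [hkl] at hmem
    rcases hmem with h | h
    · have := hx' (show n + m - l ∈ Iic m by simp; omega) (show 0 ∈ Iic m by simp) (h.trans ha'.symm)
      omega
    · have := hx' (show n + m - l ∈ Iic m by simp; omega) (show m ∈ Iic m by simp)
        (h.trans hb'.symm)
      omega
  have hecross : ∀ k < n, ∀ l < m, e k ≠ e' l := fun k hk l hl hkl =>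
    disjoint_left.1 hP ⟨k, hk, rfl⟩ ⟨l, hl, hkl.symm⟩
  have key : IsCycle G ((fun k => if k < n then e k else e' (n + m - 1 - k)) '' Iio (n + m)) := by
    refine IsCycle.of_nat (x := fun k => if k ≤ n then x k else x' (n + m - k)) (by omega)
      ?_ ?_ ?_ ?_
    · intro k hk l hl hkl
      simp only [mem_Iio] at hk hl
      simp only at hkl
      split_ifs at hkl with h1 h2 h2
      · exact hx h1 h2 hkl
      · exact (hcross k h1 l (by omega) hl hkl).elim
      · exact (hcross l h2 k (by omega) hk hkl.symm).elim
      · have := hx' (show n + m - k ∈ Iic m by simp; omega) (show n + m - l ∈ Iic m by simp; omega)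
          hkl
        omega
    · intro k hk l hl hkl
      simp only [mem_Iio] at hk hl
      simp only at hkl
      split_ifs at hkl with h1 h2 h2
      · exact he h1 h2 hkl
      · exact (hecross _ h1 _ (by omega) hkl).elim
      · exact (hecross _ h2 _ (by omega) hkl.symm).elim
      · have := he' (show n + m - 1 - k ∈ Iio m by simp; omega)
          (show n + m - 1 - l ∈ Iio m by simp; omega) hkl
        omega
    · intro k hk
      by_cases h1 : k < n
      · simp only [h1, h1.le, if_true, show k + 1 ≤ n from h1]
        exact hl k h1
      · have h2 : ¬ k + 1 ≤ n := by omega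
        have h3 : (if k ≤ n then x k else x' (n + m - k)) = x' (n + m - k) := by
          split_ifs with h
          · obtain rfl : k = n := by omega
            rw [hb, show k + m - k = m by omega, hb']
          · rfl
        simp only [h1, h2, if_false]
        rw [h3]
        have := (hl' (n + m - 1 - k) (by omega)).symm
        rw [show n + m - 1 - k + 1 = n + m - k by omega] at this
        rwa [show n + m - (k + 1) = n + m - 1 - k by omega]
    · simp [hm, ha, ha']
  convert key using 1
  ext f
  constructor
  · rintro (⟨k, hk, rfl⟩ | ⟨k, hk, rfl⟩)
    · simp only [mem_Iio] at hk
      exact ⟨k, by simp; omega, by simp [hk]⟩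
    · simp only [mem_Iio] at hk
      refine ⟨n + m - 1 - k, by simp; omega, ?_⟩
      simp only [show ¬ n + m - 1 - k < n by omega, if_false]
      congr 1; omega
  · rintro ⟨k, hk, rfl⟩
    simp only [mem_Iio] at hk
    by_cases h1 : k < n
    · exact Or.inl ⟨k, h1, by simp [h1]⟩
    · exact Or.inr ⟨n + m - 1 - k, by simp; omega, by simp [h1]⟩

end Gluing

section Units

universe x y

variable {α : Type x} {ι : Type y} {E : Set α} {q : α → ι} {T : Set ι}

/-- The minimal sets that are full at some leg. -/
def IsLegUnit (E : Set α) (q : α → ι) (T : Set ι) (U : Set α) : Prop :=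
  (∃ e ∈ E, q e ∈ T ∧ U = {e}) ∨ ∃ e ∈ E, ∃ f ∈ E, e ≠ f ∧ q e = q f ∧ q e ∉ T ∧ U = {e, f}

lemma FullLeg.of_fiber_subset {X Y : Set α} {i : ι} (h : FullLeg q T ∅ X i)
    (hXY : ∀ e ∈ X, q e = i → e ∈ Y) : FullLeg q T ∅ Y i := by
  rcases h with h | ⟨h, e, he, hq⟩ | ⟨e, he, f, hf, hne, hqe, hqf⟩
  · exact h.elim
  · exact Or.inr (Or.inl ⟨h, e, hXY e he hq, hq⟩)
  · exact Or.inr (Or.inr ⟨e, hXY e he hqe, f, hXY f hf hqf, hne, hqe, hqf⟩)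

lemma FullLeg.exists_mem {X : Set α} {i : ι} (h : FullLeg q T ∅ X i) : ∃ e ∈ X, q e = i := by
  rcases h with h | ⟨h, e, he, hq⟩ | ⟨e, he, f, hf, hne, hqe, hqf⟩
  · exact h.elim
  · exact ⟨e, he, hq⟩
  · exact ⟨e, he, hqe⟩

lemma IsTransversal.not_fullLeg {b : Set α} (hb : IsTransversal E q T b) (i : ι) :
    ¬ FullLeg q T ∅ b i := by
  rintro (h | ⟨h, e, he, rfl⟩ | ⟨e, he, f, hf, hne, hqe, hqf⟩)
  · exact h
  · exact hb.notMem he h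
  · exact hne (hb.inj he hf (hqe.trans hqf.symm))

lemma IsLegUnit.subset {U : Set α} (h : IsLegUnit E q T U) : U ⊆ E := by
  rcases h with ⟨e, he, -, rfl⟩ | ⟨e, he, f, hf, -, -, -, rfl⟩
  · simpa using he
  · exact insert_subset he (by simpa using hf)

lemma IsLegUnit.exists_fullLeg {U : Set α} (h : IsLegUnit E q T U) :
    ∃ i, FullLeg q T ∅ U i ∧ ∀ e ∈ U, q e = i := by
  rcases h with ⟨e, he, ht, rfl⟩ | ⟨e, he, f, hf, hne, hq, ht, rfl⟩
  · exact ⟨q e, Or.inr (Or.inl ⟨ht, e, rfl, rfl⟩), by simp⟩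
  · exact ⟨q e, Or.inr (Or.inr ⟨e, by simp, f, by simp, hne, rfl, hq.symm⟩), by simp [hq]⟩

lemma IsLegUnit.not_isTransversal {U : Set α} (h : IsLegUnit E q T U) :
    ¬ IsTransversal E q T U := fun h' => by
  obtain ⟨i, hi, -⟩ := h.exists_fullLeg
  exact h'.not_fullLeg i hi

lemma FullLeg.exists_unit {X : Set α} {i : ι} (h : FullLeg q T ∅ X i) (hX : X ⊆ E) :
    ∃ U ⊆ X, IsLegUnit E q T U ∧ ∀ e ∈ U, q e = i := by
  by_cases hi : i ∈ T
  · obtain ⟨e, he, rfl⟩ := h.exists_mem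
    exact ⟨{e}, by simpa using he, Or.inl ⟨e, hX he, hi, rfl⟩, by simp⟩
  rcases h with h | ⟨h, -⟩ | ⟨e, he, f, hf, hne, hqe, hqf⟩
  · exact h.elim
  · exact (hi h).elim
  · subst hqe
    exact ⟨{e, f}, insert_subset he (by simpa using hf),
      Or.inr ⟨e, hX he, f, hX hf, hne, hqf.symm, hi, rfl⟩, by simp [hqf]⟩

variable (hlab : IsLegLabelling E q T)
include hlab

lemma IsLegLabelling.mem_unit {U : Set α} (h : IsLegUnit E q T U) {i : ι} (hi : ∀ e ∈ U, q e = i)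
    {g : α} (hg : g ∈ E) (hgi : q g = i) : g ∈ U := by
  rcases h with ⟨e, he, ht, rfl⟩ | ⟨e, he, f, hf, hne, hq, ht, rfl⟩
  · exact (hlab.fiber_one e he g hg ((hi e rfl).trans hgi.symm) ht).symm
  · rcases hlab.fiber_two e he f hf g hg hq ((hi e (by simp)).trans hgi.symm) with h | rfl | rfl
    · exact (hne h).elim
    · simp
    · simp

lemma IsLegLabelling.unit_ext {U W : Set α} (hU : IsLegUnit E q T U) (hW : IsLegUnit E q T W)
    {i : ι} (hi : ∀ e ∈ U, q e = i) (hi' : ∀ e ∈ W, q e = i) : U = W :=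
  Subset.antisymm (fun e he => hlab.mem_unit hW hi' (hU.subset he) (hi e he))
    (fun e he => hlab.mem_unit hU hi (hW.subset he) (hi' e he))

lemma IsLegLabelling.unit_sdiff {U : Set α} (hU : IsLegUnit E q T U) {e : α} (he : e ∈ U)
    (i : ι) : ¬ FullLeg q T ∅ (U \ {e}) i := by
  intro hf
  obtain ⟨j, -, hj⟩ := hU.exists_fullLeg
  obtain ⟨W, hWU, hW, hWi⟩ := hf.exists_unit (sdiff_subset.trans hU.subset)
  obtain ⟨k, hk, -⟩ := hW.exists_fullLeg
  obtain ⟨g, hg, -⟩ := hk.exists_mem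
  have hij : i = j := (hWi g hg).symm.trans (hj g (hWU hg).1)
  subst hij
  rw [hlab.unit_ext hW hU hWi hj] at hWU
  exact (hWU he).2 rfl

omit hlab in
/-- The sets `P`, `Q` are parts of a unit. -/
lemma IsLegUnit.parts {P Q : Set α} (h : IsLegUnit E q T (P ∪ Q)) (hP : P.Nonempty)
    (hQ : Q.Nonempty) (hPQ : Disjoint P Q) :
    ∃ e ∈ E, ∃ f ∈ E, e ≠ f ∧ q e = q f ∧ q e ∉ T ∧ P = {e} ∧ Q = {f} := by
  obtain ⟨a, ha⟩ := hP
  obtain ⟨b, hb⟩ := hQ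
  have hab : a ≠ b := fun h => disjoint_left.1 hPQ ha (h ▸ hb)
  have haE : a ∈ E := h.subset (Or.inl ha)
  have hbE : b ∈ E := h.subset (Or.inr hb)
  have hcov : (∀ c ∈ P ∪ Q, c = a ∨ c = b) ∧ q a = q b ∧ q a ∉ T := by
    rcases h with ⟨e, he, ht, h⟩ | ⟨e, he, f, hf, hne, hq, ht, h⟩
    · have h1 : a ∈ ({e} : Set α) := h ▸ Or.inl ha
      have h2 : b ∈ ({e} : Set α) := h ▸ Or.inr hb
      exact (hab (h1.trans h2.symm)).elim
    · have h1 : a ∈ ({e, f} : Set α) := h ▸ Or.inl ha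
      have h2 : b ∈ ({e, f} : Set α) := h ▸ Or.inr hb
      rw [h]
      rcases h1 with rfl | rfl <;> rcases h2 with rfl | rfl
      · exact (hab rfl).elim
      · exact ⟨fun c hc => hc, hq, ht⟩
      · exact ⟨fun c hc => hc.symm, hq.symm, hq ▸ ht⟩
      · exact (hab rfl).elim
  refine ⟨a, haE, b, hbE, hab, hcov.2.1, hcov.2.2, Subset.antisymm (fun c hc => ?_) (by simpa),
    Subset.antisymm (fun c hc => ?_) (by simpa)⟩
  · rcases hcov.1 c (Or.inl hc) with h | rfl
    · exact h
    · exact (disjoint_left.1 hPQ hc hb).elim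
  · rcases hcov.1 c (Or.inr hc) with rfl | h
    · exact (disjoint_left.1 hPQ ha hc).elim
    · exact h

lemma IsLegLabelling.not_two_units {P Q R : Set α} (hP : P.Nonempty) (hQ : Q.Nonempty)
    (hR : R.Nonempty) (hPQ : Disjoint P Q) (hPR : Disjoint P R) (hQR : Disjoint Q R)
    (h : IsLegUnit E q T (P ∪ Q)) (h' : IsLegUnit E q T (P ∪ R)) : False := by
  obtain ⟨e, he, f, hf, hef, hq, -, rfl, rfl⟩ := h.parts hP hQ hPQ
  obtain ⟨e', he', g, hg, heg, hq', -, h1, rfl⟩ := h'.parts hP hR hPR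
  obtain rfl : e = e' := by simpa using h1
  rcases hlab.fiber_two e he f hf g hg hq hq' with h | h | h
  · exact hef h
  · exact heg h
  · exact disjoint_left.1 hQR rfl h

omit hlab in
lemma IsLegUnit.insert_of_union {P Q R : Set α} (hP : P.Nonempty) (hQ : Q.Nonempty)
    (hPQ : Disjoint P Q) (hQR : Disjoint Q R)
    (h : IsLegUnit E q T (P ∪ Q)) (h' : IsTransversal E q T (P ∪ R)) :
    ∃ C e, IsTransversal E q T C ∧ e ∈ E ∧ e ∉ C ∧ q e ∉ T ∧ P ∪ Q ∪ R = insert e C := by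
  obtain ⟨e, he, f, hf, hef, hq, ht, rfl, rfl⟩ := h.parts hP hQ hPQ
  refine ⟨{e} ∪ R, f, h', hf, ?_, hq ▸ ht, by ext; simp; tauto⟩
  rintro (h | h)
  · exact hef h.symm
  · exact disjoint_left.1 hQR rfl h

/-- Three sets that pairwise form units or transversals. -/
lemma IsLegLabelling.theta_parts {P Q R : Set α} (hP : P.Nonempty) (hQ : Q.Nonempty)
    (hR : R.Nonempty) (hPQ : Disjoint P Q) (hPR : Disjoint P R) (hQR : Disjoint Q R)
    (h1 : IsLegUnit E q T (P ∪ Q) ∨ IsTransversal E q T (P ∪ Q))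
    (h2 : IsLegUnit E q T (P ∪ R) ∨ IsTransversal E q T (P ∪ R))
    (h3 : IsLegUnit E q T (Q ∪ R) ∨ IsTransversal E q T (Q ∪ R)) :
    ∃ C e, IsTransversal E q T C ∧ e ∈ E ∧ e ∉ C ∧ q e ∉ T ∧ P ∪ Q ∪ R = insert e C := by
  rcases h1 with h1 | h1
  · rcases h2 with h2 | h2
    · exact (hlab.not_two_units hP hQ hR hPQ hPR hQR h1 h2).elim
    · exact h1.insert_of_union hP hQ hPQ hQR h2
  · rcases h2 with h2 | h2
    · obtain ⟨C, e, hC⟩ := h2.insert_of_union hP hR hPR hQR.symm h1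
      exact ⟨C, e, by rwa [union_right_comm]⟩
    · rcases h3 with h3 | h3
      · rw [union_comm] at h1
        obtain ⟨C, e, hC⟩ := h3.insert_of_union hQ hR hQR hPR.symm h1
        exact ⟨C, e, by rwa [union_assoc, union_comm P]⟩
      · obtain ⟨e, he⟩ := hQ
        obtain ⟨f, hf, hq⟩ := h2.exists_mem (h1.notMem (Or.inr he))
        rcases hf with hf | hf
        · exact (disjoint_left.1 hPQ hf (h1.inj (Or.inr he) (Or.inl hf) hq.symm ▸ he)).elim
        · exact (disjoint_left.1 hQR (h3.inj (Or.inl he) (Or.inr hf) hq.symm ▸ he) hf).elim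

end Units

end SpikeMinor

namespace SpikeMinor

universe x y z

variable {V : Type x} {α : Type y} {ι : Type z}

/-- `G` consists of vertices `x i` in cyclic order, at most two edges from `x i` to `x (i + 1)`,
which have the label `y i`, and loops, which have distinct labels in `T`. -/
structure IsRing (G : Graph V α) (n : ℕ) (x : ZMod n → V) (y : ZMod n → ι) (q : α → ι)
    (T : Set ι) : Prop where
  two_le : 2 ≤ n
  inj_vertex : Function.Injective x
  vertexSet_eq : G.vertexSet = range x
  inj_label : Function.Injective y
  range_label : range y = Tᶜ
  link : ∀ e ∈ G.edgeSet, ∀ i, q e = y i → G.IsLink e (x i) (x (i + 1))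
  loop : ∀ e ∈ G.edgeSet, q e ∈ T → ∃ a, G.IsLink e a a
  labelling : IsLegLabelling G.edgeSet q T

lemma zmod_two_eq_zero {n : ℕ} (hn : 2 ≤ n) (h : (2 : ZMod n) = 0) : n = 2 := by
  have : ((2 : ℕ) : ZMod n) = 0 := by exact_mod_cast h
  rw [ZMod.natCast_eq_zero_iff] at this
  exact le_antisymm (Nat.le_of_dvd (by norm_num) this) hn

namespace IsRing

variable {G : Graph V α} {n : ℕ} {x : ZMod n → V} {y : ZMod n → ι} {q : α → ι} {T : Set ι}
  (h : IsRing G n x y q T)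
include h

lemma neZero : NeZero n := ⟨by have := h.two_le; omega⟩

lemma fact : Fact (1 < n) := ⟨h.two_le⟩

lemma label_notMem (i : ZMod n) : y i ∉ T := by
  have : y i ∈ Tᶜ := h.range_label ▸ mem_range_self i
  exact this

lemma exists_label {j : ι} (hj : j ∉ T) : ∃ i, y i = j := by
  have : j ∈ range y := h.range_label ▸ hj
  exact this

lemma vertex_ne (i : ZMod n) : x i ≠ x (i + 1) := fun hi => by
  have := h.fact
  have h1 := h.inj_vertex hi
  exact one_ne_zero (left_eq_add.1 h1)

lemma exists_link_of_ne {e : α} {a b : ZMod n} (hl : G.IsLink e (x a) (x b)) (hab : a ≠ b) :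
    ∃ i, q e = y i ∧ (a = i ∧ b = i + 1 ∨ a = i + 1 ∧ b = i) := by
  by_cases ht : q e ∈ T
  · obtain ⟨c, hc⟩ := h.loop e hl.edge_mem ht
    rcases hl.eq_and_eq_or_eq_and_eq hc with ⟨h1, h2⟩ | ⟨h1, h2⟩ <;>
      exact (hab (h.inj_vertex (h1.trans h2.symm))).elim
  · obtain ⟨i, hi⟩ := h.exists_label ht
    refine ⟨i, hi.symm, ?_⟩
    rcases hl.eq_and_eq_or_eq_and_eq (h.link e hl.edge_mem i hi.symm) with ⟨h1, h2⟩ | ⟨h1, h2⟩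
    · exact Or.inl ⟨h.inj_vertex h1, h.inj_vertex h2⟩
    · exact Or.inr ⟨h.inj_vertex h1, h.inj_vertex h2⟩

lemma isTransversal_of_walk {m : ℕ} {v : ZMod m → ZMod n} {e : ZMod m → α}
    (hv : Function.Bijective v) (he : ∀ k, e k ∈ G.edgeSet) (hq : ∀ k, q (e k) = y (v k)) :
    IsTransversal G.edgeSet q T (range e) := by
  refine ⟨by rintro _ ⟨k, rfl⟩; exact he k, ?_, ?_, ?_⟩
  · rintro _ ⟨k, rfl⟩
    rw [hq]; exact h.label_notMem _
  · rintro _ ⟨k, rfl⟩ _ ⟨l, rfl⟩ hkl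
    rw [hq, hq] at hkl
    rw [hv.1 (h.inj_label hkl)]
  · intro j hj
    obtain ⟨i, rfl⟩ := h.exists_label hj
    obtain ⟨k, rfl⟩ := hv.2 i
    exact ⟨e k, ⟨k, rfl⟩, hq k⟩

omit h in
lemma surjective_of_add_one {S : Set (ZMod n)} [NeZero n] (hS : S.Nonempty)
    (h1 : ∀ i ∈ S, i + 1 ∈ S) : S = univ := by
  obtain ⟨a, ha⟩ := hS
  have : ∀ k : ℕ, a + k ∈ S := by
    intro k
    induction k with
    | zero => simpa using ha
    | succ k ih =>
      have := h1 _ ih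
      rwa [add_assoc, ← Nat.cast_succ] at this
  refine eq_univ_of_forall fun b => ?_
  have := this (b - a).val
  rwa [ZMod.natCast_zmod_val, add_sub_cancel] at this

lemma unit_or_transversal {C : Set α} (hC : IsCycle G C) :
    IsLegUnit G.edgeSet q T C ∨ IsTransversal G.edgeSet q T C := by
  have := h.neZero
  have := h.fact
  obtain ⟨m, z, e, hm, hz, he, hl, rfl⟩ := hC
  have : NeZero m := ⟨hm⟩
  have hv : ∀ k, ∃ a, x a = z k := fun k => by
    have : z k ∈ range x := h.vertexSet_eq ▸ (hl k).left_mem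
    exact this
  choose v hv using hv
  obtain rfl : z = fun k => x (v k) := (funext hv).symm
  have hvinj : Function.Injective v := fun a b hab => hz (congrArg x hab)
  rcases Nat.lt_or_ge m 2 with hm2 | hm2
  · obtain rfl : m = 1 := by omega
    refine Or.inl (Or.inl ⟨e 0, (hl 0).edge_mem, ?_, ?_⟩)
    · by_contra ht
      obtain ⟨i, hi⟩ := h.exists_label ht
      have h1 := hl 0
      rw [Subsingleton.elim (0 + 1 : ZMod 1) 0] at h1
      rcases h1.eq_and_eq_or_eq_and_eq (h.link _ h1.edge_mem i hi.symm) with ⟨h1, h2⟩ | ⟨h1, h2⟩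
      · exact h.vertex_ne i (h1.symm.trans h2)
      · exact h.vertex_ne i (h2.symm.trans h1)
    · ext f
      constructor
      · rintro ⟨i, rfl⟩; rw [Subsingleton.elim i 0]; rfl
      · rintro rfl; exact ⟨0, rfl⟩
  have hm1 : (1 : ZMod m) ≠ 0 := by
    have : Fact (1 < m) := ⟨hm2⟩
    exact one_ne_zero
  have hstep : ∀ k, v k ≠ v (k + 1) := fun k hk => hm1 (left_eq_add.1 (hvinj hk))
  rcases Nat.lt_or_ge m 3 with hm3 | hm3
  · obtain rfl : m = 2 := by omega
    have hz2 : ∀ k : ZMod 2, k = 0 ∨ k = 1 := by decide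
    have hr : range e = {e 0, e 1} := by
      ext f
      constructor
      · rintro ⟨i, rfl⟩
        rcases hz2 i with rfl | rfl
        · exact Or.inl rfl
        · exact Or.inr rfl
      · rintro (rfl | rfl) <;> exact ⟨_, rfl⟩
    have h0 := hl 0
    have h1 := hl 1
    rw [show (0 + 1 : ZMod 2) = 1 by decide] at h0
    rw [show (1 + 1 : ZMod 2) = 0 by decide] at h1
    have hne : v 0 ≠ v 1 := by simpa using hstep 0
    obtain ⟨i, hqi, hi⟩ := h.exists_link_of_ne h0 hne
    obtain ⟨j, hqj, hj⟩ := h.exists_link_of_ne h1 hne.symm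
    by_cases hij : i = j
    · subst hij
      refine Or.inl (Or.inr ⟨e 0, h0.edge_mem, e 1, h1.edge_mem, fun h => by simpa using he h,
        hqi.trans hqj.symm, hqi ▸ h.label_notMem i, hr⟩)
    · right
      have hn : n = 2 := by
        refine zmod_two_eq_zero h.two_le ?_
        rcases hi with ⟨h1, h2⟩ | ⟨h1, h2⟩ <;> rcases hj with ⟨h3, h4⟩ | ⟨h3, h4⟩
        · rw [h1] at h4; rw [h2] at h3
          have : i + 2 = i := by rw [← one_add_one_eq_two, ← add_assoc, h3, ← h4]
          simpa using this
        · exact (hij (h1.symm.trans h4)).elim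
        · exact (hij (h2.symm.trans h3)).elim
        · rw [h1] at h4; rw [h2] at h3
          have : i + 2 = i := by rw [← one_add_one_eq_two, ← add_assoc, h4, ← h3]
          simpa using this
      subst hn
      have hb : ∀ i j : ZMod 2, i ≠ j → Function.Bijective (fun k : ZMod 2 => if k = 0 then i else j) := by
        decide
      refine h.isTransversal_of_walk (hb i j hij) (fun k => (hl k).edge_mem) fun k => ?_
      rcases hz2 k with rfl | rfl
      · rw [if_pos rfl]; exact hqi
      · rw [if_neg (by decide)]; exact hqj
  -- cycles with at least three vertices go around the ring
  right
  have hm2' : (2 : ZMod m) ≠ 0 := fun h2 => by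
    have := zmod_two_eq_zero hm2 h2
    omega
  have hmn : m ≤ n := by
    have := Nat.card_le_card_of_injective v hvinj
    simpa using this
  have hn2 : (2 : ZMod n) ≠ 0 := fun h2 => by
    have := zmod_two_eq_zero h.two_le h2
    omega
  have hedge : ∀ k, (v (k + 1) = v k + 1 ∧ q (e k) = y (v k)) ∨
      (v k = v (k + 1) + 1 ∧ q (e k) = y (v (k + 1))) := by
    intro k
    obtain ⟨i, hqi, ⟨h1, h2⟩ | ⟨h1, h2⟩⟩ := h.exists_link_of_ne (hl k) (hstep k)
    · left; rw [h1, h2]; exact ⟨rfl, hqi⟩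
    · right; rw [h1, h2]; exact ⟨rfl, hqi⟩
  have hnot : ∀ k, v (k + 1 + 1) ≠ v k := fun k hk => by
    have := hvinj hk
    rw [add_assoc, one_add_one_eq_two] at this
    exact hm2' (by simpa using this)
  have hboth : ∀ k, ¬ (v (k + 1) = v k + 1 ∧ v k = v (k + 1) + 1) := by
    rintro k ⟨h1, h2⟩
    rw [h1, add_assoc, one_add_one_eq_two] at h2
    exact hn2 (by simpa using h2)
  by_cases hdir : ∃ k, v (k + 1) = v k + 1
  · have hS : {k | v (k + 1) = v k + 1} = univ := by
      refine surjective_of_add_one hdir fun k hk => ?_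
      rcases hedge (k + 1) with ⟨h1, -⟩ | ⟨h1, -⟩
      · exact h1
      · refine (hnot k ?_).elim
        rw [hk] at h1
        exact (add_right_cancel h1).symm
    have hS' : ∀ k, v (k + 1) = v k + 1 := fun k => by
      have : k ∈ {k | v (k + 1) = v k + 1} := hS ▸ mem_univ k
      exact this
    have hsurj : range v = univ := by
      refine surjective_of_add_one (range_nonempty v) ?_
      rintro _ ⟨k, rfl⟩
      exact ⟨k + 1, hS' k⟩
    refine h.isTransversal_of_walk ⟨hvinj, range_eq_univ.1 hsurj⟩ (fun k => (hl k).edge_mem)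
      fun k => ?_
    rcases hedge k with ⟨-, h2⟩ | ⟨h1, h2⟩
    · exact h2
    · exact (hboth k ⟨hS' k, h1⟩).elim
  · push Not at hdir
    have hS' : ∀ k, v k = v (k + 1) + 1 ∧ q (e k) = y (v (k + 1)) := fun k =>
      (hedge k).resolve_left fun h => hdir k h.1
    have hsurj : range v = univ := by
      refine surjective_of_add_one (range_nonempty v) ?_
      rintro _ ⟨k, rfl⟩
      refine ⟨k - 1, ?_⟩
      have := (hS' (k - 1)).1
      rwa [sub_add_cancel] at this
    refine h.isTransversal_of_walk (v := fun k => v (k + 1)) ?_ (fun k => (hl k).edge_mem)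
      fun k => (hS' k).2
    exact (show Function.Bijective v from ⟨hvinj, range_eq_univ.1 hsurj⟩).comp
      (Equiv.addRight (1 : ZMod m)).bijective

lemma isCycle_unit {C : Set α} (hC : IsLegUnit G.edgeSet q T C) : IsCycle G C := by
  rcases hC with ⟨e, he, ht, rfl⟩ | ⟨e, he, f, hf, hne, hq, ht, rfl⟩
  · obtain ⟨a, ha⟩ := h.loop e he ht
    refine ⟨1, fun _ => a, fun _ => e, one_ne_zero, fun i j _ => Subsingleton.elim i j,
      fun i j _ => Subsingleton.elim i j, fun _ => ha, by simp⟩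
  · obtain ⟨i, hi⟩ := h.exists_label ht
    have h1 := h.link e he i hi.symm
    have h2 := h.link f hf i (hq ▸ hi.symm)
    have hz : ∀ k : ZMod 2, k = 0 ∨ k = 1 := by decide
    have h10 : (1 : ZMod 2) ≠ 0 := by decide
    refine ⟨2, fun k => if k = 0 then x i else x (i + 1), fun k => if k = 0 then e else f,
      two_ne_zero, ?_, ?_, ?_, ?_⟩
    · intro k l hkl
      rcases hz k with rfl | rfl <;> rcases hz l with rfl | rfl
      · rfl
      · simp only [if_true, h10, if_false] at hkl; exact (h.vertex_ne i hkl).elim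
      · simp only [if_true, h10, if_false] at hkl; exact (h.vertex_ne i hkl.symm).elim
      · rfl
    · intro k l hkl
      rcases hz k with rfl | rfl <;> rcases hz l with rfl | rfl
      · rfl
      · simp only [if_true, h10, if_false] at hkl; exact (hne hkl).elim
      · simp only [if_true, h10, if_false] at hkl; exact (hne hkl.symm).elim
      · rfl
    · intro k
      rcases hz k with rfl | rfl
      · simpa using h1
      · simpa [show (1 + 1 : ZMod 2) = 0 by decide] using h2.symm
    · ext g
      constructor
      · rintro (rfl | rfl)
        · exact ⟨0, by simp⟩
        · exact ⟨1, by simp⟩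
      · rintro ⟨k, rfl⟩
        rcases hz k with rfl | rfl <;> simp

lemma exists_section {C : Set α} (hC : IsTransversal G.edgeSet q T C) :
    ∃ g : ZMod n → α, (∀ i, g i ∈ C ∧ q (g i) = y i) ∧ C = range g := by
  have : ∀ i, ∃ e, e ∈ C ∧ q e = y i := fun i => hC.exists_mem (h.label_notMem i)
  choose g hg using this
  refine ⟨g, hg, Subset.antisymm (fun e he => ?_) ?_⟩
  · obtain ⟨i, hi⟩ := h.exists_label (hC.notMem he)
    exact ⟨i, hC.inj (hg i).1 he ((hg i).2.trans hi)⟩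
  · rintro _ ⟨i, rfl⟩; exact (hg i).1

lemma isCycle_transversal {C : Set α} (hC : IsTransversal G.edgeSet q T C) : IsCycle G C := by
  obtain ⟨g, hg, rfl⟩ := h.exists_section hC
  refine ⟨n, x, g, h.neZero.ne, h.inj_vertex, fun i j hij => ?_, fun i => ?_, rfl⟩
  · have := (hg i).2
    rw [hij, (hg j).2] at this
    exact (h.inj_label this).symm
  · exact h.link _ (hC.1 (hg i).1) i (hg i).2

theorem isCycle_iff {C : Set α} :
    IsCycle G C ↔ IsLegUnit G.edgeSet q T C ∨ IsTransversal G.edgeSet q T C :=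
  ⟨h.unit_or_transversal, fun hC => hC.elim h.isCycle_unit h.isCycle_transversal⟩

lemma exists_insert_of_isTheta {X : Set α} (hX : IsTheta G X) :
    ∃ C e, IsTransversal G.edgeSet q T C ∧ e ∈ G.edgeSet ∧ e ∉ C ∧ q e ∉ T ∧ X = insert e C := by
  obtain ⟨a, b, W, P, hab, hP, hd, rfl⟩ := hX
  have hne := fun i => (hP i).nonempty hab
  have hcyc : ∀ i j, i ≠ j → IsLegUnit G.edgeSet q T (P i ∪ P j) ∨
      IsTransversal G.edgeSet q T (P i ∪ P j) := fun i j hij =>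
    h.unit_or_transversal ((hP i).isCycle_union hab (hP j) (hd i j hij).1 (hd i j hij).2)
  have hU : ⋃ i, P i = P 0 ∪ P 1 ∪ P 2 := by
    ext e
    simp [Fin.exists_fin_succ, or_assoc]
  rw [hU]
  exact h.labelling.theta_parts (hne 0) (hne 1) (hne 2) (hd 0 1 (by simp)).2 (hd 0 2 (by simp)).2
    (hd 1 2 (by simp)).2 (hcyc 0 1 (by simp)) (hcyc 0 2 (by simp)) (hcyc 1 2 (by simp))

omit h in
lemma isPath_single {a b : V} {e : α} (hl : G.IsLink e a b) (hab : a ≠ b) :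
    IsPath G a b {a, b} {e} := by
  refine ⟨1, ![a, b], ![e], ?_, ?_, rfl, rfl, ?_, ?_⟩
  · intro i j hij
    fin_cases i <;> fin_cases j <;> simp_all
  · intro i
    fin_cases i
    simpa using hl
  · simp [pair_comm]
  · simp

lemma isTheta_insert {C : Set α} {e : α} (hC : IsTransversal G.edgeSet q T C)
    (he : e ∈ G.edgeSet) (heC : e ∉ C) (hq : q e ∉ T) : IsTheta G (insert e C) := by
  obtain ⟨i, hi⟩ := h.exists_label hq
  have hfact := h.fact
  have hn0 := h.neZero
  obtain ⟨g, hg, rfl⟩ := h.exists_section hC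
  have hge : g i ≠ e := fun hh => heC ⟨i, hh⟩
  have hginj : Function.Injective g := fun a b hab => by
    have := (hg a).2
    rw [hab, (hg b).2] at this
    exact (h.inj_label this).symm
  obtain ⟨m, rfl⟩ : ∃ m, n = m + 1 := ⟨n - 1, by have := h.two_le; omega⟩
  have hcast : ∀ k l : ℕ, k ≤ m → l ≤ m → i + 1 + (k : ZMod (m + 1)) = i + 1 + l → k = l := by
    intro k l hk hl hkl
    have := (ZMod.natCast_eq_natCast_iff' k l (m + 1)).1 (add_left_cancel hkl)
    rwa [Nat.mod_eq_of_lt (by omega), Nat.mod_eq_of_lt (by omega)] at this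
  have hm : i + 1 + (m : ZMod (m + 1)) = i := by
    rw [add_assoc, add_comm (1 : ZMod (m + 1)), ← Nat.cast_succ, ZMod.natCast_self, add_zero]
  have hlast : IsPath G (x (i + 1)) (x i) (range x) (range g \ {g i}) := by
    refine ⟨m, fun j => x (i + 1 + (j.val : ZMod (m + 1))),
      fun j => g (i + 1 + (j.val : ZMod (m + 1))), ?_, ?_, ?_, ?_, ?_, ?_⟩
    · intro j k hjk
      exact Fin.ext (hcast _ _ (Nat.le_of_lt_succ j.2) (Nat.le_of_lt_succ k.2)
        (h.inj_vertex hjk))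
    · intro j
      have := h.link _ (hC.1 (hg (i + 1 + (j.val : ZMod (m + 1)))).1) _ (hg _).2
      simpa [add_assoc] using this
    · simp
    · simp [hm]
    · ext v
      constructor
      · rintro ⟨k, rfl⟩
        refine ⟨⟨(k - (i + 1)).val, ZMod.val_lt _⟩, ?_⟩
        simp
      · rintro ⟨j, rfl⟩
        exact ⟨_, rfl⟩
    · ext f
      constructor
      · rintro ⟨⟨k, rfl⟩, hk⟩
        have hlt := ZMod.val_lt (k - (i + 1))
        have hne : (k - (i + 1)).val ≠ m := by
          intro hh
          have h1 : i + 1 + ((k - (i + 1)).val : ZMod (m + 1)) = k := by simp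
          rw [hh, hm] at h1
          exact hk (by rw [h1]; rfl)
        exact ⟨⟨(k - (i + 1)).val, by omega⟩, by simp⟩
      · rintro ⟨j, rfl⟩
        refine ⟨⟨_, rfl⟩, fun hh => ?_⟩
        have h1 := hginj hh
        have h2 := hcast j.val m j.2.le le_rfl (h1.trans hm.symm)
        have := j.2
        omega
  have hne := (h.vertex_ne i).symm
  have hl1 := (h.link (g i) (hC.1 (hg i).1) i (hg i).2).symm
  have hl2 := (h.link e he i hi.symm).symm
  refine ⟨x (i + 1), x i, ![{x (i + 1), x i}, {x (i + 1), x i}, range x],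
    ![{g i}, {e}, range g \ {g i}], hne, ?_, ?_, ?_⟩
  · intro k
    fin_cases k
    · exact isPath_single hl1 hne
    · exact isPath_single hl2 hne
    · exact hlast
  · intro j k hjk
    fin_cases j <;> fin_cases k <;> first | exact (hjk rfl).elim | skip
    · exact ⟨inter_subset_left, by simpa using hge⟩
    · exact ⟨inter_subset_left, by simp⟩
    · exact ⟨inter_subset_left, by simpa using hge.symm⟩
    · exact ⟨inter_subset_left, by simp at heC ⊢; exact fun j hj => (heC j hj).elim⟩
    · exact ⟨inter_subset_right, by simp⟩
    · exact ⟨inter_subset_right, by simp at heC ⊢; exact fun j hj => (heC j hj).elim⟩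
  · ext f
    simp only [mem_insert_iff, mem_iUnion, Fin.exists_fin_succ]
    simp
    constructor
    · rintro (rfl | ⟨j, rfl⟩)
      · simp
      · by_cases hj : g j = g i
        · simp [hj]
        · simp [hj]
    · rintro (rfl | rfl | h)
      · simp
      · simp
      · exact Or.inr h.1

theorem isTheta_iff {X : Set α} : IsTheta G X ↔
    ∃ C e, IsTransversal G.edgeSet q T C ∧ e ∈ G.edgeSet ∧ e ∉ C ∧ q e ∉ T ∧ X = insert e C := by
  refine ⟨h.exists_insert_of_isTheta, ?_⟩
  rintro ⟨C, e, hC, he, heC, hq, rfl⟩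
  exact h.isTheta_insert hC he heC hq

end IsRing

end SpikeMinor

namespace SpikeMinor

universe x y z

variable {V : Type x} {α : Type y} {ι : Type z}

section Sets

variable {E : Set α} {q : α → ι} {T : Set ι}

/-- The union of two units is a minimal dependent set, provided that some leg is not met. -/
lemma IsLegLabelling.union_unit_sdiff (hlab : IsLegLabelling E q T) {B : Set (Set α)}
    (hB : ∀ b ∈ B, IsTransversal E q T b) {U W : Set α} {i j l : ι}
    (hU : IsLegUnit E q T U) (hi : ∀ e ∈ U, q e = i) (hj : ∀ e ∈ W, q e = j) (hij : i ≠ j)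
    (hl : l ∉ T) (hli : l ≠ i) (hlj : l ≠ j) {e : α} (he : e ∈ U) :
    ¬ LegDep q T ∅ B ((U ∪ W) \ {e}) := by
  have hq : ∀ f ∈ (U ∪ W) \ {e}, q f = i ∨ q f = j := fun f hf =>
    hf.1.elim (fun h => Or.inl (hi f h)) (fun h => Or.inr (hj f h))
  have hfull : ∀ k, FullLeg q T ∅ ((U ∪ W) \ {e}) k → k = j := by
    intro k hk
    obtain ⟨f, hf, rfl⟩ := hk.exists_mem
    rcases hq f hf with h | h
    · refine (hlab.unit_sdiff hU he (q f) (hk.of_fiber_subset fun g hg hgf => ⟨?_, hg.2⟩)).elim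
      exact hg.1.resolve_right fun hgW => hij (h.symm.trans (hgf.symm.trans (hj g hgW)))
    · exact h
  have hmiss : ¬ ∃ f ∈ (U ∪ W) \ {e}, q f = l := by
    rintro ⟨f, hf, rfl⟩
    exact (hq f hf).elim hli hlj
  rintro (⟨k, k', hne, hk, hk'⟩ | ⟨-, hall⟩ | ⟨b, hb, hbX⟩)
  · exact hne ((hfull k hk).trans (hfull k' hk').symm)
  · exact hmiss (hall l hl)
  · obtain ⟨f, hf, hfl⟩ := (hB b hb).exists_mem hl
    exact hmiss ⟨f, hbX hf, hfl⟩

lemma IsLegLabelling.union_unit_minimal (hlab : IsLegLabelling E q T) {B : Set (Set α)}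
    (hB : ∀ b ∈ B, IsTransversal E q T b) {U W : Set α} {i j l : ι}
    (hU : IsLegUnit E q T U) (hW : IsLegUnit E q T W)
    (hi : ∀ e ∈ U, q e = i) (hj : ∀ e ∈ W, q e = j) (hij : i ≠ j)
    (hl : l ∉ T) (hli : l ≠ i) (hlj : l ≠ j) :
    U ∪ W ⊆ E ∧ LegDep q T ∅ B (U ∪ W) ∧ ∀ e ∈ U ∪ W, ¬ LegDep q T ∅ B ((U ∪ W) \ {e}) := by
  refine ⟨union_subset hU.subset hW.subset, Or.inl ⟨i, j, hij, ?_, ?_⟩, ?_⟩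
  · obtain ⟨k, hk, hk'⟩ := hU.exists_fullLeg
    obtain ⟨e, he, -⟩ := hk.exists_mem
    rw [← hi e he, hk' e he]
    exact hk.mono subset_union_left
  · obtain ⟨k, hk, hk'⟩ := hW.exists_fullLeg
    obtain ⟨e, he, -⟩ := hk.exists_mem
    rw [← hj e he, hk' e he]
    exact hk.mono subset_union_right
  · rintro e (he | he)
    · exact hlab.union_unit_sdiff hB hU hi hj hij hl hli hlj he
    · rw [union_comm]
      exact hlab.union_unit_sdiff hB hW hj hi hij.symm hl hlj hli he

lemma IsTransversal.not_legDep {B : Set (Set α)} {C : Set α} (hC : IsTransversal E q T C)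
    (hB : ∀ b ∈ B, IsTransversal E q T b) (hCB : C ∉ B) : ¬ LegDep q T ∅ B C := by
  rintro (⟨k, -, -, hk, -⟩ | ⟨⟨k, hk⟩, -⟩ | ⟨b, hb, hbX⟩)
  · exact hC.not_fullLeg k hk
  · exact hC.not_fullLeg k hk
  · exact hCB ((hB b hb).eq_of_subset hC hbX ▸ hb)

/-- Removing an element from a transversal, and adding another leg at most, gives an independent
set. -/
lemma IsTransversal.insert_sdiff_not_legDep {B : Set (Set α)} {C X : Set α} {e g : α}
    (hC : IsTransversal E q T C) (hB : ∀ b ∈ B, IsTransversal E q T b) (hg : g ∈ C)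
    (hqg : q e ≠ q g) (hX : X = insert e C \ {g}) : ¬ LegDep q T ∅ B X := by
  subst hX
  have hfull : ∀ k, FullLeg q T ∅ (insert e C \ {g}) k → k = q e := by
    intro k hk
    by_contra hne
    refine hC.not_fullLeg k (hk.of_fiber_subset fun f hf hfk => hf.1.resolve_left ?_)
    rintro rfl
    exact hne hfk.symm
  have hmiss : ¬ ∃ f ∈ insert e C \ {g}, q f = q g := by
    rintro ⟨f, ⟨rfl | hf, hfg⟩, hq⟩
    · exact hqg hq
    · exact hfg (hC.inj hf hg hq)
  rintro (⟨k, k', hne, hk, hk'⟩ | ⟨-, hall⟩ | ⟨b, hb, hbX⟩)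
  · exact hne ((hfull k hk).trans (hfull k' hk').symm)
  · exact hmiss (hall _ (hC.notMem hg))
  · obtain ⟨f, hf, hfl⟩ := (hB b hb).exists_mem (hC.notMem hg)
    exact hmiss ⟨f, hbX hf, hfl⟩

lemma IsTransversal.loop_minimal {B : Set (Set α)} {C : Set α} {e : α}
    (hC : IsTransversal E q T C) (hB : ∀ b ∈ B, IsTransversal E q T b) (hCB : C ∉ B)
    (he : e ∈ E) (ht : q e ∈ T) :
    insert e C ⊆ E ∧ LegDep q T ∅ B (insert e C) ∧
      ∀ g ∈ insert e C, ¬ LegDep q T ∅ B (insert e C \ {g}) := by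
  refine ⟨insert_subset he hC.1, Or.inr (Or.inl ⟨⟨q e, Or.inr (Or.inl ⟨ht, e, by simp, rfl⟩)⟩,
    fun i hi => ?_⟩), ?_⟩
  · obtain ⟨f, hf, hq⟩ := hC.exists_mem hi
    exact ⟨f, mem_insert_of_mem _ hf, hq⟩
  · rintro g (rfl | hg)
    · exact fun hd => hC.not_legDep hB hCB (hd.mono (by simp))
    · exact hC.insert_sdiff_not_legDep hB hg (fun hq => hC.notMem hg (hq ▸ ht)) rfl

lemma IsTransversal.theta_minimal {B : Set (Set α)} {C : Set α} {e : α}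
    (hC : IsTransversal E q T C) (hB : ∀ b ∈ B, IsTransversal E q T b)
    (he : e ∈ E) (heC : e ∉ C) (ht : q e ∉ T) (hno : ∀ b ∈ B, ¬ b ⊆ insert e C) :
    insert e C ⊆ E ∧ LegDep q T ∅ B (insert e C) ∧
      ∀ g ∈ insert e C, ¬ LegDep q T ∅ B (insert e C \ {g}) := by
  obtain ⟨f, hf, hqf⟩ := hC.exists_mem ht
  have hef : e ≠ f := fun h => heC (h ▸ hf)
  refine ⟨insert_subset he hC.1, Or.inr (Or.inl ⟨⟨q e, Or.inr (Or.inr ⟨e, by simp, f, by simp [hf],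
    hef, rfl, hqf⟩)⟩, fun i hi => ?_⟩), ?_⟩
  · obtain ⟨f, hf, hq⟩ := hC.exists_mem hi
    exact ⟨f, mem_insert_of_mem _ hf, hq⟩
  · intro g hg
    have hCB : C ∉ B := fun h => hno C h (subset_insert _ _)
    by_cases hge : g = e
    · subst hge
      exact fun hd => hC.not_legDep hB hCB (hd.mono (by simp))
    have hgC : g ∈ C := hg.resolve_left hge
    by_cases hgf : g = f
    · subst hgf
      rw [insert_sdiff_of_notMem _ (by simpa using hef)]
      have h1 := hC.exchange he hf hqf.symm
      exact h1.not_legDep hB fun hb => hno _ hb (insert_subset_insert sdiff_subset)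
    · exact hC.insert_sdiff_not_legDep hB hgC (fun hq => hgf (hC.inj hgC hf (hq.symm.trans hqf.symm)))
        rfl

lemma IsTransversal.minimal_of_mem {B : Set (Set α)} {C : Set α}
    (hC : IsTransversal E q T C) (hB : ∀ b ∈ B, IsTransversal E q T b) (hCB : C ∈ B) :
    C ⊆ E ∧ LegDep q T ∅ B C ∧ ∀ g ∈ C, ¬ LegDep q T ∅ B (C \ {g}) := by
  refine ⟨hC.1, Or.inr (Or.inr ⟨C, hCB, Subset.rfl⟩), fun g hg => ?_⟩
  have hmiss : ¬ ∃ f ∈ C \ {g}, q f = q g := by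
    rintro ⟨f, ⟨hf, hfg⟩, hq⟩
    exact hfg (hC.inj hf hg hq)
  rintro (⟨k, -, -, hk, -⟩ | ⟨⟨k, hk⟩, -⟩ | ⟨b, hb, hbX⟩)
  · exact hC.not_fullLeg k (hk.mono sdiff_subset)
  · exact hC.not_fullLeg k (hk.mono sdiff_subset)
  · obtain ⟨f, hf, hfl⟩ := (hB b hb).exists_mem (hC.notMem hg)
    exact hmiss ⟨f, hbX hf, hfl⟩

end Sets

namespace IsRing

variable {G : Graph V α} {n : ℕ} {x : ZMod n → V} {y : ZMod n → ι} {q : α → ι} {T : Set ι}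

lemma support_loop {e : α} {a : V} (hl : G.IsLink e a a) : vertexSupport G {e} = {a} := by
  ext v
  constructor
  · rintro ⟨f, rfl, hv⟩
    simpa using hv.eq_or_eq_of_isLink hl
  · rintro rfl
    exact ⟨e, rfl, hl.inc_left⟩

lemma support_pair {e f : α} {a b : V} (he : G.IsLink e a b) (hf : G.IsLink f a b) :
    vertexSupport G {e, f} = {a, b} := by
  ext v
  constructor
  · rintro ⟨g, rfl | rfl, hv⟩
    · exact hv.eq_or_eq_of_isLink he
    · exact hv.eq_or_eq_of_isLink hf
  · rintro (rfl | rfl)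
    · exact ⟨e, by simp, he.inc_left⟩
    · exact ⟨e, by simp, he.inc_right⟩

variable (h : IsRing G n x y q T)
include h

lemma support_transversal {C : Set α} (hC : IsTransversal G.edgeSet q T C) :
    vertexSupport G C = range x := by
  refine Subset.antisymm ?_ ?_
  · rintro v ⟨e, -, hv⟩
    rw [← h.vertexSet_eq]
    exact hv.vertex_mem
  · rintro _ ⟨i, rfl⟩
    obtain ⟨e, he, hq⟩ := hC.exists_mem (h.label_notMem i)
    exact ⟨e, he, (h.link e (hC.1 he) i hq).inc_left⟩

lemma isHamiltonianCycle_transversal {C : Set α} (hC : IsTransversal G.edgeSet q T C) :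
    IsHamiltonianCycle G C :=
  ⟨h.isCycle_transversal hC, (h.support_transversal hC).trans h.vertexSet_eq.symm⟩

/-- A unit with a label outside `T` is supported by two consecutive vertices. -/
lemma support_unit {U : Set α} (hU : IsLegUnit G.edgeSet q T U) {i : ZMod n}
    (hi : ∀ e ∈ U, q e = y i) : vertexSupport G U = {x i, x (i + 1)} := by
  rcases hU with ⟨e, he, ht, rfl⟩ | ⟨e, he, f, hf, hne, hq, ht, rfl⟩
  · exact (h.label_notMem i (hi e rfl ▸ ht)).elim
  · exact support_pair (h.link e he i (hi e (by simp))) (h.link f hf i (hi f (by simp)))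

lemma support_unit_subsingleton {U : Set α} (hU : IsLegUnit G.edgeSet q T U) {i : ι}
    (hi : ∀ e ∈ U, q e = i) (ht : i ∈ T) : (vertexSupport G U).Subsingleton := by
  rcases hU with ⟨e, he, -, rfl⟩ | ⟨e, he, f, hf, hne, hq, ht', rfl⟩
  · obtain ⟨a, ha⟩ := h.loop e he (hi e rfl ▸ ht)
    rw [support_loop ha]
    exact subsingleton_singleton
  · exact (ht' (hi e (by simp) ▸ ht)).elim

lemma consecutive_inter {a b c : ZMod n} (hab : a ≠ b) (hca : c ≠ a) (hcb : c ≠ b) :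
    (({x a, x (a + 1)} : Set V) ∩ {x b, x (b + 1)}).Subsingleton := by
  have := h.fact
  have := h.neZero
  have hn : n ≠ 2 := by
    rintro rfl
    have : ∀ a b c : ZMod 2, a ≠ b → c ≠ a → c ≠ b → False := by decide
    exact this a b c hab hca hcb
  have hab1 : a = b + 1 → b = a + 1 → False := fun h1 h2 => by
    refine hn (zmod_two_eq_zero h.two_le ?_)
    rw [h2, add_assoc, one_add_one_eq_two] at h1
    simpa using h1
  have hi := h.inj_vertex
  rintro v ⟨hv1, hv2⟩ w ⟨hw1, hw2⟩
  rcases hv1 with rfl | rfl <;> rcases hw1 with rfl | rfl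
  · rfl
  · rcases hv2 with h1 | h1
    · exact (hab (hi h1)).elim
    · rcases hw2 with h2 | h2
      · exact (hab1 (hi h1) (hi h2).symm).elim
      · exact (hab (add_right_cancel (hi h2))).elim
  · rcases hv2 with h1 | h1
    · rcases hw2 with h2 | h2
      · exact (hab (hi h2)).elim
      · exact (hab1 (hi h2) (hi h1).symm).elim
    · exact (hab (add_right_cancel (hi h1))).elim
  · rfl

lemma exists_other_label (i : ι) : ∃ l, l ∉ T ∧ l ≠ i := by
  have := h.fact
  by_cases h0 : y 0 = i
  · refine ⟨y 1, h.label_notMem 1, fun h1 => ?_⟩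
    exact zero_ne_one (h.inj_label (h0.trans h1.symm))
  · exact ⟨y 0, h.label_notMem 0, h0⟩

lemma range_not_subsingleton : ¬ (range x).Subsingleton := fun hs =>
  h.vertex_ne 0 (hs ⟨_, rfl⟩ ⟨_, rfl⟩)

lemma not_subsingleton_unit_transversal {U C : Set α} (hU : IsLegUnit G.edgeSet q T U)
    (hC : IsTransversal G.edgeSet q T C) {i : ι} (hi : ∀ e ∈ U, q e = i)
    (hs : (vertexSupport G U ∩ vertexSupport G C).Subsingleton) : i ∈ T := by
  by_contra ht
  obtain ⟨j, rfl⟩ := h.exists_label ht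
  rw [h.support_unit hU hi, h.support_transversal hC, inter_eq_left.2] at hs
  · exact h.vertex_ne j (hs (by simp) (by simp))
  · rintro v (rfl | rfl) <;> exact ⟨_, rfl⟩

lemma exists_third_label {U W : Set α} (hU : IsLegUnit G.edgeSet q T U)
    (hW : IsLegUnit G.edgeSet q T W) {i j : ι} (hi : ∀ e ∈ U, q e = i) (hj : ∀ e ∈ W, q e = j)
    (hij : i ≠ j) (hs : (vertexSupport G U ∩ vertexSupport G W).Subsingleton) :
    ∃ l, l ∉ T ∧ l ≠ i ∧ l ≠ j := by
  by_cases hiT : i ∈ T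
  · obtain ⟨l, hl, hlj⟩ := h.exists_other_label j
    exact ⟨l, hl, fun hli => hl (hli ▸ hiT), hlj⟩
  by_cases hjT : j ∈ T
  · obtain ⟨l, hl, hli⟩ := h.exists_other_label i
    exact ⟨l, hl, hli, fun hlj => hl (hlj ▸ hjT)⟩
  obtain ⟨a, rfl⟩ := h.exists_label hiT
  obtain ⟨b, rfl⟩ := h.exists_label hjT
  rw [h.support_unit hU hi, h.support_unit hW hj] at hs
  have hab : a ≠ b := fun hab => hij (hab ▸ rfl)
  by_contra! hcon
  have hall : ∀ c, c = a ∨ c = b := fun c => by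
    by_contra! hc
    exact hc.2 (h.inj_label (hcon (y c) (h.label_notMem c) fun hca => hc.1 (h.inj_label hca)))
  have ha : a + 1 = b := (hall (a + 1)).resolve_left fun ha => h.vertex_ne a (by rw [ha])
  have hb : b + 1 = a := (hall (b + 1)).resolve_right fun hb => h.vertex_ne b (by rw [hb])
  rw [ha, hb] at hs
  exact h.inj_vertex.ne hab (hs (by simp) (by simp))

lemma isLiftCircuit_minimal {B : Set (Set α)} (hB : ∀ b ∈ B, IsTransversal G.edgeSet q T b)
    {X : Set α} (hX : IsLiftCircuit G B X) :
    X ⊆ G.edgeSet ∧ LegDep q T ∅ B X ∧ ∀ e ∈ X, ¬ LegDep q T ∅ B (X \ {e}) := by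
  rcases hX with hX | ⟨hX, hno⟩ | ⟨C, D, hC, hD, hCB, hDB, hCD, hs, rfl⟩
  · exact (hB X hX).minimal_of_mem hB hX
  · obtain ⟨C, e, hC, he, heC, ht, rfl⟩ := h.isTheta_iff.1 hX
    exact hC.theta_minimal hB he heC ht hno
  · rcases h.isCycle_iff.1 hC with hC | hC <;> rcases h.isCycle_iff.1 hD with hD | hD
    · obtain ⟨i, -, hi⟩ := hC.exists_fullLeg
      obtain ⟨j, -, hj⟩ := hD.exists_fullLeg
      have hij : i ≠ j := by
        rintro rfl
        exact hCD (h.labelling.unit_ext hC hD hi hj)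
      obtain ⟨l, hl, hli, hlj⟩ := h.exists_third_label hC hD hi hj hij hs
      exact h.labelling.union_unit_minimal hB hC hD hi hj hij hl hli hlj
    · obtain ⟨i, -, hi⟩ := hC.exists_fullLeg
      have ht := h.not_subsingleton_unit_transversal hC hD hi hs
      rcases hC with ⟨e, he, ht, rfl⟩ | ⟨e, he, f, hf, hne, hq, ht', rfl⟩
      · exact hD.loop_minimal hB hDB he ht
      · exact (ht' (hi e (by simp) ▸ ht)).elim
    · obtain ⟨i, -, hi⟩ := hD.exists_fullLeg
      have ht := h.not_subsingleton_unit_transversal hD hC hi (by rwa [inter_comm])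
      rw [union_comm]
      rcases hD with ⟨e, he, ht, rfl⟩ | ⟨e, he, f, hf, hne, hq, ht', rfl⟩
      · exact hC.loop_minimal hB hCB he ht
      · exact (ht' (hi e (by simp) ▸ ht)).elim
    · rw [h.support_transversal hC, h.support_transversal hD, inter_self] at hs
      exact (h.range_not_subsingleton hs).elim

lemma exists_isLiftCircuit {B : Set (Set α)} (hB : ∀ b ∈ B, IsTransversal G.edgeSet q T b)
    {X : Set α} (hXE : X ⊆ G.edgeSet) (hX : LegDep q T ∅ B X) :
    ∃ Y ⊆ X, IsLiftCircuit G B Y := by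
  have hunitB : ∀ U, IsLegUnit G.edgeSet q T U → U ∉ B := fun U hU hUB =>
    hU.not_isTransversal (hB U hUB)
  by_cases hb : ∃ b ∈ B, b ⊆ X
  · obtain ⟨b, hb, hbX⟩ := hb
    exact ⟨b, hbX, Or.inl hb⟩
  have hfull : ∃ i, FullLeg q T ∅ X i := by
    rcases hX with ⟨i, -, -, hi, -⟩ | ⟨hi, -⟩ | hb'
    · exact ⟨i, hi⟩
    · exact hi
    · exact (hb hb').elim
  push Not at hb
  by_cases hall : ∀ i ∉ T, ∃ e ∈ X, q e = i
  · obtain ⟨i, hi⟩ := hfull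
    obtain ⟨U, hUX, hU, hUi⟩ := hi.exists_unit hXE
    obtain ⟨C, hCX, hC⟩ := exists_transversal hXE hall
    rcases id hU with ⟨e, he, ht, rfl⟩ | ⟨e, he, f, hf, hne, hq, ht, rfl⟩
    · refine ⟨{e} ∪ C, union_subset hUX hCX, Or.inr (Or.inr ⟨_, _, h.isCycle_unit hU,
        h.isCycle_transversal hC, hunitB _ hU, fun hCB => hb C hCB hCX, ?_, ?_, rfl⟩)⟩
      · rintro rfl
        exact hU.not_isTransversal hC
      · exact (h.support_unit_subsingleton hU (i := q e) (by simp) ht).anti inter_subset_left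
    · have : ∃ g ∈ X, g ∈ G.edgeSet ∧ g ∉ C ∧ q g ∉ T := by
        by_cases heC : e ∈ C
        · exact ⟨f, hUX (by simp), hf, fun hfC => hne (hC.inj heC hfC hq), hq ▸ ht⟩
        · exact ⟨e, hUX (by simp), he, heC, ht⟩
      obtain ⟨g, hgX, hg, hgC, hgT⟩ := this
      have hsub := insert_subset hgX hCX
      exact ⟨insert g C, hsub, Or.inr (Or.inl ⟨h.isTheta_insert hC hg hgC hgT,
        fun b hbB hbs => hb b hbB (hbs.trans hsub)⟩)⟩
  · have h2 : ∃ i j, i ≠ j ∧ FullLeg q T ∅ X i ∧ FullLeg q T ∅ X j := by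
      rcases hX with h2 | ⟨-, h3⟩ | ⟨b, h3, h4⟩
      · exact h2
      · exact (hall h3).elim
      · exact (hb b h3 h4).elim
    obtain ⟨i, j, hij, hi, hj⟩ := h2
    push Not at hall
    obtain ⟨l, hl, hlX⟩ := hall
    obtain ⟨U, hUX, hU, hUi⟩ := hi.exists_unit hXE
    obtain ⟨W, hWX, hW, hWj⟩ := hj.exists_unit hXE
    refine ⟨U ∪ W, union_subset hUX hWX, Or.inr (Or.inr ⟨U, W, h.isCycle_unit hU,
      h.isCycle_unit hW, hunitB U hU, hunitB W hW, ?_, ?_, rfl⟩)⟩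
    · rintro rfl
      obtain ⟨k, hk, -⟩ := hU.exists_fullLeg
      obtain ⟨e, he, -⟩ := hk.exists_mem
      exact hij ((hUi e he).symm.trans (hWj e he))
    · by_cases hiT : i ∈ T
      · exact (h.support_unit_subsingleton hU hUi hiT).anti inter_subset_left
      by_cases hjT : j ∈ T
      · exact (h.support_unit_subsingleton hW hWj hjT).anti inter_subset_right
      obtain ⟨e, he, hei⟩ := hi.exists_mem
      obtain ⟨f, hf, hfj⟩ := hj.exists_mem
      have hli : l ≠ i := fun hli => hlX e he (hei.trans hli.symm)
      have hlj : l ≠ j := fun hlj => hlX f hf (hfj.trans hlj.symm)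
      obtain ⟨a, rfl⟩ := h.exists_label hiT
      obtain ⟨b, rfl⟩ := h.exists_label hjT
      obtain ⟨c, rfl⟩ := h.exists_label hl
      rw [h.support_unit hU hUi, h.support_unit hW hWj]
      exact h.consecutive_inter (fun hab => hij (hab ▸ rfl)) (fun hca => hli (hca ▸ rfl))
        (fun hcb => hlj (hcb ▸ rfl))

/-- The lift matroid in terms of legs. -/
theorem isLiftMatroid_iff {B : Set (Set α)} (hB : ∀ b ∈ B, IsTransversal G.edgeSet q T b)
    (M : Matroid α) [M.Finite] : IsLiftMatroid G B M ↔
      M.E = G.edgeSet ∧ ∀ I ⊆ M.E, M.Indep I ↔ ¬ LegDep q T ∅ B I := by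
  refine and_congr_right fun hE => ?_
  rw [indep_iff_iff_isCircuit_iff M (P := LegDep q T ∅ B) fun X Y hX hXY => hX.mono hXY, hE]
  refine forall_congr' fun X => ?_
  rw [subset_and_minimal_iff (fun X Y hX hXY => LegDep.mono hX hXY)
    (fun X hX => h.isLiftCircuit_minimal hB hX) (fun X hXE hX => h.exists_isLiftCircuit hB hXE hX)]

/-- The cycle matroid in terms of legs. -/
theorem isCycleMatroid_iff (M : Matroid α) [M.Finite] : IsCycleMatroid G M ↔
      M.E = G.edgeSet ∧ ∀ I ⊆ M.E, M.Indep I ↔ ¬ CycleDep q T I := by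
  refine and_congr_right fun hE => ?_
  rw [indep_iff_iff_isCircuit_iff M (P := CycleDep q T) fun X Y hX hXY => hX.mono hXY, hE]
  refine forall_congr' fun X => ?_
  rw [subset_and_minimal_iff (L := IsCycle G) (fun X Y hX hXY => CycleDep.mono hX hXY) ?_ ?_]
  · intro X hX
    rcases h.isCycle_iff.1 hX with hX | hX
    · obtain ⟨i, hi, hXi⟩ := hX.exists_fullLeg
      refine ⟨hX.subset, Or.inl ⟨i, hi⟩, fun e he hd => ?_⟩
      rcases hd with ⟨j, hj⟩ | hall
      · exact h.labelling.unit_sdiff hX he j hj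
      · obtain ⟨l, hl, hli⟩ := h.exists_other_label i
        obtain ⟨f, hf, rfl⟩ := hall l hl
        exact hli (hXi f hf.1)
    · refine ⟨hX.1, Or.inr fun i hi => hX.exists_mem hi, fun e he hd => ?_⟩
      rcases hd with ⟨j, hj⟩ | hall
      · exact hX.not_fullLeg j (hj.mono sdiff_subset)
      · obtain ⟨f, hf, hfe⟩ := hall (q e) (hX.notMem he)
        exact hf.2 (hX.inj hf.1 he hfe)
  · intro X hXE hd
    rcases hd with ⟨i, hi⟩ | hall
    · obtain ⟨U, hUX, hU, -⟩ := hi.exists_unit hXE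
      exact ⟨U, hUX, h.isCycle_unit hU⟩
    · obtain ⟨C, hCX, hC⟩ := exists_transversal hXE hall
      exact ⟨C, hCX, h.isCycle_transversal hC⟩

theorem isLinearClass_iff {B : Set (Set α)} (hB : ∀ b ∈ B, IsTransversal G.edgeSet q T b) :
    IsLinearClass G B ↔ Separated q B := by
  constructor
  · rintro ⟨-, hlin⟩ b hb c hc i hi
    by_contra hne
    have hbt := hB b hb
    have hct := hB c hc
    obtain ⟨e, he, heb⟩ : ∃ e ∈ c, e ∉ b := by
      by_contra! hsub
      exact hne (hct.eq_of_subset hbt hsub).symm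
    have hei : q e = i := by
      by_contra hei
      exact heb ((hi e hei).2 he)
    have hcsub : c ⊆ insert e b := by
      intro f hf
      by_cases hfi : q f = i
      · exact Or.inl (hct.inj hf he (hfi.trans hei.symm))
      · exact Or.inr ((hi f hfi).2 hf)
    refine hlin (insert e b) (h.isTheta_insert hbt (hct.1 he) heb (hct.notMem he)) ?_
    have : {C | C ∈ B ∧ C ⊆ insert e b} = {b, c} := by
      ext d
      constructor
      · rintro ⟨hd, hdsub⟩
        have hdt := hB d hd
        by_cases hed : e ∈ d
        · right
          refine hdt.eq_of_subset hct fun f hf => ?_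
          rcases hdsub hf with rfl | hfb
          · exact he
          · by_cases hfi : q f = i
            · rw [hdt.inj hf hed (hfi.trans hei.symm)]; exact he
            · exact (hi f hfi).1 hfb
        · left
          refine hdt.eq_of_subset hbt fun f hf => (hdsub hf).resolve_left ?_
          rintro rfl
          exact hed hf
      · rintro (rfl | rfl)
        · exact ⟨hb, subset_insert _ _⟩
        · exact ⟨hc, hcsub⟩
    rw [this, encard_pair hne]
  · intro hsep
    refine ⟨fun C hC => h.isCycle_transversal (hB C hC), fun X hX h2 => ?_⟩
    obtain ⟨C, e, hC, he, heC, ht, rfl⟩ := h.isTheta_iff.1 hX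
    obtain ⟨b, c, hbc, hset⟩ := encard_eq_two.1 h2
    have hb : b ∈ B ∧ b ⊆ insert e C := by
      have : b ∈ ({b, c} : Set (Set α)) := by simp
      rwa [← hset] at this
    have hc : c ∈ B ∧ c ⊆ insert e C := by
      have : c ∈ ({b, c} : Set (Set α)) := by simp
      rwa [← hset] at this
    have key : ∀ d ∈ B, d ⊆ insert e C → ∀ f, q f ≠ q e → (f ∈ d ↔ f ∈ C) := by
      intro d hd hdsub f hf
      have hdt := hB d hd
      refine ⟨fun hfd => (hdsub hfd).resolve_left fun hfe => hf (hfe ▸ rfl), fun hfC => ?_⟩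
      obtain ⟨g, hg, hgf⟩ := hdt.exists_mem (hC.notMem hfC)
      rcases hdsub hg with rfl | hgC
      · exact (hf hgf.symm).elim
      · rwa [← hC.inj hgC hfC hgf]
    exact hbc (hsep b hb.1 c hc.1 (q e) fun f hf =>
      (key b hb.1 hb.2 f hf).trans (key c hc.1 hc.2 f hf).symm)

end IsRing

end SpikeMinor

namespace SpikeMinor

section Isomorphism

universe x y

variable {α : Type x} {β : Type y}

lemma isomorphic_of_injOn {M : Matroid α} {N : Matroid β} {φ : α → β} (hφ : InjOn φ M.E)
    (hE : φ '' M.E = N.E) (hI : ∀ I ⊆ M.E, M.Indep I ↔ N.Indep (φ '' I)) : Isomorphic M N := by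
  let f : M.E ≃ N.E := (hφ.bijOn_image.equiv φ).trans (Equiv.setCongr hE)
  have hf : ∀ e : M.E, (f e : β) = φ e := fun e => rfl
  refine ⟨f, Matroid.ext_indep rfl fun J hJ => ?_⟩
  rw [Matroid.mapSetEquiv.ground] at hJ
  have hJ' : φ '' (Subtype.val '' (f.symm '' (Subtype.val ⁻¹' J))) = J := by
    ext b
    constructor
    · rintro ⟨_, ⟨_, ⟨c, hc, rfl⟩, rfl⟩, rfl⟩
      rw [← hf, Equiv.apply_symm_apply]
      exact hc
    · intro hb
      refine ⟨_, ⟨_, ⟨⟨b, hJ hb⟩, hb, rfl⟩, rfl⟩, ?_⟩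
      rw [← hf, Equiv.apply_symm_apply]
  rw [Matroid.mapSetEquiv_indep_iff, and_iff_left hJ, hI _ (by rintro _ ⟨e, -, rfl⟩; exact e.2), hJ']

lemma Isomorphic.exists_injOn [Nonempty β] {M : Matroid α} {N : Matroid β} (h : Isomorphic M N) :
    ∃ φ : α → β, InjOn φ M.E ∧ φ '' M.E = N.E ∧ ∀ I ⊆ M.E, (M.Indep I ↔ N.Indep (φ '' I)) := by
  classical
  obtain ⟨f, hf⟩ := h
  let φ : α → β := fun e => if h : e ∈ M.E then f ⟨e, h⟩ else Classical.arbitrary β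
  have hφ : ∀ e (h : e ∈ M.E), φ e = f ⟨e, h⟩ := fun e h => dif_pos h
  refine ⟨φ, ?_, ?_, ?_⟩
  · intro e he e' he' hee
    rw [hφ e he, hφ e' he'] at hee
    simpa using f.injective (Subtype.val_injective hee)
  · ext b
    constructor
    · rintro ⟨e, he, rfl⟩
      rw [hφ e he]
      exact (f ⟨e, he⟩).2
    · intro hb
      exact ⟨f.symm ⟨b, hb⟩, (f.symm ⟨b, hb⟩).2, by rw [hφ _ (f.symm ⟨b, hb⟩).2]; simp⟩
  · intro I hI
    rw [← hf, Matroid.mapSetEquiv_indep_iff, and_iff_left]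
    · congr! 1
      ext e
      constructor
      · intro he
        refine ⟨⟨e, hI he⟩, ⟨f ⟨e, hI he⟩, ⟨e, he, hφ e (hI he)⟩, by simp⟩, rfl⟩
      · rintro ⟨_, ⟨b, ⟨e', he', heb⟩, rfl⟩, rfl⟩
        rw [hφ e' (hI he')] at heb
        obtain rfl := Subtype.val_injective heb
        simpa using he'
    · rintro _ ⟨e, he, rfl⟩
      rw [hφ e (hI he)]
      exact (f _).2

end Isomorphism

section Transfer

universe x y z

variable {α : Type x} {ι : Type y} {κ : Type z}

/-- Contracting `C` in a spike, and restricting to the image of `φ`. -/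
lemma legDep_image_union_iff {E I : Set α} {φ : α → ι × Bool} {C : Set (ι × Bool)} {T D : Set ι}
    {B : Set (Set α)} {B' : Set (Set (ι × Bool))} (hφ : InjOn φ E) (hC : ∀ e ∈ E, φ e ∉ C)
    (hT : ∀ i, i ∈ T ↔ ∃ s, (i, s) ∈ C) (hD : ∀ i, i ∈ D ↔ ∀ s, (i, s) ∈ C)
    (hB' : ∀ b ∈ B', IsTransversal univ Prod.fst ∅ b) (hBE : ∀ b ∈ B, b ⊆ E)
    (hBB : ∀ b ⊆ E, b ∈ B ↔ φ '' b ∪ C ∈ B') (hI : I ⊆ E) :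
    LegDep Prod.fst ∅ ∅ B' (φ '' I ∪ C) ↔ LegDep (fun e => (φ e).1) T D B I := by
  have hfull : ∀ i, FullLeg Prod.fst ∅ ∅ (φ '' I ∪ C) i ↔ FullLeg (fun e => (φ e).1) T D I i := by
    intro i
    rw [fullLeg_fst_iff]
    constructor
    · rintro ⟨⟨e, he, h1⟩ | h1, ⟨f, hf, h2⟩ | h2⟩
      · refine Or.inr (Or.inr ⟨e, he, f, hf, ?_, by simp [h1], by simp [h2]⟩)
        rintro rfl
        simp [h1] at h2
      · exact Or.inr (Or.inl ⟨(hT i).2 ⟨_, h2⟩, e, he, by simp [h1]⟩)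
      · exact Or.inr (Or.inl ⟨(hT i).2 ⟨_, h1⟩, f, hf, by simp [h2]⟩)
      · refine Or.inl ((hD i).2 fun s => ?_)
        cases s
        · exact h1
        · exact h2
    · rintro (h | ⟨h, e, he, rfl⟩ | ⟨e, he, f, hf, hne, rfl, hq⟩)
      · exact ⟨Or.inr ((hD i).1 h _), Or.inr ((hD i).1 h _)⟩
      · obtain ⟨s, hs⟩ := (hT _).1 h
        have h1 := hC e (hI he)
        have h2 : φ e ∈ φ '' I := ⟨e, he, rfl⟩
        beta_reduce at hs ⊢
        generalize φ e = p at *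
        obtain ⟨i, t⟩ := p
        cases s <;> cases t
        · exact (h1 hs).elim
        · exact ⟨Or.inr hs, Or.inl h2⟩
        · exact ⟨Or.inl h2, Or.inr hs⟩
        · exact (h1 hs).elim
      · have h1 : φ e ≠ φ f := fun h => hne (hφ (hI he) (hI hf) h)
        have h2 : φ e ∈ φ '' I := ⟨e, he, rfl⟩
        have h3 : φ f ∈ φ '' I := ⟨f, hf, rfl⟩
        beta_reduce at hq ⊢
        generalize φ e = p at *
        generalize φ f = p' at *
        obtain ⟨i, t⟩ := p
        obtain ⟨j, t'⟩ := p'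
        obtain rfl : j = i := hq
        cases t <;> cases t'
        · exact (h1 rfl).elim
        · exact ⟨Or.inl h2, Or.inl h3⟩
        · exact ⟨Or.inl h3, Or.inl h2⟩
        · exact (h1 rfl).elim
  have hmet : (∀ i ∉ (∅ : Set ι), ∃ p ∈ φ '' I ∪ C, p.1 = i) ↔
      ∀ i ∉ T, ∃ e ∈ I, (φ e).1 = i := by
    constructor
    · intro h i hi
      obtain ⟨p, ⟨e, he, rfl⟩ | hp, rfl⟩ := h i (notMem_empty _)
      · exact ⟨e, he, rfl⟩
      · exact (hi ((hT _).2 ⟨p.2, hp⟩)).elim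
    · intro h i _
      by_cases hi : i ∈ T
      · obtain ⟨s, hs⟩ := (hT i).1 hi
        exact ⟨_, Or.inr hs, rfl⟩
      · obtain ⟨e, he, rfl⟩ := h i hi
        exact ⟨φ e, Or.inl ⟨e, he, rfl⟩, rfl⟩
  constructor
  · rintro (⟨i, j, hij, hi, hj⟩ | ⟨⟨i, hi⟩, h⟩ | ⟨b, hb, hbI⟩)
    · exact Or.inl ⟨i, j, hij, (hfull i).1 hi, (hfull j).1 hj⟩
    · exact Or.inr (Or.inl ⟨⟨i, (hfull i).1 hi⟩, hmet.1 h⟩)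
    · by_cases hCb : C ⊆ b
      · have hbeq : φ '' (I ∩ φ ⁻¹' b) ∪ C = b := by
          ext p
          constructor
          · rintro (⟨e, he, rfl⟩ | hp)
            · exact he.2
            · exact hCb hp
          · intro hp
            rcases hbI hp with ⟨e, he, rfl⟩ | h
            · exact Or.inl ⟨e, ⟨he, hp⟩, rfl⟩
            · exact Or.inr h
        exact Or.inr (Or.inr ⟨I ∩ φ ⁻¹' b, (hBB _ (inter_subset_left.trans hI)).2 (by rwa [hbeq]),
          inter_subset_left⟩)
      · obtain ⟨p, hpC, hpb⟩ := not_subset.1 hCb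
        obtain ⟨p', hp', hpp⟩ := (hB' b hb).exists_mem (i := p.1) (notMem_empty _)
        refine Or.inr (Or.inl ⟨⟨p.1, (hfull _).1 (Or.inr (Or.inr ⟨p, Or.inr hpC, p', hbI hp', ?_,
          rfl, hpp⟩))⟩, hmet.1 fun i hi => ?_⟩)
        · rintro rfl
          exact hpb hp'
        · obtain ⟨g, hg, hgi⟩ := (hB' b hb).exists_mem hi
          exact ⟨g, hbI hg, hgi⟩
  · rintro (⟨i, j, hij, hi, hj⟩ | ⟨⟨i, hi⟩, h⟩ | ⟨b, hb, hbI⟩)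
    · exact Or.inl ⟨i, j, hij, (hfull i).2 hi, (hfull j).2 hj⟩
    · exact Or.inr (Or.inl ⟨⟨i, (hfull i).2 hi⟩, hmet.2 h⟩)
    · exact Or.inr (Or.inr ⟨_, (hBB b (hBE b hb)).1 hb,
        union_subset_union_left _ (image_mono hbI)⟩)

/-- Changing the names of the legs. -/
lemma legDep_comp_iff {E I : Set α} {q : α → ι} {T D R : Set ι} {B : Set (Set α)} {σ : ι → κ}
    (hσ : InjOn σ R) (hq : ∀ e ∈ E, q e ∈ R) (hT : Tᶜ ⊆ R) (hD : D ⊆ R) (hI : I ⊆ E) :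
    LegDep (fun e => σ (q e)) (σ '' Tᶜ)ᶜ (σ '' D) B I ↔ LegDep q T D B I := by
  have h1 : ∀ t, FullLeg (fun e => σ (q e)) (σ '' Tᶜ)ᶜ (σ '' D) I t →
      ∃ i, σ i = t ∧ FullLeg q T D I i := by
    rintro t (⟨i, hi, rfl⟩ | ⟨h, e, he, rfl⟩ | ⟨e, he, f, hf, hne, rfl, hqf⟩)
    · exact ⟨i, rfl, Or.inl hi⟩
    · exact ⟨q e, rfl, Or.inr (Or.inl ⟨by_contra fun hn => h ⟨_, hn, rfl⟩, e, he, rfl⟩)⟩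
    · exact ⟨q e, rfl, Or.inr (Or.inr ⟨e, he, f, hf, hne, rfl,
        hσ (hq f (hI hf)) (hq e (hI he)) hqf⟩)⟩
  have h2 : ∀ i, FullLeg q T D I i →
      i ∈ R ∧ FullLeg (fun e => σ (q e)) (σ '' Tᶜ)ᶜ (σ '' D) I (σ i) := by
    rintro t (hi | ⟨h, e, he, rfl⟩ | ⟨e, he, f, hf, hne, rfl, hqf⟩)
    · exact ⟨hD hi, Or.inl ⟨t, hi, rfl⟩⟩
    · refine ⟨hq e (hI he), Or.inr (Or.inl ⟨?_, e, he, rfl⟩)⟩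
      rintro ⟨j, hj, hjq⟩
      exact hj (hσ (hT hj) (hq e (hI he)) hjq ▸ h)
    · exact ⟨hq e (hI he), Or.inr (Or.inr ⟨e, he, f, hf, hne, rfl, congrArg σ hqf⟩)⟩
  have h3 : (∀ t ∉ (σ '' Tᶜ)ᶜ, ∃ e ∈ I, σ (q e) = t) ↔ ∀ i ∉ T, ∃ e ∈ I, q e = i := by
    constructor
    · intro h i hi
      obtain ⟨e, he, heq⟩ := h (σ i) (fun hn => hn ⟨i, hi, rfl⟩)
      exact ⟨e, he, hσ (hq e (hI he)) (hT hi) heq⟩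
    · intro h t ht
      obtain ⟨i, hi, rfl⟩ := not_not.1 ht
      obtain ⟨e, he, rfl⟩ := h i hi
      exact ⟨e, he, rfl⟩
  refine or_congr ?_ (or_congr (and_congr ?_ h3) Iff.rfl)
  · constructor
    · rintro ⟨t, t', hne, ht, ht'⟩
      obtain ⟨i, rfl, hi⟩ := h1 t ht
      obtain ⟨j, rfl, hj⟩ := h1 t' ht'
      exact ⟨i, j, fun hij => hne (congrArg σ hij), hi, hj⟩
    · rintro ⟨i, j, hne, hi, hj⟩
      obtain ⟨hiR, hi⟩ := h2 i hi
      obtain ⟨hjR, hj⟩ := h2 j hj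
      exact ⟨_, _, fun hij => hne (hσ hiR hjR hij), hi, hj⟩
  · constructor
    · rintro ⟨t, ht⟩
      obtain ⟨i, -, hi⟩ := h1 t ht
      exact ⟨i, hi⟩
    · rintro ⟨i, hi⟩
      exact ⟨_, (h2 i hi).2⟩

end Transfer

section Legs

universe x y

variable {α : Type x} {ι : Type y}

/-- `M` is the minor of a spike described by the labelling `q`, where the legs in `T` have a
contracted element, those in `D` have two of them, and `B` is the set of balanced transversals. -/
structure HasLegs (k : ℕ) (M : Matroid α) (q : α → ι) (T D : Set ι) (B : Set (Set α)) : Prop where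
  labelling : IsLegLabelling M.E q T
  subset : D ⊆ T
  notMem : ∀ e ∈ M.E, q e ∉ D
  transversal : ∀ b ∈ B, IsTransversal M.E q T b
  separated : Separated q B
  eq_empty : D.Nonempty → B = ∅
  encard_le : B.encard ≤ k
  indep_iff : ∀ I ⊆ M.E, M.Indep I ↔ ¬ LegDep q T D B I

lemma isRing_doubledCycle {r : ℕ} (hr : 2 ≤ r) :
    IsRing (doubledCycle r) r id id (Prod.fst : ZMod r × Bool → ZMod r) ∅ where
  two_le := hr
  inj_vertex := Function.injective_id
  vertexSet_eq := range_id.symm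
  inj_label := Function.injective_id
  range_label := by simp
  link := fun e _ i hi => Or.inl ⟨hi.symm, by rw [hi]; rfl⟩
  loop := fun _ _ h => h.elim
  labelling := by
    refine ⟨?_, fun _ _ _ _ _ h => h.elim⟩
    rintro ⟨i, s⟩ - ⟨j, t⟩ - ⟨l, u⟩ - h1 h2
    obtain rfl : i = j := h1
    obtain rfl : i = l := h2
    cases s <;> cases t <;> cases u <;> simp

lemma IsRing.transversal_of_isHamiltonianCycle {V : Type*} {G : Graph V α} {n : ℕ}
    {x : ZMod n → V} {y : ZMod n → ι} {q : α → ι} {T : Set ι} (h : IsRing G n x y q T)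
    (hn : 3 ≤ n) {C : Set α} (hC : IsHamiltonianCycle G C) : IsTransversal G.edgeSet q T C := by
  refine (h.isCycle_iff.1 hC.1).resolve_left fun hU => ?_
  have hs := hC.2
  rw [h.vertexSet_eq] at hs
  obtain ⟨i, -, hi⟩ := hU.exists_fullLeg
  by_cases ht : i ∈ T
  · have := h.support_unit_subsingleton hU hi ht
    rw [hs] at this
    exact h.range_not_subsingleton this
  · obtain ⟨j, rfl⟩ := h.exists_label ht
    rw [h.support_unit hU hi] at hs
    have h1 : (range x).ncard ≤ 2 := by
      rw [← hs]
      exact (ncard_insert_le _ _).trans (by simp)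
    rw [← image_univ, ncard_image_of_injective _ h.inj_vertex, ncard_univ, Nat.card_zmod] at h1
    omega

theorem InClassS.exists_hasLegs {k : ℕ} {M : Matroid α} (h : InClassS k M) :
    ∃ (r : ℕ) (q : α → ZMod r) (T D : Set (ZMod r)) (B : Set (Set α)), 3 ≤ r ∧
      HasLegs k M q T D B := by
  obtain ⟨r, B', L, N, hr, hlin, hham, hk, hL, ⟨X, Y, rfl⟩, hiso⟩ := h
  have hring := isRing_doubledCycle (by omega : 2 ≤ r)
  have : NeZero r := ⟨by omega⟩
  have hB' : ∀ b ∈ B', IsTransversal univ Prod.fst ∅ b := fun b hb =>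
    hring.transversal_of_isHamiltonianCycle hr (hham b hb)
  have hLE : L.E = univ := hL.1
  have : L.Finite := ⟨hLE ▸ finite_univ⟩
  have hLI := ((hring.isLiftMatroid_iff hB' L).1 hL).2
  have hsep := (hring.isLinearClass_iff hB').1 hlin
  obtain ⟨φ, hφ, hφE, hφI⟩ := hiso.exists_injOn
  obtain ⟨C, hC⟩ := L.exists_isBasis' X
  have hE : ∀ e ∈ M.E, φ e ∉ X ∧ φ e ∉ Y := fun e he => by
    have : φ e ∈ ((L.contract X).delete Y).E := hφE ▸ ⟨e, he, rfl⟩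
    exact ⟨this.1.2, this.2⟩
  have hCE : ∀ e ∈ M.E, φ e ∉ C := fun e he h => (hE e he).1 (hC.subset h)
  have hinj : ∀ b ⊆ M.E, ∀ c ⊆ M.E, ∀ e ∈ M.E, (φ e ∈ φ '' b ∪ C ↔ φ e ∈ φ '' c ∪ C) →
      (e ∈ b ↔ e ∈ c) := by
    have : ∀ b ⊆ M.E, ∀ e ∈ M.E, φ e ∈ φ '' b ∪ C ↔ e ∈ b := by
      intro b hb e he
      refine ⟨?_, fun h => Or.inl ⟨e, h, rfl⟩⟩
      rintro (⟨f, hf, hfe⟩ | h)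
      · rwa [← hφ (hb hf) he hfe]
      · exact (hCE e he h).elim
    intro b hb c hc e he h
    rwa [this b hb e he, this c hc e he] at h
  have hext : ∀ b ⊆ M.E, ∀ c ⊆ M.E, φ '' b ∪ C = φ '' c ∪ C → b = c := by
    intro b hb c hc h
    ext e
    by_cases he : e ∈ M.E
    · exact hinj b hb c hc e he (by rw [h])
    · exact iff_of_false (fun h => he (hb h)) (fun h => he (hc h))
  refine ⟨r, fun e => (φ e).1, {i | ∃ s, (i, s) ∈ C}, {i | ∀ s, (i, s) ∈ C},
    {b | b ⊆ M.E ∧ φ '' b ∪ C ∈ B'}, hr, ⟨?_, ?_⟩, ?_, ?_, ?_, ?_, ?_, ?_, ?_⟩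
  · intro e he f hf g hg h1 h2
    have h3 := hring.labelling.fiber_two (φ e) (mem_univ _) (φ f) (mem_univ _) (φ g) (mem_univ _)
      h1 h2
    rcases h3 with h | h | h
    · exact Or.inl (hφ he hf h)
    · exact Or.inr (Or.inl (hφ he hg h))
    · exact Or.inr (Or.inr (hφ hf hg h))
  · rintro e he f hf hq ⟨s, hs⟩
    have h1 : φ e ≠ ((φ e).1, s) := fun h => hCE e he (h ▸ hs)
    have h2 : φ f ≠ ((φ e).1, s) := fun h => hCE f hf (h ▸ hs)
    have h3 := hring.labelling.fiber_two (φ e) (mem_univ _) (φ f) (mem_univ _) ((φ e).1, s)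
      (mem_univ _) hq rfl
    rcases h3 with h | h | h
    · exact hφ he hf h
    · exact (h1 h).elim
    · exact (h2 h).elim
  · intro i hi
    exact ⟨true, hi true⟩
  · intro e he h
    exact hCE e he (h (φ e).2)
  · rintro b ⟨hbE, hb⟩
    have hbt := hB' _ hb
    refine ⟨hbE, ?_, ?_, ?_⟩
    · rintro e he ⟨s, hs⟩
      have := hbt.inj (Or.inl ⟨e, he, rfl⟩) (Or.inr hs) rfl
      exact hCE e (hbE he) (this ▸ hs)
    · intro e he f hf hq
      exact hφ (hbE he) (hbE hf) (hbt.inj (Or.inl ⟨e, he, rfl⟩) (Or.inl ⟨f, hf, rfl⟩) hq)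
    · intro i hi
      obtain ⟨p, ⟨e, he, rfl⟩ | hp, rfl⟩ := hbt.exists_mem (i := i) (notMem_empty _)
      · exact ⟨e, he, rfl⟩
      · exact (hi ⟨p.2, hp⟩).elim
  · rintro b ⟨hbE, hb⟩ c ⟨hcE, hc⟩ i hbc
    refine hext b hbE c hcE (hsep _ hb _ hc i fun p hp => or_congr_left ?_)
    constructor
    · rintro ⟨e, he, rfl⟩
      exact ⟨e, (hbc e hp).1 he, rfl⟩
    · rintro ⟨e, he, rfl⟩
      exact ⟨e, (hbc e hp).2 he, rfl⟩
  · rintro ⟨i, hi⟩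
    rw [eq_empty_iff_forall_notMem]
    rintro b ⟨-, hb⟩
    have := (hB' _ hb).inj (Or.inr (hi true)) (Or.inr (hi false)) rfl
    simp at this
  · refine le_trans (encard_le_encard_of_injOn (f := fun b => φ '' b ∪ C) (fun b hb => hb.2) ?_) hk
    exact fun b hb c hc h => hext b hb.1 c hc.1 h
  · intro I hI
    have key := legDep_image_union_iff (T := {i | ∃ s, (i, s) ∈ C}) (D := {i | ∀ s, (i, s) ∈ C})
      (B := {b | b ⊆ M.E ∧ φ '' b ∪ C ∈ B'}) hφ hCE (fun _ => Iff.rfl)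
      (fun _ => Iff.rfl) hB' (fun b hb => hb.1) (fun b hb => and_iff_right hb) hI
    rw [← key, ← hLI _ (hLE ▸ subset_univ _), hφI I hI, Matroid.delete_indep_iff,
      hC.contract_indep_iff]
    refine ⟨fun h => h.1.1, fun h => ⟨⟨h, ?_⟩, ?_⟩⟩
    · rw [disjoint_right]
      rintro _ ⟨e, he, rfl⟩
      exact (hE e (hI he)).1
    · rw [disjoint_left]
      rintro _ ⟨e, he, rfl⟩
      exact (hE e (hI he)).2

lemma exists_injOn_zmod {R : Set ι} (hR : R.Finite) :
    ∃ (r : ℕ) (σ : ι → ZMod r), 3 ≤ r ∧ InjOn σ R := by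
  classical
  have := hR.to_subtype
  obtain ⟨n, ⟨f⟩⟩ := Finite.exists_equiv_fin R
  refine ⟨n + 3, fun i => if h : i ∈ R then ((f ⟨i, h⟩ : ℕ) : ZMod (n + 3)) else 0, by omega, ?_⟩
  intro i hi j hj hij
  simp only [hi, hj, dif_pos] at hij
  rw [ZMod.natCast_eq_natCast_iff', Nat.mod_eq_of_lt (by omega), Nat.mod_eq_of_lt (by omega)] at hij
  simpa using f.injective (Fin.ext hij)

lemma IsLegLabelling.exists_side {E : Set α} {q : α → ι} {T : Set ι} (h : IsLegLabelling E q T) :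
    ∃ s : α → Bool, ∀ e ∈ E, ∀ f ∈ E, q e = q f → s e = s f → e = f := by
  classical
  have : ∀ i, ∃ p : Option α, (∀ e, p = some e → e ∈ E ∧ q e = i) ∧
      (∀ e ∈ E, q e = i → p.isSome) := by
    intro i
    by_cases hi : ∃ e ∈ E, q e = i
    · obtain ⟨e, he⟩ := hi
      exact ⟨some e, by simpa using he, by simp⟩
    · exact ⟨none, by simp, fun e he hq => (hi ⟨e, he, hq⟩).elim⟩
  choose p hp hp' using this
  refine ⟨fun e => decide (p (q e) = some e), fun e he f hf hq hs => ?_⟩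
  obtain ⟨g, hg⟩ := Option.isSome_iff_exists.1 (hp' (q e) e he rfl)
  obtain ⟨hgE, hgq⟩ := hp _ g hg
  simp only [← hq, hg, decide_eq_decide, Option.some.injEq] at hs
  rcases h.fiber_two e he f hf g hgE hq hgq.symm with h | rfl | rfl
  · exact h
  · exact hs.1 rfl
  · exact (hs.2 rfl).symm

theorem HasLegs.inClassS {k : ℕ} {M : Matroid α} [M.Finite] {q : α → ι} {T D : Set ι}
    {B : Set (Set α)} (h : HasLegs k M q T D B) (hTfin : Tᶜ.Finite) : InClassS k M := by
  classical
  have hempty := (h.indep_iff ∅ (empty_subset _)).1 M.empty_indep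
  have hDfin : D.Finite := by
    refine Set.Subsingleton.finite fun i hi j hj => ?_
    by_contra hij
    exact hempty (Or.inl ⟨i, j, hij, Or.inl hi, Or.inl hj⟩)
  obtain ⟨r, σ, hr, hσ⟩ := exists_injOn_zmod (((M.ground_finite.image q).union hTfin).union hDfin)
  set R := q '' M.E ∪ Tᶜ ∪ D with hR
  have hqR : ∀ e ∈ M.E, q e ∈ R := fun e he => Or.inl (Or.inl ⟨e, he, rfl⟩)
  have hTR : Tᶜ ⊆ R := fun i hi => Or.inl (Or.inr hi)
  have hDR : D ⊆ R := fun i hi => Or.inr hi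
  have hring := isRing_doubledCycle (by omega : 2 ≤ r)
  have : NeZero r := ⟨by omega⟩
  obtain ⟨s, hs⟩ := h.labelling.exists_side
  obtain ⟨c, hc⟩ : ∃ c : ZMod r → Bool, ∀ e ∈ M.E, q e ∈ T → s e ≠ c (σ (q e)) := by
    refine ⟨fun t => decide (∃ e ∈ M.E, q e ∈ T ∧ σ (q e) = t ∧ s e = false), fun e he ht hse => ?_⟩
    beta_reduce at hse
    by_cases hex : ∃ f ∈ M.E, q f ∈ T ∧ σ (q f) = σ (q e) ∧ s f = false
    · rw [decide_eq_true hex] at hse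
      obtain ⟨f, hf, hfT, hfe, hsf⟩ := hex
      have := h.labelling.fiber_one f hf e he (hσ (hqR f hf) (hqR e he) hfe) hfT
      subst this
      rw [hsf] at hse
      exact absurd hse (by simp)
    · rw [decide_eq_false hex] at hse
      exact hex ⟨e, he, ht, rfl, hse⟩
  have hσT : ∀ i ∈ R, i ∈ T → σ i ∉ σ '' Tᶜ := by
    rintro i hi hiT ⟨j, hj, hji⟩
    exact hj (hσ (hTR hj) hi hji ▸ hiT)
  set φ : α → ZMod r × Bool := fun e => (σ (q e), s e) with hφdef
  have hφ : InjOn φ M.E := fun e he f hf hef =>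
    hs e he f hf (hσ (hqR e he) (hqR f hf) (Prod.mk.inj hef).1) (Prod.mk.inj hef).2
  set C : Set (ZMod r × Bool) := {p | p.1 ∈ σ '' D ∨ (p.1 ∉ σ '' Tᶜ ∧ p.2 = c p.1)} with hCdef
  have hCE : ∀ e ∈ M.E, φ e ∉ C := by
    rintro e he (⟨i, hi, hie⟩ | ⟨h1, h2⟩)
    · exact h.notMem e he (hσ (hDR hi) (hqR e he) hie ▸ hi)
    · exact hc e he (by_contra fun hn => h1 ⟨_, hn, rfl⟩) h2
  have hT0 : ∀ t, t ∈ (σ '' Tᶜ)ᶜ ↔ ∃ s, (t, s) ∈ C := by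
    intro t
    constructor
    · intro ht
      exact ⟨c t, Or.inr ⟨ht, rfl⟩⟩
    · rintro ⟨s, ⟨i, hi, rfl⟩ | ⟨h, -⟩⟩
      · exact hσT i (hDR hi) (h.subset hi)
      · exact h
  have hD0 : ∀ t, t ∈ σ '' D ↔ ∀ s, (t, s) ∈ C := by
    intro t
    constructor
    · intro ht s
      exact Or.inl ht
    · intro ht
      rcases ht (!c t) with h | ⟨-, h⟩
      · exact h
      · simp at h
  have hinj : ∀ b ⊆ M.E, ∀ e ∈ M.E, φ e ∈ φ '' b ∪ C ↔ e ∈ b := by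
    intro b hb e he
    refine ⟨?_, fun h => Or.inl ⟨e, h, rfl⟩⟩
    rintro (⟨f, hf, hfe⟩ | h)
    · rwa [← hφ (hb hf) he hfe]
    · exact (hCE e he h).elim
  set B' : Set (Set (ZMod r × Bool)) := (fun b => φ '' b ∪ C) '' B with hB'def
  have hBE : ∀ b ∈ B, b ⊆ M.E := fun b hb => (h.transversal b hb).1
  have hB' : ∀ b ∈ B', IsTransversal univ Prod.fst ∅ b := by
    rintro _ ⟨b, hb, rfl⟩
    have hbt := h.transversal b hb
    have hDe : ∀ i, i ∉ D := fun i hi => by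
      have := h.eq_empty ⟨i, hi⟩
      rw [this] at hb
      exact hb
    have hC1 : ∀ p ∈ C, p.1 ∉ σ '' Tᶜ ∧ p.2 = c p.1 := by
      rintro p (⟨i, hi, -⟩ | hp)
      · exact (hDe i hi).elim
      · exact hp
    refine ⟨subset_univ _, fun _ _ => notMem_empty _, ?_, ?_⟩
    · rintro p (⟨e, he, rfl⟩ | hp) p' (⟨f, hf, rfl⟩ | hp') hpp
      · rw [hbt.inj he hf (hσ (hqR e (hBE b hb he)) (hqR f (hBE b hb hf)) hpp)]
      · exact ((hC1 _ hp').1 ⟨q e, hbt.notMem he, hpp⟩).elim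
      · exact ((hC1 _ hp).1 ⟨q f, hbt.notMem hf, hpp.symm⟩).elim
      · exact Prod.ext hpp (by rw [(hC1 _ hp).2, (hC1 _ hp').2, hpp])
    · intro t _
      by_cases ht : t ∈ σ '' Tᶜ
      · obtain ⟨i, hi, rfl⟩ := ht
        obtain ⟨e, he, rfl⟩ := hbt.exists_mem hi
        exact ⟨φ e, Or.inl ⟨e, he, rfl⟩, rfl⟩
      · exact ⟨(t, c t), Or.inr (Or.inr ⟨ht, rfl⟩), rfl⟩
  have hsep : Separated Prod.fst B' := by
    rintro _ ⟨b, hb, rfl⟩ _ ⟨d, hd, rfl⟩ t hbd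
    have key : ∀ e, σ (q e) ≠ t ∨ e ∉ M.E → (e ∈ b ↔ e ∈ d) := by
      intro e he
      by_cases heE : e ∈ M.E
      · have := hbd (φ e) (he.resolve_right (not_not.2 heE))
        rwa [hinj b (hBE b hb) e heE, hinj d (hBE d hd) e heE] at this
      · exact iff_of_false (fun h => heE (hBE b hb h)) (fun h => heE (hBE d hd h))
    congr 2
    by_cases ht : ∃ i ∈ R, σ i = t
    · obtain ⟨i, hi, rfl⟩ := ht
      refine h.separated b hb d hd i fun e he => key e ?_
      by_cases heE : e ∈ M.E
      · exact Or.inl fun hh => he (hσ (hqR e heE) hi hh)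
      · exact Or.inr heE
    · ext e
      refine key e ?_
      by_cases heE : e ∈ M.E
      · exact Or.inl fun hh => ht ⟨q e, hqR e heE, hh⟩
      · exact Or.inr heE
  have hBB : ∀ b ⊆ M.E, b ∈ B ↔ φ '' b ∪ C ∈ B' := by
    intro b hb
    refine ⟨fun h => ⟨b, h, rfl⟩, ?_⟩
    rintro ⟨d, hd, hdb⟩
    have hdb : φ '' d ∪ C = φ '' b ∪ C := hdb
    have : d = b := by
      ext e
      by_cases he : e ∈ M.E
      · rw [← hinj d (hBE d hd) e he, hdb, hinj b hb e he]
      · exact iff_of_false (fun h => he (hBE d hd h)) (fun h => he (hb h))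
    exact this ▸ hd
  have hdep : ∀ I ⊆ M.E, LegDep Prod.fst ∅ ∅ B' (φ '' I ∪ C) ↔ LegDep q T D B I := by
    intro I hI
    rw [legDep_image_union_iff (E := M.E) hφ hCE hT0 hD0 hB' hBE hBB hI,
      ← legDep_comp_iff (E := M.E) hσ hqR hTR hDR hI]
  obtain ⟨L, hLE, hLI⟩ := exists_spike_matroid hB' hsep
  have : L.Finite := ⟨hLE ▸ finite_univ⟩
  have hCI : L.Indep C := by
    rw [hLI]
    have := hdep ∅ (empty_subset _)
    rw [image_empty, empty_union] at this
    rwa [this]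
  have hdisj : ∀ I ⊆ M.E, Disjoint (φ '' I) C := by
    intro I hI
    rw [disjoint_left]
    rintro _ ⟨e, he, rfl⟩
    exact hCE e (hI he)
  refine ⟨r, B', L, (L.contract C).delete (φ '' M.E ∪ C)ᶜ, hr, (hring.isLinearClass_iff hB').2 hsep,
    fun b hb => hring.isHamiltonianCycle_transversal (hB' b hb),
    (encard_image_le _ _).trans h.encard_le, (hring.isLiftMatroid_iff hB' L).2
      ⟨hLE, fun I _ => hLI I⟩, ⟨C, _, rfl⟩, isomorphic_of_injOn hφ ?_ ?_⟩
  · rw [Matroid.delete_ground, Matroid.contract_ground, hLE]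
    ext p
    simp only [mem_sdiff, mem_univ, true_and, mem_compl_iff, not_not]
    constructor
    · intro hp
      exact ⟨disjoint_left.1 (hdisj _ Subset.rfl) hp, Or.inl hp⟩
    · rintro ⟨h1, h2⟩
      exact h2.resolve_right h1
  · intro I hI
    rw [Matroid.delete_indep_iff, hCI.contract_indep_iff, hLI, hdep I hI, h.indep_iff I hI]
    refine ⟨fun h => ⟨⟨hdisj I hI, h⟩, ?_⟩, fun h => h.1.2⟩
    exact disjoint_compl_right.mono_left ((image_mono hI).trans subset_union_left)

end Legs

end SpikeMinor

namespace SpikeMinor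

universe x y

variable {α : Type x} {ι : Type y}

lemma encard_le_two_of_forall {S : Set α}
    (h : ∀ a ∈ S, ∀ b ∈ S, ∀ c ∈ S, a = b ∨ a = c ∨ b = c) : S.encard ≤ 2 := by
  by_contra hlt
  have h3 : (3 : ℕ∞) ≤ S.encard := by
    have := Order.add_one_le_of_lt (not_le.1 hlt)
    rwa [two_add_one_eq_three] at this
  obtain ⟨R, hRS, hR⟩ := exists_subset_encard_eq h3
  obtain ⟨a, b, c, hab, hac, hbc, rfl⟩ := encard_eq_three.1 hR
  rcases h a (hRS (by simp)) b (hRS (by simp)) c (hRS (by simp)) with h | h | h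
  · exact hab h
  · exact hac h
  · exact hbc h

lemma IsLegLabelling.encard_fiber_le {E : Set α} {q : α → ι} {T : Set ι}
    (h : IsLegLabelling E q T) (i : ι) : {e | e ∈ E ∧ q e = i}.encard ≤ 2 :=
  encard_le_two_of_forall fun a ha b hb c hc => h.fiber_two a ha.1 b hb.1 c hc.1
    (ha.2.trans hb.2.symm) (ha.2.trans hc.2.symm)

lemma categoryF_of_fibers {M : Matroid α} {q : α → ι} {T : Set ι} (hlab : IsLegLabelling M.E q T)
    (h : ∀ X ⊆ M.E, ¬ M.Indep X → ∃ i, ¬ M.Indep {e | e ∈ X ∧ q e = i}) : CategoryF M := by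
  intro e he
  refine (encard_le_encard ?_).trans (hlab.encard_fiber_le (q e))
  rintro f (rfl | ⟨C, hC, heC, hfC⟩)
  · exact ⟨he, rfl⟩
  · obtain ⟨i, hi⟩ := h C hC.subset_ground hC.not_indep
    have := hC.eq_of_not_indep_subset hi fun g hg => hg.1
    rw [← this] at heC hfC
    exact ⟨hC.subset_ground hfC.1, hfC.2.trans heC.2.symm⟩

section OneVertex

variable {V : Type y} {G : Graph V α} {a : V}

lemma isCycle_iff_of_vertexSet_eq_singleton (h : G.vertexSet = {a}) {C : Set α} :
    IsCycle G C ↔ ∃ e ∈ G.edgeSet, C = {e} := by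
  constructor
  · rintro ⟨n, v, e, hn, hv, he, hl, rfl⟩
    have hva : ∀ i, v i = a := fun i => by
      have : v i ∈ ({a} : Set V) := h ▸ (hl i).left_mem
      exact this
    have h0 : ∀ i : ZMod n, i = 0 := fun i => hv ((hva i).trans (hva 0).symm)
    refine ⟨e 0, (hl 0).edge_mem, ?_⟩
    ext f
    constructor
    · rintro ⟨i, rfl⟩
      rw [h0 i]; rfl
    · rintro rfl
      exact ⟨0, rfl⟩
  · rintro ⟨e, he, rfl⟩
    obtain ⟨b, c, hbc⟩ := G.exists_isLink_of_mem_edgeSet he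
    have hb : b ∈ ({a} : Set V) := h ▸ hbc.left_mem
    have hc : c ∈ ({a} : Set V) := h ▸ hbc.right_mem
    rw [mem_singleton_iff] at hb hc
    subst hb hc
    refine ⟨1, fun _ => c, fun _ => e, one_ne_zero, fun i j _ => Subsingleton.elim i j,
      fun i j _ => Subsingleton.elim i j, fun _ => hbc, by simp⟩

lemma not_isTheta_of_vertexSet_eq_singleton (h : G.vertexSet = {a}) {X : Set α} :
    ¬ IsTheta G X := by
  rintro ⟨b, c, W, P, hbc, hP, -, -⟩
  obtain ⟨n, v, e, hn, -, -, hl, h0, hn', -, -⟩ := (hP 0).exists_nat hbc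
  have hb : v 0 ∈ ({a} : Set V) := h ▸ (hl 0 (by omega)).left_mem
  have hc : v n ∈ ({a} : Set V) := by
    have := (hl (n - 1) (by omega)).right_mem
    rw [Nat.sub_add_cancel (by omega)] at this
    exact h ▸ this
  rw [mem_singleton_iff] at hb hc
  exact hbc (h0.symm.trans ((hb.trans hc.symm).trans hn'))

lemma isLinearClass_of_vertexSet_eq_singleton (h : G.vertexSet = {a}) {B : Set (Set α)}
    (hB : ∀ b ∈ B, ∃ e ∈ G.edgeSet, b = {e}) : IsLinearClass G B :=
  ⟨fun C hC => (isCycle_iff_of_vertexSet_eq_singleton h).2 (hB C hC),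
    fun _ hX => (not_isTheta_of_vertexSet_eq_singleton h hX).elim⟩

theorem isLiftMatroid_iff_of_vertexSet_eq_singleton (h : G.vertexSet = {a}) {B : Set (Set α)}
    (hB : ∀ b ∈ B, ∃ e ∈ G.edgeSet, b = {e}) (M : Matroid α) [M.Finite] :
    IsLiftMatroid G B M ↔ M.E = G.edgeSet ∧
      ∀ I ⊆ M.E, M.Indep I ↔ ¬ ((∃ e ∈ I, {e} ∈ B) ∨ ∃ e ∈ I, ∃ f ∈ I, e ≠ f) := by
  have hmono : ∀ X Y : Set α, ((∃ e ∈ X, {e} ∈ B) ∨ ∃ e ∈ X, ∃ f ∈ X, e ≠ f) → X ⊆ Y →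
      ((∃ e ∈ Y, {e} ∈ B) ∨ ∃ e ∈ Y, ∃ f ∈ Y, e ≠ f) := by
    rintro X Y (⟨e, he, h⟩ | ⟨e, he, f, hf, h⟩) hXY
    · exact Or.inl ⟨e, hXY he, h⟩
    · exact Or.inr ⟨e, hXY he, f, hXY hf, h⟩
  refine and_congr_right fun hE => ?_
  rw [indep_iff_iff_isCircuit_iff M hmono, hE]
  refine forall_congr' fun X => ?_
  rw [subset_and_minimal_iff (L := IsLiftCircuit G B) hmono ?_ ?_]
  · rintro X (hX | ⟨hX, -⟩ | ⟨C, D, hC, hD, hCB, hDB, hne, -, rfl⟩)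
    · obtain ⟨e, he, rfl⟩ := hB X hX
      refine ⟨by simpa using he, Or.inl ⟨e, rfl, hX⟩, ?_⟩
      rintro f rfl
      simp
    · exact (not_isTheta_of_vertexSet_eq_singleton h hX).elim
    · obtain ⟨e, he, rfl⟩ := (isCycle_iff_of_vertexSet_eq_singleton h).1 hC
      obtain ⟨f, hf, rfl⟩ := (isCycle_iff_of_vertexSet_eq_singleton h).1 hD
      have hef : e ≠ f := fun h => hne (by rw [h])
      refine ⟨union_subset (by simpa using he) (by simpa using hf),
        Or.inr ⟨e, by simp, f, by simp, hef⟩, fun g hg => ?_⟩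
      rintro (⟨g', ⟨rfl | rfl, -⟩, hgB⟩ | ⟨g1, ⟨h1, h1g⟩, g2, ⟨h2, h2g⟩, hg12⟩)
      · exact hCB hgB
      · exact hDB hgB
      · simp only [singleton_union, mem_insert_iff, mem_singleton_iff] at hg h1 h1g h2 h2g
        grind
  · intro X hXE hX
    by_cases hb : ∃ e ∈ X, {e} ∈ B
    · obtain ⟨e, he, heB⟩ := hb
      exact ⟨{e}, by simpa using he, Or.inl heB⟩
    · obtain ⟨e, he, f, hf, hef⟩ := hX.resolve_left hb
      push Not at hb
      refine ⟨{e} ∪ {f}, union_subset (by simpa using he) (by simpa using hf),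
        Or.inr (Or.inr ⟨{e}, {f}, ?_, ?_, hb e he, hb f hf, by simpa using hef, ?_, rfl⟩)⟩
      · exact (isCycle_iff_of_vertexSet_eq_singleton h).2 ⟨e, hXE he, rfl⟩
      · exact (isCycle_iff_of_vertexSet_eq_singleton h).2 ⟨f, hXE hf, rfl⟩
      · refine (subsingleton_singleton (a := a)).anti (inter_subset_left.trans ?_)
        rintro v ⟨g, -, hg⟩
        rw [← h]
        exact hg.vertex_mem

theorem isCycleMatroid_iff_of_vertexSet_eq_singleton (h : G.vertexSet = {a}) (M : Matroid α)
    [M.Finite] : IsCycleMatroid G M ↔ M.E = G.edgeSet ∧ ∀ I ⊆ M.E, M.Indep I ↔ ¬ I.Nonempty := by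
  refine and_congr_right fun hE => ?_
  rw [indep_iff_iff_isCircuit_iff M (P := Set.Nonempty) fun X Y hX hXY => hX.mono hXY, hE]
  refine forall_congr' fun X => ?_
  rw [subset_and_minimal_iff (L := IsCycle G) (fun X Y hX hXY => hX.mono hXY) ?_ ?_]
  · intro X hX
    obtain ⟨e, he, rfl⟩ := (isCycle_iff_of_vertexSet_eq_singleton h).1 hX
    refine ⟨by simpa using he, by simp, ?_⟩
    rintro f rfl
    simp
  · rintro X hXE ⟨e, he⟩
    exact ⟨{e}, by simpa using he, (isCycle_iff_of_vertexSet_eq_singleton h).2 ⟨e, hXE he, rfl⟩⟩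

end OneVertex

section Construction

/-- The graph on the cyclically ordered vertices `ZMod m` in which an edge with label `y i` joins
`i` to `i + 1`, and an edge with label in `T` is a loop. -/
def ringGraph (m : ℕ) (E : Set α) (q : α → ι) (T : Set ι) (y : ZMod m → ι)
    (hy : Function.Injective y) (hyT : range y = Tᶜ) : Graph (ZMod m) α where
  vertexSet := univ
  edgeSet := E
  IsLink e a b := e ∈ E ∧ ((∃ i, q e = y i ∧ (a = i ∧ b = i + 1 ∨ a = i + 1 ∧ b = i)) ∨
    (q e ∈ T ∧ a = 0 ∧ b = 0))
  isLink_symm := by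
    intro e _
    refine ⟨?_⟩
    rintro a b ⟨he, ⟨i, hi, h⟩ | ⟨h, rfl, rfl⟩⟩
    · exact ⟨he, Or.inl ⟨i, hi, h.symm.imp And.symm And.symm⟩⟩
    · exact ⟨he, Or.inr ⟨h, rfl, rfl⟩⟩
  eq_or_eq_of_isLink_of_isLink := by
    have hyt : ∀ i, y i ∉ T := fun i => by
      have : y i ∈ Tᶜ := hyT ▸ mem_range_self i
      exact this
    rintro e a b c d ⟨-, ⟨i, hi, h⟩ | ⟨h, rfl, rfl⟩⟩ ⟨-, ⟨j, hj, h'⟩ | ⟨h', rfl, rfl⟩⟩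
    · obtain rfl := hy (hi.symm.trans hj)
      rcases h with ⟨rfl, rfl⟩ | ⟨rfl, rfl⟩ <;> rcases h' with ⟨rfl, rfl⟩ | ⟨rfl, rfl⟩ <;> simp
    · exact (hyt i (hi ▸ h')).elim
    · exact (hyt j (hj ▸ h)).elim
    · exact Or.inl rfl
  edge_mem_iff_exists_isLink := by
    intro e
    refine ⟨fun he => ?_, fun ⟨_, _, h⟩ => h.1⟩
    by_cases ht : q e ∈ T
    · exact ⟨0, 0, he, Or.inr ⟨ht, rfl, rfl⟩⟩
    · have : q e ∈ range y := hyT ▸ ht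
      obtain ⟨i, hi⟩ := this
      exact ⟨i, i + 1, he, Or.inl ⟨i, hi.symm, Or.inl ⟨rfl, rfl⟩⟩⟩
  left_mem_of_isLink := fun _ _ _ _ => mem_univ _

variable {E : Set α} {q : α → ι} {T : Set ι}

theorem exists_isRing [Finite ι] (hE : E.Finite) (hlab : IsLegLabelling E q T)
    (hhit : ∀ i ∉ T, ∃ e ∈ E, q e = i) (hm : 2 ≤ Tᶜ.ncard) :
    ∃ (G : Graph (ZMod Tᶜ.ncard) α) (y : ZMod Tᶜ.ncard → ι), IsRing G Tᶜ.ncard id y q T ∧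
      G.edgeSet = E ∧ InClassG G := by
  generalize hmdef : Tᶜ.ncard = m at hm
  have : NeZero m := ⟨by omega⟩
  have : Fact (1 < m) := ⟨hm⟩
  have hcard : Nat.card (ZMod m) = Nat.card ↥Tᶜ := by
    rw [Nat.card_zmod, ← hmdef]; rfl
  obtain ⟨f⟩ : Nonempty (ZMod m ≃ ↥Tᶜ) := Finite.card_eq.1 hcard
  have hy : Function.Injective fun i => (f i : ι) := Subtype.val_injective.comp f.injective
  have hyT : range (fun i => (f i : ι)) = Tᶜ := by
    ext j
    constructor
    · rintro ⟨i, rfl⟩; exact (f i).2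
    · intro hj; exact ⟨f.symm ⟨j, hj⟩, by simp⟩
  let G := ringGraph m E q T (fun i => (f i : ι)) hy hyT
  have hG : IsRing G m id (fun i => (f i : ι)) q T :=
    { two_le := hm
      inj_vertex := Function.injective_id
      vertexSet_eq := range_id.symm
      inj_label := hy
      range_label := hyT
      link := fun e he i hi => ⟨he, Or.inl ⟨i, hi, Or.inl ⟨rfl, rfl⟩⟩⟩
      loop := fun e he ht => ⟨0, he, Or.inr ⟨ht, rfl, rfl⟩⟩
      labelling := hlab }
  have hhit' : ∀ i, ∃ e ∈ E, q e = f i := fun i => hhit _ (f i).2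
  refine ⟨G, fun i => (f i : ι), hG, rfl, hE, Or.inr ?_⟩
  have hsub : ∀ a b : ZMod m, a ≠ b → ∀ e, G.IsLink e a b →
      ∃ i, e ∈ {e | e ∈ E ∧ q e = f i} ∧ (a = i ∧ b = i + 1 ∨ a = i + 1 ∧ b = i) := by
    intro a b hab e he
    obtain ⟨i, hi, h⟩ := hG.exists_link_of_ne he hab
    exact ⟨i, ⟨he.1, hi⟩, h⟩
  rcases Nat.lt_or_ge m 3 with h3 | h3
  · left
    obtain rfl : m = 2 := by omega
    refine ⟨0, 1, zero_ne_one, ?_, ?_, ?_⟩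
    · refine (eq_univ_of_forall ?_).symm
      decide
    · obtain ⟨e, he, hq⟩ := hhit' 0
      exact ⟨e, he, Or.inl ⟨0, hq, Or.inl ⟨rfl, by decide⟩⟩⟩
    · have h1 : {e | G.IsLink e 0 1} ⊆ {e | e ∈ E ∧ q e = f 0} ∪ {e | e ∈ E ∧ q e = f 1} := by
        intro e he
        obtain ⟨i, hi, -⟩ := hsub 0 1 zero_ne_one e he
        have hz : ∀ i : ZMod 2, i = 0 ∨ i = 1 := by decide
        rcases hz i with rfl | rfl
        · exact Or.inl hi
        · exact Or.inr hi
      refine (encard_le_encard h1).trans ((encard_union_le _ _).trans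
        ((add_le_add (hlab.encard_fiber_le _) (hlab.encard_fiber_le _)).trans ?_))
      norm_num
  · right
    refine ⟨m, id, h3, Function.injective_id, range_id.symm, ?_, ?_⟩
    · intro a b hab
      constructor
      · rintro ⟨e, he⟩
        obtain ⟨i, -, h⟩ := hsub a b hab e he
        exact ⟨i, h⟩
      · rintro ⟨i, h⟩
        obtain ⟨e, he, hq⟩ := hhit' i
        exact ⟨e, he, Or.inl ⟨i, hq, h⟩⟩
    · intro a b hab
      by_cases hex : ∃ e, G.IsLink e a b
      · obtain ⟨e, he⟩ := hex
        obtain ⟨i, -, h⟩ := hsub a b hab e he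
        refine (encard_le_encard fun e' he' => ?_).trans (hlab.encard_fiber_le (f i))
        obtain ⟨j, hj, h'⟩ := hsub a b hab e' he'
        have hij : j = i := by
          by_contra hij
          have h2 : (2 : ZMod m) = 0 := by
            rcases h with ⟨h1, h2⟩ | ⟨h1, h2⟩ <;> rcases h' with ⟨h3, h4⟩ | ⟨h3, h4⟩
            · exact (hij (h3.symm.trans h1)).elim
            · have : i + 2 = i := by
                rw [← one_add_one_eq_two, ← add_assoc, ← h2, h4, ← h3, h1]
              simpa using this
            · have : i + 2 = i := by
                rw [← one_add_one_eq_two, ← add_assoc, ← h1, h3, ← h4, h2]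
              simpa using this
            · exact (hij (h4.symm.trans h2)).elim
          have := zmod_two_eq_zero hm h2
          omega
        rw [← hij]
        exact hj
      · have : {e | G.IsLink e a b} = ∅ := by
          rw [eq_empty_iff_forall_notMem]
          exact fun e he => hex ⟨e, he⟩
        rw [this]
        simp

end Construction

section Duality

variable {M : Matroid α} {q : α → ι} {T : Set ι}

/-- A matroid whose dependent sets are those that contain two fibers is the dual of a cycle matroid
of a doubled cycle. -/
lemma dual_indep_iff_of_fibers (hT : ∃ i, i ∉ T) (hhit : ∀ i ∉ T, ∃ e ∈ M.E, q e = i)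
    (hM : ∀ I ⊆ M.E, M.Indep I ↔ ¬ ∃ i j, i ≠ j ∧ i ∉ T ∧ j ∉ T ∧ (∀ e ∈ M.E, q e = i → e ∈ I) ∧
      ∀ e ∈ M.E, q e = j → e ∈ I) {I : Set α} (hI : I ⊆ M.E) :
    M✶.Indep I ↔ ¬ CycleDep q T I := by
  classical
  rw [Matroid.dual_indep_iff_exists hI]
  constructor
  · rintro ⟨X, hX, hXI⟩ hd
    have hXind := (hM X hX.subset_ground).1 hX.indep
    have hins : ∀ e ∈ I, ¬ M.Indep (insert e X) := fun e he hi => by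
      have := hX.eq_of_subset_indep hi (subset_insert e X)
      exact disjoint_left.1 hXI he (this ▸ mem_insert e X)
    have hinsE : ∀ e ∈ I, insert e X ⊆ M.E := fun e he => insert_subset (hI he) hX.subset_ground
    -- fibers other than that of the new element are unchanged
    have hold : ∀ e i, q e ≠ i → (∀ f ∈ M.E, q f = i → f ∈ insert e X) →
        ∀ f ∈ M.E, q f = i → f ∈ X := fun e i hei h f hf hfi =>
      (h f hf hfi).resolve_left fun hfe => hei (hfe ▸ hfi)
    rcases hd with ⟨i, hi⟩ | hall
    · obtain ⟨e, heI, hei, hnew⟩ : ∃ e ∈ I, q e = i ∧ (i ∈ T ∨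
          ¬ ∀ f ∈ M.E, q f = i → f ∈ insert e X) := by
        rcases hi with hi | ⟨hiT, e, he, hei⟩ | ⟨e, he, f, hf, hne, hei, hfi⟩
        · exact hi.elim
        · exact ⟨e, he, hei, Or.inl hiT⟩
        · refine ⟨e, he, hei, Or.inr fun h => ?_⟩
          rcases h f (hI hf) hfi with hfe | hfX
          · exact hne hfe.symm
          · exact disjoint_left.1 hXI hf hfX
      refine hins e heI ((hM _ (hinsE e heI)).2 ?_)
      rintro ⟨j, l, hjl, hj, hl, hjX, hlX⟩
      have hji : ∀ j ∉ T, (∀ f ∈ M.E, q f = j → f ∈ insert e X) → q e ≠ j := by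
        rintro j hj hjX rfl
        rcases hnew with h | h
        · exact hj (hei ▸ h)
        · exact h (hei ▸ hjX)
      exact hXind ⟨j, l, hjl, hj, hl, hold e j (hji j hj hjX) hjX, hold e l (hji l hl hlX) hlX⟩
    · have hnone : ∀ i ∉ T, ¬ ∀ f ∈ M.E, q f = i → f ∈ X := fun i hi h => by
        obtain ⟨e, he, hei⟩ := hall i hi
        exact disjoint_left.1 hXI he (h e (hI he) hei)
      obtain ⟨i, hi⟩ := hT
      obtain ⟨e, he, hei⟩ := hall i hi
      refine hins e he ((hM _ (hinsE e he)).2 ?_)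
      rintro ⟨j, l, hjl, hj, hl, hjX, hlX⟩
      by_cases hej : q e = j
      · exact hnone l hl (hold e l (fun h => hjl (hej.symm.trans h)) hlX)
      · exact hnone j hj (hold e j hej hjX)
  · intro hd
    have h1 : ∃ i ∉ T, ∀ e ∈ I, q e ≠ i := by
      by_contra! h
      exact hd (Or.inr h)
    obtain ⟨i, hi, hiI⟩ := h1
    have hfull : ∀ j, ¬ FullLeg q T ∅ I j := fun j hj => hd (Or.inl ⟨j, hj⟩)
    have hch : ∀ j, ∃ e, j ∉ T → e ∈ M.E ∧ q e = j ∧ ∀ f ∈ I, q f = j → f = e := by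
      intro j
      by_cases hj : ∃ e ∈ I, q e = j
      · obtain ⟨e, he, hej⟩ := hj
        refine ⟨e, fun _ => ⟨hI he, hej, fun f hf hfj => ?_⟩⟩
        by_contra hne
        exact hfull j (Or.inr (Or.inr ⟨f, hf, e, he, hne, hfj, hej⟩))
      · by_cases hjT : j ∈ T
        · obtain ⟨e, -, -⟩ := hhit i hi
          exact ⟨e, fun h => (h hjT).elim⟩
        · obtain ⟨e, he, hej⟩ := hhit j hjT
          exact ⟨e, fun _ => ⟨he, hej, fun f hf hfj => (hj ⟨f, hf, hfj⟩).elim⟩⟩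
    choose g hg using hch
    refine ⟨{e | e ∈ M.E ∧ (q e ∈ T ∨ q e = i ∨ e ≠ g (q e))}, ?_, ?_⟩
    · refine Matroid.Indep.isBase_of_maximal ((hM _ fun e he => he.1).2 ?_) fun J hJ hXJ => ?_
      · rintro ⟨j, l, hjl, hj, hl, hjX, hlX⟩
        have : ∀ j ∉ T, (∀ e ∈ M.E, q e = j → e ∈ M.E ∧ (q e ∈ T ∨ q e = i ∨ e ≠ g (q e))) →
            j = i := by
          intro j hj h
          obtain ⟨hgE, hgj, -⟩ := hg j hj
          rcases (h (g j) hgE hgj).2 with h | h | h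
          · exact (hj (hgj ▸ h)).elim
          · exact hgj.symm.trans h
          · exact (h (by rw [hgj])).elim
        exact hjl ((this j hj hjX).trans (this l hl hlX).symm)
      · refine hXJ.antisymm fun e he => ?_
        by_contra heX
        have heE := hJ.subset_ground he
        have hex : q e ∉ T ∧ q e ≠ i ∧ e = g (q e) := by
          refine ⟨fun h => heX ⟨heE, Or.inl h⟩, fun h => heX ⟨heE, Or.inr (Or.inl h)⟩, ?_⟩
          by_contra h
          exact heX ⟨heE, Or.inr (Or.inr h)⟩
        refine (hM J hJ.subset_ground).1 hJ ⟨q e, i, hex.2.1, hex.1, hi, fun f hf hfe => ?_,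
          fun f hf hfi => hXJ ⟨hf, Or.inr (Or.inl hfi)⟩⟩
        by_cases hfg : f = g (q f)
        · rwa [hfg, hfe, ← hex.2.2]
        · exact hXJ ⟨hf, Or.inr (Or.inr hfg)⟩
    · rw [disjoint_left]
      rintro e he ⟨-, h | h | h⟩
      · exact hfull (q e) (Or.inr (Or.inl ⟨h, e, he, rfl⟩))
      · exact hiI e he h
      · by_cases hT : q e ∈ T
        · exact hfull (q e) (Or.inr (Or.inl ⟨hT, e, he, rfl⟩))
        · exact h ((hg (q e) hT).2.2 e he rfl)

end Duality

end SpikeMinor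

namespace SpikeMinor

universe x y

variable {α : Type x} {ι : Type y} {k : ℕ} {M : Matroid α} {q : α → ι}
  {T D : Set ι} {B : Set (Set α)}

lemma FullLeg.fiber {I : Set α} {i : ι} (h : FullLeg q T ∅ I i) :
    FullLeg q T ∅ {e | e ∈ I ∧ q e = i} i :=
  h.of_fiber_subset fun _ he hq => ⟨he, hq⟩

lemma categoryD_of_cycleDep [Finite ι] [M.Finite] (hlab : IsLegLabelling M.E q T)
    (hhit : ∀ i ∉ T, ∃ e ∈ M.E, q e = i) (hm : 2 ≤ Tᶜ.ncard)
    (hM : ∀ I ⊆ M.E, M.Indep I ↔ ¬ CycleDep q T I) : CategoryD M := by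
  obtain ⟨G, y, hG, hGE, hGc⟩ := exists_isRing M.ground_finite hlab hhit hm
  exact ⟨_, G, hGc, (hG.isCycleMatroid_iff M).2 ⟨hGE.symm, hM⟩⟩

lemma ncard_compl_pos [Finite ι] (h : ∃ i, i ∉ T) : 0 < Tᶜ.ncard := (ncard_pos).2 h

lemma categoryD_or_categoryF_of_cycleDep [Finite ι] [M.Finite] (hlab : IsLegLabelling M.E q T) (hT : ∃ i, i ∉ T)
    (hM : ∀ I ⊆ M.E, M.Indep I ↔ ¬ CycleDep q T I) : CategoryD M ∨ CategoryF M := by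
  by_cases hD : (∀ i ∉ T, ∃ e ∈ M.E, q e = i) ∧ 2 ≤ Tᶜ.ncard
  · exact Or.inl (categoryD_of_cycleDep hlab hD.1 hD.2 hM)
  refine Or.inr (categoryF_of_fibers hlab fun X hX hd => ?_)
  rw [hM X hX, not_not] at hd
  have hfib : ∀ i, {e | e ∈ X ∧ q e = i} ⊆ M.E := fun i e he => hX he.1
  rcases hd with ⟨i, hi⟩ | hall
  · exact ⟨i, by rw [hM _ (hfib i), not_not]; exact Or.inl ⟨i, hi.fiber⟩⟩
  · have h1 : Tᶜ.ncard = 1 := by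
      have := ncard_compl_pos hT
      have : ¬ 2 ≤ Tᶜ.ncard := fun h => hD ⟨fun i hi => by
        obtain ⟨e, he, h⟩ := hall i hi
        exact ⟨e, hX he, h⟩, h⟩
      omega
    obtain ⟨i, hi⟩ := ncard_eq_one.1 h1
    refine ⟨i, by
      rw [hM _ (hfib i), not_not]
      refine Or.inr fun j hj => ?_
      have hji : j ∈ ({i} : Set ι) := hi ▸ hj
      obtain ⟨e, he, h⟩ := hall j hj
      exact ⟨e, ⟨he, h.trans hji⟩, h⟩⟩

lemma legDep_iff_of_compl_eq_singleton {E : Set α} (hlab : IsLegLabelling E q T) {i : ι}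
    (hi : Tᶜ = {i}) (hB : ∀ b ∈ B, ∃ e ∈ E, b = {e}) {I : Set α} (hI : I ⊆ E) :
    LegDep q T ∅ B I ↔ (∃ e ∈ I, {e} ∈ B) ∨ ∃ e ∈ I, ∃ f ∈ I, e ≠ f := by
  have hiT : i ∉ T := by
    have : i ∈ Tᶜ := hi ▸ mem_singleton i
    exact this
  have hjT : ∀ j, j ≠ i → j ∈ T := fun j hj => by
    by_contra hn
    have : j ∈ ({i} : Set ι) := hi ▸ hn
    exact hj this
  constructor
  · rintro (⟨j, l, hjl, hj, hl⟩ | ⟨⟨j, hj⟩, hall⟩ | ⟨b, hb, hbI⟩)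
    · obtain ⟨e, he, rfl⟩ := hj.exists_mem
      obtain ⟨f, hf, rfl⟩ := hl.exists_mem
      exact Or.inr ⟨e, he, f, hf, fun hef => hjl (hef ▸ rfl)⟩
    · obtain ⟨f, hf, hfi⟩ := hall i hiT
      rcases hj with hj | ⟨hj, e, he, rfl⟩ | ⟨e, he, g, hg, hne, -, -⟩
      · exact hj.elim
      · refine Or.inr ⟨e, he, f, hf, ?_⟩
        rintro rfl
        exact hiT (hfi ▸ hj)
      · exact Or.inr ⟨e, he, g, hg, hne⟩
    · obtain ⟨e, he, rfl⟩ := hB b hb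
      exact Or.inl ⟨e, hbI rfl, hb⟩
  · rintro (⟨e, he, heB⟩ | ⟨e, he, f, hf, hef⟩)
    · exact Or.inr (Or.inr ⟨{e}, heB, by simpa using he⟩)
    · have hmet : ∀ g ∈ I, q g = i → ∀ j ∉ T, ∃ e ∈ I, q e = j := by
        intro g hg hgi j hj
        refine ⟨g, hg, hgi.trans ?_⟩
        by_contra hne
        exact hj (hjT j fun h => hne h.symm)
      by_cases hei : q e = i
      · by_cases hfi : q f = i
        · exact Or.inr (Or.inl ⟨⟨i, Or.inr (Or.inr ⟨e, he, f, hf, hef, hei, hfi⟩)⟩, hmet e he hei⟩)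
        · exact Or.inr (Or.inl ⟨⟨q f, Or.inr (Or.inl ⟨hjT _ hfi, f, hf, rfl⟩)⟩, hmet e he hei⟩)
      · by_cases hfi : q f = i
        · exact Or.inr (Or.inl ⟨⟨q e, Or.inr (Or.inl ⟨hjT _ hei, e, he, rfl⟩)⟩, hmet f hf hfi⟩)
        · refine Or.inl ⟨q e, q f, fun hq => hef ?_, Or.inr (Or.inl ⟨hjT _ hei, e, he, rfl⟩),
            Or.inr (Or.inl ⟨hjT _ hfi, f, hf, rfl⟩)⟩
          exact hlab.fiber_one e (hI he) f (hI hf) hq (hjT _ hei)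

namespace HasLegs

variable (h : HasLegs k M q T D B)
include h

lemma indep_iff_cycleDep (hD : D.Nonempty) :
    (∃ i, i ∉ T) ∧ ∀ I ⊆ M.E, M.Indep I ↔ ¬ CycleDep q T I := by
  obtain ⟨d, hd⟩ := hD
  have hempty := (h.indep_iff ∅ (empty_subset _)).1 M.empty_indep
  have hDd : ∀ i ∈ D, i = d := fun i hi => by
    by_contra hne
    exact hempty (Or.inl ⟨i, d, hne, Or.inl hi, Or.inl hd⟩)
  have hB := h.eq_empty ⟨d, hd⟩
  refine ⟨?_, fun I hI => ?_⟩
  · by_contra! hT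
    exact hempty (Or.inr (Or.inl ⟨⟨d, Or.inl hd⟩, fun i hi => (hi (hT i)).elim⟩))
  rw [h.indep_iff I hI, not_iff_not]
  constructor
  · rintro (⟨i, j, hij, hi, hj⟩ | ⟨-, hall⟩ | ⟨b, hb, -⟩)
    · by_cases hid : i ∈ D
      · refine Or.inl ⟨j, Or.inr (hj.resolve_left fun hjd => ?_)⟩
        exact hij ((hDd i hid).trans (hDd j hjd).symm)
      · exact Or.inl ⟨i, Or.inr (hi.resolve_left hid)⟩
    · exact Or.inr hall
    · simp [hB] at hb
  · rintro (⟨i, hi⟩ | hall)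
    · refine Or.inl ⟨i, d, ?_, Or.inr (hi.resolve_left (notMem_empty _)), Or.inl hd⟩
      rintro rfl
      obtain ⟨e, he, rfl⟩ := hi.exists_mem
      exact h.notMem e (hI he) hd
    · exact Or.inr (Or.inl ⟨⟨d, Or.inl hd⟩, hall⟩)

lemma categoryE_or_categoryF [Finite ι] [M.Finite] (hD : D = ∅) {l : ι} (hl : l ∉ T) (hlE : ∀ e ∈ M.E, q e ≠ l) :
    CategoryE M ∨ CategoryF M := by
  subst hD
  set S : Set ι := {i | FullLeg q T ∅ M.E i} with hS
  have hfull : ∀ I ⊆ M.E, ∀ i, FullLeg q T ∅ I i ↔ i ∈ S ∧ ∀ e ∈ M.E, q e = i → e ∈ I := by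
    intro I hI i
    constructor
    · intro hi
      obtain ⟨U, hUI, hU, hUi⟩ := hi.exists_unit hI
      exact ⟨hi.mono hI, fun e he hei => hUI (h.labelling.mem_unit hU hUi he hei)⟩
    · rintro ⟨hi, hiI⟩
      exact FullLeg.of_fiber_subset hi hiI
  have hM : ∀ I ⊆ M.E, M.Indep I ↔ ¬ ∃ i j, i ≠ j ∧ i ∉ Sᶜ ∧ j ∉ Sᶜ ∧
      (∀ e ∈ M.E, q e = i → e ∈ I) ∧ ∀ e ∈ M.E, q e = j → e ∈ I := by
    intro I hI
    rw [h.indep_iff I hI, not_iff_not]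
    constructor
    · rintro (⟨i, j, hij, hi, hj⟩ | ⟨-, hall⟩ | ⟨b, hb, hbI⟩)
      · obtain ⟨h1, h2⟩ := (hfull I hI i).1 hi
        obtain ⟨h3, h4⟩ := (hfull I hI j).1 hj
        exact ⟨i, j, hij, not_not.2 h1, not_not.2 h3, h2, h4⟩
      · obtain ⟨e, he, hel⟩ := hall l hl
        exact (hlE e (hI he) hel).elim
      · obtain ⟨e, he, hel⟩ := (h.transversal b hb).exists_mem hl
        exact (hlE e (hI (hbI he)) hel).elim
    · rintro ⟨i, j, hij, h1, h3, h2, h4⟩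
      exact Or.inl ⟨i, j, hij, (hfull I hI i).2 ⟨not_not.1 h1, h2⟩,
        (hfull I hI j).2 ⟨not_not.1 h3, h4⟩⟩
  by_cases hm : 2 ≤ S.ncard
  · left
    have hhit : ∀ i ∉ Sᶜ, ∃ e ∈ M.E, q e = i := fun i hi => (not_not.1 hi).exists_mem
    have hlab : IsLegLabelling M.E q Sᶜ := by
      refine ⟨h.labelling.fiber_two, fun e he f hf hef hS => ?_⟩
      by_contra hne
      exact hS (Or.inr (Or.inr ⟨e, he, f, hf, hne, rfl, hef.symm⟩))
    have hT : ∃ i, i ∉ Sᶜ := by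
      obtain ⟨i, hi⟩ := nonempty_of_ncard_ne_zero (by omega : S.ncard ≠ 0)
      exact ⟨i, not_not.2 hi⟩
    exact categoryD_of_cycleDep (M := M✶) hlab hhit (by rwa [compl_compl])
      fun I hI => dual_indep_iff_of_fibers hT hhit hM hI
  · right
    refine categoryF_of_fibers h.labelling fun X hX hd => ?_
    rw [hM X hX, not_not] at hd
    obtain ⟨i, j, hij, hi, hj, -⟩ := hd
    exact (hm ((one_lt_ncard (toFinite S)).2 ⟨i, not_not.1 hi, j, not_not.1 hj, hij⟩)).elim

lemma categoryC [M.Finite] {i : ι} (hi : Tᶜ = {i}) (hD : D = ∅) :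
    CategoryC k M := by
  subst hD
  have hiT : i ∉ T := by
    have : i ∈ Tᶜ := hi ▸ mem_singleton i
    exact this
  have hjT : ∀ j, j ≠ i → j ∈ T := fun j hj => by
    by_contra hn
    have : j ∈ ({i} : Set ι) := hi ▸ hn
    exact hj this
  have hB : ∀ b ∈ B, ∃ e ∈ M.E, b = {e} := by
    intro b hb
    have hbt := h.transversal b hb
    obtain ⟨e, he, hei⟩ := hbt.exists_mem hiT
    refine ⟨e, hbt.1 he, Subset.antisymm (fun f hf => ?_) (by simpa)⟩
    refine hbt.inj hf he ?_
    by_contra hne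
    exact hbt.notMem hf (hjT _ (hei ▸ hne))
  have hBs : B.Subsingleton := by
    intro b hb c hc
    refine h.separated b hb c hc i fun e he => ?_
    exact iff_of_false (fun heb => (h.transversal b hb).notMem heb (hjT _ he))
      (fun hec => (h.transversal c hc).notMem hec (hjT _ he))
  let G : Graph Unit α :=
    { vertexSet := univ
      edgeSet := M.E
      IsLink := fun e _ _ => e ∈ M.E
      isLink_symm := fun e _ => ⟨fun _ _ h => h⟩
      eq_or_eq_of_isLink_of_isLink := fun _ _ _ _ _ _ _ => Or.inl rfl
      edge_mem_iff_exists_isLink := fun e => ⟨fun h => ⟨(), (), h⟩, fun ⟨_, _, h⟩ => h⟩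
      left_mem_of_isLink := fun _ _ _ _ => mem_univ _ }
  have hG : G.vertexSet = {()} := by
    ext; simp [G]
  refine ⟨Unit, G, B, ⟨M.ground_finite, Or.inl ⟨(), hG⟩⟩, by rw [hG]; simp,
    isLinearClass_of_vertexSet_eq_singleton hG hB, ?_,
    (isLiftMatroid_iff_of_vertexSet_eq_singleton hG hB M).2 ⟨rfl, fun I hI => ?_⟩⟩
  · have h1 : B.encard ≤ 1 := encard_le_one_iff_subsingleton.2 hBs
    rcases Nat.le_total k 1 with hk | hk
    · rw [min_eq_left hk]; exact h.encard_le
    · rw [min_eq_right hk]; exact_mod_cast h1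
  rw [h.indep_iff I hI, legDep_iff_of_compl_eq_singleton h.labelling hi hB hI]

theorem categories [Finite ι] [M.Finite] : CategoryA k M ∨ CategoryB k M ∨ CategoryC k M ∨
    CategoryD M ∨ CategoryE M ∨ CategoryF M := by
  by_cases hDn : D.Nonempty
  · obtain ⟨hT, hM⟩ := h.indep_iff_cycleDep hDn
    rcases categoryD_or_categoryF_of_cycleDep h.labelling hT hM with h | h
    · exact Or.inr (Or.inr (Or.inr (Or.inl h)))
    · exact Or.inr (Or.inr (Or.inr (Or.inr (Or.inr h))))
  have hD : D = ∅ := not_nonempty_iff_eq_empty.1 hDn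
  by_cases hhit : ∀ i ∉ T, ∃ e ∈ M.E, q e = i
  swap
  · push Not at hhit
    obtain ⟨l, hl, hlE⟩ := hhit
    rcases h.categoryE_or_categoryF hD hl hlE with h | h
    · exact Or.inr (Or.inr (Or.inr (Or.inr (Or.inl h))))
    · exact Or.inr (Or.inr (Or.inr (Or.inr (Or.inr h))))
  by_cases hm : 2 ≤ Tᶜ.ncard
  · obtain ⟨G, y, hG, hGE, hGc⟩ := exists_isRing M.ground_finite h.labelling hhit hm
    have hB : ∀ b ∈ B, IsTransversal G.edgeSet q T b := hGE ▸ h.transversal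
    have hlin := (hG.isLinearClass_iff hB).2 h.separated
    have hham : ∀ b ∈ B, IsHamiltonianCycle G b := fun b hb =>
      hG.isHamiltonianCycle_transversal (hB b hb)
    have hlift : IsLiftMatroid G B M :=
      (hG.isLiftMatroid_iff hB M).2 ⟨hGE.symm, by rw [← hD]; exact h.indep_iff⟩
    have hcard : G.vertexSet.encard = Tᶜ.ncard := by
      have : NeZero Tᶜ.ncard := ⟨by omega⟩
      rw [hG.vertexSet_eq, range_id, encard_univ, ENat.card_eq_coe_natCard, Nat.card_zmod]
    rcases Nat.lt_or_ge Tᶜ.ncard 3 with h3 | h3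
    · refine Or.inr (Or.inl ⟨_, G, B, hGc, ?_, hlin, hham, ?_, h.encard_le, hlift⟩)
      · rw [hcard, show Tᶜ.ncard = 2 by omega]; rfl
      · intro b hb c hc hbc
        rw [disjoint_left]
        intro e heb hec
        obtain ⟨i, j, hij, hTij⟩ := ncard_eq_two.1 (show Tᶜ.ncard = 2 by omega)
        obtain ⟨l, hl⟩ : ∃ l, ∀ m ∉ T, m ≠ l → m = q e := by
          have he : q e ∈ ({i, j} : Set ι) := hTij ▸ (h.transversal b hb).notMem heb
          have hm' : ∀ m ∉ T, m = i ∨ m = j := fun m hm => by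
            have : m ∈ ({i, j} : Set ι) := hTij ▸ hm
            exact this
          rcases he with he | he
          · exact ⟨j, fun m hm hmj => ((hm' m hm).resolve_right hmj).trans he.symm⟩
          · exact ⟨i, fun m hm hmi => ((hm' m hm).resolve_left hmi).trans he.symm⟩
        refine hbc (h.separated b hb c hc l fun f hf => ?_)
        constructor
        · intro hfb
          have := hl _ ((h.transversal b hb).notMem hfb) hf
          rwa [(h.transversal b hb).inj hfb heb this]
        · intro hfc
          have := hl _ ((h.transversal c hc).notMem hfc) hf
          rwa [(h.transversal c hc).inj hfc hec this]
    · refine Or.inl ⟨_, G, B, hGc, ?_, hlin, hham, h.encard_le, hlift⟩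
      rw [hcard]
      exact_mod_cast h3
  · by_cases h0 : Tᶜ.ncard = 0
    · have hT : ∀ i, i ∈ T := fun i => by
        have : Tᶜ = ∅ := (ncard_eq_zero).1 h0
        by_contra hi
        exact (this ▸ hi : i ∈ (∅ : Set ι))
      refine Or.inr (Or.inr (Or.inr (Or.inr (Or.inr
        (categoryF_of_fibers h.labelling fun X hX hd => ?_)))))
      obtain ⟨e, he⟩ : X.Nonempty := by
        rw [nonempty_iff_ne_empty]
        rintro rfl
        exact hd M.empty_indep
      refine ⟨q e, ?_⟩
      rw [h.indep_iff _ (fun f hf => hX hf.1), not_not]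
      exact Or.inr (Or.inl ⟨⟨q e, Or.inr (Or.inl ⟨hT _, e, ⟨he, rfl⟩, rfl⟩)⟩,
        fun i hi => (hi (hT i)).elim⟩)
    · obtain ⟨i, hi⟩ := ncard_eq_one.1 (show Tᶜ.ncard = 1 by omega)
      exact Or.inr (Or.inr (Or.inl (h.categoryC hi hD)))

end HasLegs

end SpikeMinor

namespace SpikeMinor

universe x y

variable {V : Type x} {α : Type y}

section Rings

variable {G : Graph V α}

lemma eq_or_eq_or_eq_of_encard_le_two {S : Set α} (hS : S.encard ≤ 2) {e f g : α} (he : e ∈ S)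
    (hf : f ∈ S) (hg : g ∈ S) : e = f ∨ e = g ∨ f = g := by
  by_contra! h
  have h3 : ({e, f, g} : Set α).encard = 3 := encard_eq_three.2 ⟨e, f, g, h.1, h.2.1, h.2.2, rfl⟩
  have hle : ({e, f, g} : Set α).encard ≤ S.encard := by
    refine encard_le_encard ?_
    rintro a (rfl | rfl | rfl) <;> assumption
  rw [h3] at hle
  exact absurd (hle.trans hS) (by decide)

lemma IsDoubledCycle.exists_isRing (h : IsDoubledCycle G) :
    ∃ (n : ℕ) (v : ZMod n → V) (q : α → ZMod n ⊕ α), 3 ≤ n ∧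
      IsRing G n v Sum.inl q (range Sum.inr) ∧ ∀ i, ∃ e ∈ G.edgeSet, q e = Sum.inl i := by
  obtain ⟨n, v, hn, hv, hV, hadj, hpar⟩ := h
  have hne : ∀ i, v i ≠ v (i + 1) := fun i hi => by
    have : Fact (1 < n) := ⟨by omega⟩
    exact one_ne_zero (left_eq_add.1 (hv hi))
  have hq : ∀ e, ∃ l : ZMod n ⊕ α, e ∈ G.edgeSet →
      ((∃ a, G.IsLink e a a) ∧ l = Sum.inr e) ∨ ∃ i, G.IsLink e (v i) (v (i + 1)) ∧ l = Sum.inl i := by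
    intro e
    by_cases he : e ∈ G.edgeSet
    · obtain ⟨a, b, hab⟩ := G.exists_isLink_of_mem_edgeSet he
      by_cases h : a = b
      · subst h
        exact ⟨_, fun _ => Or.inl ⟨⟨a, hab⟩, rfl⟩⟩
      · obtain ⟨i, ⟨rfl, rfl⟩ | ⟨rfl, rfl⟩⟩ := (hadj a b h).1 ⟨e, hab⟩
        · exact ⟨_, fun _ => Or.inr ⟨i, hab, rfl⟩⟩
        · exact ⟨_, fun _ => Or.inr ⟨i, hab.symm, rfl⟩⟩
    · exact ⟨Sum.inr e, fun h => (he h).elim⟩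
  choose q hq using hq
  have hlink : ∀ e ∈ G.edgeSet, ∀ i, q e = Sum.inl i → G.IsLink e (v i) (v (i + 1)) := by
    intro e he i hi
    rcases hq e he with ⟨-, h⟩ | ⟨j, hj, h⟩
    · rw [hi] at h; simp at h
    · rw [hi] at h
      obtain rfl := Sum.inl_injective h
      exact hj
  have hloop : ∀ e ∈ G.edgeSet, ∀ f, q e = Sum.inr f → (∃ a, G.IsLink e a a) ∧ e = f := by
    intro e he f hf
    rcases hq e he with ⟨ha, h⟩ | ⟨j, hj, h⟩
    · rw [hf] at h
      exact ⟨ha, (Sum.inr_injective h).symm⟩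
    · rw [hf] at h; simp at h
  refine ⟨n, v, q, hn, ⟨by omega, hv, hV, Sum.inl_injective, compl_range_inr.symm, hlink, ?_,
    ?_, ?_⟩, ?_⟩
  · rintro e he ⟨f, hf⟩
    exact (hloop e he f hf.symm).1
  · intro e he f hf g hg hef heg
    rcases hqe : q e with i | a
    · exact eq_or_eq_or_eq_of_encard_le_two (hpar _ _ (hne i)) (hlink e he i hqe)
        (hlink f hf i (hef ▸ hqe)) (hlink g hg i (heg ▸ hqe))
    · exact Or.inl ((hloop e he a hqe).2.trans (hloop f hf a (hef ▸ hqe)).2.symm)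
  · rintro e he f hf hef ⟨a, ha⟩
    exact (hloop e he a ha.symm).2.trans (hloop f hf a (hef ▸ ha.symm)).2.symm
  · intro i
    obtain ⟨e, he⟩ := (hadj _ _ (hne i)).2 ⟨i, Or.inl ⟨rfl, rfl⟩⟩
    refine ⟨e, he.edge_mem, ?_⟩
    rcases hq e he.edge_mem with ⟨⟨a, ha⟩, -⟩ | ⟨j, hj, h⟩
    · rcases he.eq_and_eq_or_eq_and_eq ha with ⟨h1, h2⟩ | ⟨h1, h2⟩ <;>
        exact (hne i (h1.trans h2.symm)).elim
    · rw [h]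
      congr 1
      by_contra hij
      rcases he.eq_and_eq_or_eq_and_eq hj with ⟨h1, -⟩ | ⟨h1, h2⟩
      · exact hij (hv h1).symm
      · have h1 := hv h1
        have h2 := hv h2
        have : (2 : ZMod n) = 0 := by
          have : j + 2 = j := by rw [← one_add_one_eq_two, ← add_assoc, ← h1, h2]
          simpa using this
        have := zmod_two_eq_zero (by omega) this
        omega

/-- At most four parallel edges can be split into two pairs, such that the members of a family of
disjoint pairs are separated. -/
lemma exists_split {J : Set α} (hJ : J.encard ≤ 4) {B : Set (Set α)}
    (hB : ∀ b ∈ B, b ⊆ J ∧ b.encard = 2) (hdisj : ∀ b ∈ B, ∀ c ∈ B, b ≠ c → Disjoint b c) :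
    ∃ S ⊆ J, S.encard ≤ 2 ∧ (J \ S).encard ≤ 2 ∧ ∀ b ∈ B, ∃ e f, e ∈ S ∧ f ∉ S ∧ b = {e, f} := by
  have hJfin : J.Finite := finite_of_encard_le_coe (k := 4) hJ
  by_cases hBn : B.Nonempty
  · obtain ⟨b, hb⟩ := hBn
    obtain ⟨p, r, hpr, hbpr⟩ := encard_eq_two.1 (hB b hb).2
    have hpb : p ∈ b := by simp [hbpr]
    have hrb : r ∈ b := by simp [hbpr]
    have hJb : (J \ b).encard ≤ 2 := by
      have h1 := encard_sdiff_add_encard_of_subset (hB b hb).1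
      rw [(hB b hb).2] at h1
      rw [← h1] at hJ
      exact (ENat.add_le_add_iff_right (by simp : (2 : ℕ∞) ≠ ⊤)).1
        (hJ.trans (by norm_num : (4 : ℕ∞) ≤ 2 + 2))
    have hother : ∀ c ∈ B, c ≠ b → c = J \ b := by
      intro c hc hcb
      refine (hJfin.subset (hB c hc).1).eq_of_subset_of_encard_le ?_ ?_
      · exact subset_sdiff.2 ⟨(hB c hc).1, hdisj c hc b hb hcb⟩
      · rw [(hB c hc).2]; exact hJb
    by_cases hn : (J \ b).Nonempty
    · obtain ⟨c, hc⟩ := hn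
      have hJbc : ((J \ b) \ {c}).encard ≤ 1 := by
        have h1 := encard_sdiff_add_encard_of_subset (singleton_subset_iff.2 hc)
        rw [encard_singleton] at h1
        rw [← h1] at hJb
        exact (ENat.add_le_add_iff_right (by simp : (1 : ℕ∞) ≠ ⊤)).1
          (hJb.trans (by norm_num : (2 : ℕ∞) ≤ 1 + 1))
      refine ⟨{p, c}, ?_, (encard_insert_le _ _).trans (by rw [encard_singleton]; norm_num), ?_, ?_⟩
      · rintro a (rfl | rfl)
        · exact (hB b hb).1 hpb
        · exact hc.1
      · have : J \ {p, c} ⊆ {r} ∪ (J \ b) \ {c} := by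
          rintro a ⟨haJ, ha⟩
          by_cases har : a = r
          · exact Or.inl har
          · refine Or.inr ⟨⟨haJ, fun hab => ?_⟩, fun hac => ha (Or.inr hac)⟩
            rw [hbpr] at hab
            rcases hab with h | h
            · exact ha (Or.inl h)
            · exact har h
        refine (encard_le_encard this).trans ((encard_union_le _ _).trans ?_)
        rw [encard_singleton]
        exact (add_le_add le_rfl hJbc).trans (by norm_num)
      · intro d hd
        by_cases hdb : d = b
        · refine ⟨p, r, by simp, ?_, hdb.trans hbpr⟩
          rintro (h | h)
          · exact hpr h.symm
          · exact hc.2 (h ▸ hrb)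
        · have hdJ := hother d hd hdb
          have hcd : c ∈ d := hdJ ▸ hc
          obtain ⟨u, w, huw, hduw⟩ := encard_eq_two.1 (hB d hd).2
          have hnotp : ∀ a ∈ d, a ≠ p := fun a ha hap => by
            rw [hdJ] at ha
            exact ha.2 (hap ▸ hpb)
          have hcuw : c = u ∨ c = w := by
            have : c ∈ ({u, w} : Set α) := hduw ▸ hcd
            exact this
          rcases hcuw with rfl | rfl
          · refine ⟨c, w, by simp, ?_, hduw⟩
            rintro (h | h)
            · exact hnotp w (by simp [hduw]) h
            · exact huw h.symm
          · refine ⟨c, u, by simp, ?_, hduw.trans (pair_comm _ _)⟩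
            rintro (h | h)
            · exact hnotp u (by simp [hduw]) h
            · exact huw h
    · have hJb' : J ⊆ b := by
        intro a ha
        by_contra hab
        exact hn ⟨a, ha, hab⟩
      refine ⟨{p}, by simpa using (hB b hb).1 hpb, by simp, ?_, ?_⟩
      · refine (encard_le_encard (sdiff_subset.trans hJb')).trans (hB b hb).2.le
      · intro d hd
        have hdb : d = b := by
          by_contra hdb
          have := hother d hd hdb
          rw [not_nonempty_iff_eq_empty.1 hn] at this
          have h2 := (hB d hd).2
          rw [this] at h2
          simp at h2
        exact ⟨p, r, rfl, fun h => hpr h.symm, hdb.trans hbpr⟩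
  · have hBe : ∀ S : Set α, ∀ b ∈ B, ∃ e f, e ∈ S ∧ f ∉ S ∧ b = {e, f} :=
      fun S b hb => (hBn ⟨b, hb⟩).elim
    rcases le_total J.encard 2 with h2 | h2
    · exact ⟨J, Subset.rfl, h2, by simp, hBe J⟩
    · obtain ⟨S, hSJ, hS⟩ := exists_subset_encard_eq h2
      refine ⟨S, hSJ, hS.le, ?_, hBe S⟩
      have h1 := encard_sdiff_add_encard_of_subset hSJ
      rw [hS] at h1
      rw [← h1] at hJ
      exact (ENat.add_le_add_iff_right (by simp : (2 : ℕ∞) ≠ ⊤)).1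
        (hJ.trans (by norm_num : (4 : ℕ∞) ≤ 2 + 2))

lemma IsHamiltonianCycle.pair_of_vertexSet_eq {a b : V} (hab : a ≠ b)
    (hV : G.vertexSet = {a, b}) {C : Set α} (hC : IsHamiltonianCycle G C) :
    C ⊆ {e | G.IsLink e a b} ∧ C.encard = 2 := by
  obtain ⟨⟨n, v, e, hn, hv, he, hl, rfl⟩, hs⟩ := hC
  have : NeZero n := ⟨hn⟩
  have hmem : ∀ i, v i = a ∨ v i = b := fun i => by
    have : v i ∈ ({a, b} : Set V) := hV ▸ (hl i).left_mem
    exact this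
  have hn2 : n ≤ 2 := by
    have h1 : (range v).ncard ≤ ({a, b} : Set V).ncard :=
      ncard_le_ncard (by rintro _ ⟨i, rfl⟩; exact hmem i)
    rw [ncard_pair hab, ← image_univ, ncard_image_of_injective _ hv, ncard_univ,
      Nat.card_zmod] at h1
    exact h1
  obtain rfl | rfl : n = 1 ∨ n = 2 := by omega
  · exfalso
    have hloop : ∀ i, G.IsLink (e i) (v 0) (v 0) := fun i => by
      obtain rfl : i = 0 := Subsingleton.elim _ _
      have := hl 0
      rwa [Subsingleton.elim (0 + 1 : ZMod 1) 0] at this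
    have : ∀ w ∈ vertexSupport G (range e), w = v 0 := by
      rintro w ⟨_, ⟨i, rfl⟩, hw⟩
      simpa using hw.eq_or_eq_of_isLink (hloop i)
    rw [hs, hV] at this
    exact hab ((this a (by simp)).trans (this b (by simp)).symm)
  · have hz : ∀ i : ZMod 2, i ≠ i + 1 := by decide
    constructor
    · rintro _ ⟨i, rfl⟩
      have h1 := hl i
      have h2 := hv.ne (hz i)
      rcases hmem i with h3 | h3 <;> rcases hmem (i + 1) with h4 | h4
      · exact (h2 (h3.trans h4.symm)).elim
      · rw [h3, h4] at h1; exact h1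
      · rw [h3, h4] at h1; exact h1.symm
      · exact (h2 (h3.trans h4.symm)).elim
    · rw [← image_univ, he.encard_image, encard_univ, ENat.card_eq_coe_natCard, Nat.card_zmod]
      rfl

lemma IsTwoVertex.exists_isRing (h : IsTwoVertex G) {B : Set (Set α)}
    (hB : ∀ b ∈ B, IsHamiltonianCycle G b) (hdisj : ∀ b ∈ B, ∀ c ∈ B, b ≠ c → Disjoint b c) :
    ∃ (v : ZMod 2 → V) (q : α → ZMod 2 ⊕ α), IsRing G 2 v Sum.inl q (range Sum.inr) ∧
      (∃ i, ∃ e ∈ G.edgeSet, q e = Sum.inl i) ∧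
      ∀ b ∈ B, IsTransversal G.edgeSet q (range Sum.inr) b := by
  classical
  obtain ⟨a, b, hab, hV, hJn, hJ⟩ := h
  obtain ⟨S, hSJ, hS, hJS, hBS⟩ := exists_split hJ
    (fun c hc => (hB c hc).pair_of_vertexSet_eq hab hV) hdisj
  have hz : ∀ k : ZMod 2, k = 0 ∨ k = 1 := by decide
  have h10 : (1 : ZMod 2) ≠ 0 := by decide
  let q : α → ZMod 2 ⊕ α := fun e => if e ∈ S then Sum.inl 0 else
    if G.IsLink e a b then Sum.inl 1 else Sum.inr e
  have hq0 : ∀ e ∈ S, q e = Sum.inl 0 := fun e he => if_pos he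
  have hq1 : ∀ e, e ∉ S → G.IsLink e a b → q e = Sum.inl 1 := fun e h1 h2 => by
    simp [q, h1, h2]
  have hq2 : ∀ e, ¬ G.IsLink e a b → q e = Sum.inr e := fun e h => by
    have : e ∉ S := fun hS => h (hSJ hS)
    simp [q, this, h]
  have hcase : ∀ e, (e ∈ S ∧ G.IsLink e a b ∧ q e = Sum.inl 0) ∨
      (e ∉ S ∧ G.IsLink e a b ∧ q e = Sum.inl 1) ∨ (¬ G.IsLink e a b ∧ q e = Sum.inr e) := by
    intro e
    by_cases h1 : e ∈ S
    · exact Or.inl ⟨h1, hSJ h1, hq0 e h1⟩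
    · by_cases h2 : G.IsLink e a b
      · exact Or.inr (Or.inl ⟨h1, h2, hq1 e h1 h2⟩)
      · exact Or.inr (Or.inr ⟨h2, hq2 e h2⟩)
  let v : ZMod 2 → V := fun k => if k = 0 then a else b
  have hv0 : v 0 = a := if_pos rfl
  have hv1 : v 1 = b := if_neg h10
  refine ⟨v, q, ⟨le_rfl, ?_, ?_, Sum.inl_injective, compl_range_inr.symm, ?_, ?_, ?_, ?_⟩, ?_, ?_⟩
  · intro k l hkl
    rcases hz k with rfl | rfl <;> rcases hz l with rfl | rfl
    · rfl
    · rw [hv0, hv1] at hkl; exact (hab hkl).elim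
    · rw [hv0, hv1] at hkl; exact (hab hkl.symm).elim
    · rfl
  · rw [hV]
    ext w
    constructor
    · rintro (rfl | rfl)
      · exact ⟨0, hv0⟩
      · exact ⟨1, hv1⟩
    · rintro ⟨k, rfl⟩
      rcases hz k with rfl | rfl
      · exact Or.inl hv0
      · exact Or.inr hv1
  · intro e he i hi
    have hl : G.IsLink e a b := by
      by_contra hl
      rw [hq2 e hl] at hi
      simp at hi
    rcases hz i with rfl | rfl
    · rw [show (0 + 1 : ZMod 2) = 1 by decide, hv0, hv1]; exact hl
    · rw [show (1 + 1 : ZMod 2) = 0 by decide, hv0, hv1]; exact hl.symm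
  · rintro e he ⟨f, hf⟩
    have hl : ¬ G.IsLink e a b := by
      rcases hcase e with ⟨-, -, h⟩ | ⟨-, -, h⟩ | ⟨h, -⟩
      · rw [h] at hf; simp at hf
      · rw [h] at hf; simp at hf
      · exact h
    obtain ⟨c, d, hcd⟩ := G.exists_isLink_of_mem_edgeSet he
    have hc : c ∈ ({a, b} : Set V) := hV ▸ hcd.left_mem
    have hd : d ∈ ({a, b} : Set V) := hV ▸ hcd.right_mem
    rcases hc with rfl | rfl <;> rcases hd with rfl | rfl
    · exact ⟨_, hcd⟩
    · exact (hl hcd).elim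
    · exact (hl hcd.symm).elim
    · exact ⟨_, hcd⟩
  · intro e he f hf g hg hef heg
    rcases hcase e with ⟨h1, -, h⟩ | ⟨h1, h1', h⟩ | ⟨h1, h⟩
    · have hm : ∀ f, q e = q f → f ∈ S := by
        intro f hf
        rcases hcase f with ⟨h2, -, -⟩ | ⟨-, -, h2⟩ | ⟨-, h2⟩
        · exact h2
        · rw [h, h2] at hf; exact (h10 (Sum.inl_injective hf).symm).elim
        · rw [h, h2] at hf; simp at hf
      exact eq_or_eq_or_eq_of_encard_le_two hS h1 (hm f hef) (hm g heg)
    · have hm : ∀ f, q e = q f → f ∈ {e | G.IsLink e a b} \ S := by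
        intro f hf
        rcases hcase f with ⟨-, -, h2⟩ | ⟨h2, h3, -⟩ | ⟨-, h2⟩
        · rw [h, h2] at hf; exact (h10 (Sum.inl_injective hf)).elim
        · exact ⟨h3, h2⟩
        · rw [h, h2] at hf; simp at hf
      exact eq_or_eq_or_eq_of_encard_le_two hJS ⟨h1', h1⟩ (hm f hef) (hm g heg)
    · left
      rcases hcase f with ⟨-, -, h2⟩ | ⟨-, -, h2⟩ | ⟨-, h2⟩
      · rw [h, h2] at hef; simp at hef
      · rw [h, h2] at hef; simp at hef
      · rw [h, h2] at hef; exact Sum.inr_injective hef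
  · rintro e he f hf hef ⟨g, hg⟩
    have hinr : ∀ f, Sum.inr g = q f → g = f := by
      intro f hf
      rcases hcase f with ⟨-, -, h2⟩ | ⟨-, -, h2⟩ | ⟨-, h2⟩
      · rw [h2] at hf; simp at hf
      · rw [h2] at hf; simp at hf
      · rw [h2] at hf; exact Sum.inr_injective hf
    exact (hinr e hg).symm.trans (hinr f (hg.trans hef))
  · obtain ⟨e, he⟩ := hJn
    rcases hcase e with ⟨-, -, h⟩ | ⟨-, -, h⟩ | ⟨h, -⟩
    · exact ⟨0, e, he.edge_mem, h⟩
    · exact ⟨1, e, he.edge_mem, h⟩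
    · exact (h he).elim
  · intro c hc
    obtain ⟨e, f, he, hf, rfl⟩ := hBS c hc
    have hJc := ((hB _ hc).pair_of_vertexSet_eq hab hV).1
    have hfJ : G.IsLink f a b := hJc (by simp)
    have hqe := hq0 e he
    have hqf := hq1 f hf hfJ
    refine ⟨fun g hg => (hJc hg).edge_mem, ?_, ?_, ?_⟩
    · rintro g (rfl | rfl) ⟨w, hw⟩
      · rw [hqe] at hw; simp at hw
      · rw [hqf] at hw; simp at hw
    · rintro g (rfl | rfl) g' (rfl | rfl) hgg
      · rfl
      · rw [hqe, hqf] at hgg; exact (h10 (Sum.inl_injective hgg).symm).elim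
      · rw [hqe, hqf] at hgg; exact (h10 (Sum.inl_injective hgg)).elim
      · rfl
    · intro j hj
      rcases j with k | w
      · rcases hz k with rfl | rfl
        · exact ⟨e, by simp, hqe⟩
        · exact ⟨f, by simp, hqf⟩
      · exact (hj ⟨w, rfl⟩).elim

end Rings

lemma finite_compl_range_inr {n : ℕ} [NeZero n] :
    (range (Sum.inr : α → ZMod n ⊕ α))ᶜ.Finite := by
  rw [compl_range_inr]
  exact finite_range _

lemma IsRing.hasLegs {ι : Type*} {G : Graph V α} {n : ℕ} {v : ZMod n → V} {y : ZMod n → ι}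
    {q : α → ι} {T : Set ι} (h : IsRing G n v y q T) {B : Set (Set α)} {k : ℕ} {M : Matroid α}
    [M.Finite] (hB : ∀ b ∈ B, IsTransversal G.edgeSet q T b) (hlin : IsLinearClass G B)
    (hk : B.encard ≤ k) (hM : IsLiftMatroid G B M) : HasLegs k M q T ∅ B where
  labelling := hM.1 ▸ h.labelling
  subset := empty_subset _
  notMem := fun _ _ => notMem_empty _
  transversal := hM.1 ▸ hB
  separated := (h.isLinearClass_iff hB).1 hlin
  eq_empty := fun h => (h.ne_empty rfl).elim
  encard_le := hk
  indep_iff := ((h.isLiftMatroid_iff hB M).1 hM).2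

lemma IsOneVertex.encard {G : Graph V α} (h : IsOneVertex G) : G.vertexSet.encard = 1 := by
  obtain ⟨a, h⟩ := h
  rw [h, encard_singleton]

lemma IsTwoVertex.encard {G : Graph V α} (h : IsTwoVertex G) : G.vertexSet.encard = 2 := by
  obtain ⟨a, b, hab, h, -⟩ := h
  rw [h, encard_pair hab]

lemma IsDoubledCycle.three_le_encard {G : Graph V α} (h : IsDoubledCycle G) :
    3 ≤ G.vertexSet.encard := by
  obtain ⟨n, v, hn, hv, h, -⟩ := h
  have : NeZero n := ⟨by omega⟩
  rw [h, ← image_univ, hv.encard_image, encard_univ, ENat.card_eq_coe_natCard, Nat.card_zmod]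
  exact_mod_cast hn

variable {k : ℕ} {M : Matroid α} [M.Finite]

theorem CategoryA.inClassS (h : CategoryA k M) : InClassS k M := by
  obtain ⟨V, G, B, hG, h3, hlin, hham, hk, hM⟩ := h
  have hd : IsDoubledCycle G := by
    rcases hG.2 with h | h | h
    · rw [h.encard] at h3; exact absurd h3 (by decide)
    · rw [h.encard] at h3; exact absurd h3 (by decide)
    · exact h
  obtain ⟨n, v, q, hn, hring, -⟩ := hd.exists_isRing
  have := hring.neZero
  exact (hring.hasLegs (fun b hb => hring.transversal_of_isHamiltonianCycle hn (hham b hb)) hlin hk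
    hM).inClassS finite_compl_range_inr

theorem CategoryB.inClassS (h : CategoryB k M) : InClassS k M := by
  obtain ⟨V, G, B, hG, h2, hlin, hham, hdisj, hk, hM⟩ := h
  have hd : IsTwoVertex G := by
    rcases hG.2 with h | h | h
    · rw [h.encard] at h2; exact absurd h2 (by decide)
    · exact h
    · have := h.three_le_encard
      rw [h2] at this; exact absurd this (by decide)
  obtain ⟨v, q, hring, -, hB⟩ := hd.exists_isRing hham hdisj
  exact (hring.hasLegs hB hlin hk hM).inClassS finite_compl_range_inr

theorem CategoryC.inClassS (h : CategoryC k M) : InClassS k M := by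
  classical
  obtain ⟨V, G, B, hG, h1, hlin, hk, hM⟩ := h
  obtain ⟨a, hV⟩ := encard_eq_one.1 h1
  have hB : ∀ b ∈ B, ∃ e ∈ G.edgeSet, b = {e} := fun b hb =>
    (isCycle_iff_of_vertexSet_eq_singleton hV).1 (hlin.1 b hb)
  have hMI := ((isLiftMatroid_iff_of_vertexSet_eq_singleton hV hB M).1 hM).2
  rw [← hM.1] at hB
  have hBs : B.Subsingleton := by
    refine encard_le_one_iff_subsingleton.1 (hk.trans ?_)
    exact_mod_cast min_le_right k 1
  let q : α → Option α := fun e => if {e} ∈ B then none else some e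
  have hqn : ∀ e, q e = none ↔ {e} ∈ B := fun e => by
    by_cases h : {e} ∈ B <;> simp [q, h]
  have hqs : ∀ e f, q e = some f → e = f := fun e f => by
    by_cases h : {e} ∈ B <;> simp [q, h]
  have hT : (range (some : α → Option α))ᶜ = {none} := by
    ext i
    rcases i with _ | i <;> simp
  have hinj : ∀ e f, q e = q f → e = f := by
    intro e f hef
    rcases hqe : q e with _ | g
    · exact singleton_injective (hBs ((hqn e).1 hqe) ((hqn f).1 (hef ▸ hqe)))
    · exact (hqs e g hqe).trans (hqs f g (hef ▸ hqe)).symm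
  have hlab : IsLegLabelling M.E q (range some) :=
    ⟨fun e _ f _ g _ hef _ => Or.inl (hinj e f hef), fun e _ f _ hef _ => hinj e f hef⟩
  have hlegs : HasLegs k M q (range some) ∅ B := by
    refine ⟨hlab, empty_subset _, fun _ _ => notMem_empty _, ?_, ?_,
      fun h => (h.ne_empty rfl).elim, ?_, fun I hI => ?_⟩
    · intro b hb
      obtain ⟨e, he, rfl⟩ := hB b hb
      rw [IsTransversal, hT, bijOn_singleton]
      exact ⟨by simpa using he, (hqn e).2 hb⟩
    · exact fun b hb c hc _ _ => hBs hb hc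
    · exact hk.trans (by exact_mod_cast min_le_left k 1)
    · rw [hMI I hI, legDep_iff_of_compl_eq_singleton hlab hT hB hI]
  exact hlegs.inClassS (by rw [hT]; exact finite_singleton _)

omit [M.Finite] in
/-- A doubled cycle gives a matroid with two elements of one leg contracted. -/
lemma hasLegs_of_cycleDep {ι : Type*} {q : α → ι} {T : Set ι} (hlab : IsLegLabelling M.E q T)
    (hM : ∀ I ⊆ M.E, M.Indep I ↔ ¬ CycleDep q T I) :
    HasLegs k M (fun e => some (q e)) (some '' T ∪ {none}) {none} ∅ := by
  have hmem : ∀ i, some i ∈ some '' T ∪ {none} ↔ i ∈ T := by simp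
  have hfull : ∀ I i, FullLeg (fun e => some (q e)) (some '' T ∪ {none}) {none} I (some i) ↔
      FullLeg q T ∅ I i := by
    intro I i
    simp only [FullLeg, hmem, mem_singleton_iff, reduceCtorEq, mem_empty_iff_false,
      Option.some.injEq]
  refine ⟨⟨?_, ?_⟩, subset_union_right, by simp, by simp, ?_, by simp, by simp, fun I hI => ?_⟩
  · intro e he f hf g hg hef heg
    exact hlab.fiber_two e he f hf g hg (Option.some_injective _ hef) (Option.some_injective _ heg)
  · intro e he f hf hef ht
    exact hlab.fiber_one e he f hf (Option.some_injective _ hef) ((hmem _).1 ht)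
  · intro b hb
    exact hb.elim
  rw [hM I hI, not_iff_not]
  have hnone : FullLeg (fun e => some (q e)) (some '' T ∪ {none}) {none} I none := Or.inl rfl
  constructor
  · rintro (⟨i, hi⟩ | hall)
    · exact Or.inl ⟨some i, none, by simp, (hfull I i).2 hi, hnone⟩
    · refine Or.inr (Or.inl ⟨⟨none, hnone⟩, fun j hj => ?_⟩)
      rcases j with _ | j
      · exact (hj (Or.inr rfl)).elim
      · obtain ⟨e, he, h⟩ := hall j fun h => hj ((hmem j).2 h)
        exact ⟨e, he, congrArg some h⟩
  · rintro (⟨i, j, hij, hi, hj⟩ | ⟨-, hall⟩ | ⟨b, hb, -⟩)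
    · rcases i with _ | i
      · rcases j with _ | j
        · exact (hij rfl).elim
        · exact Or.inl ⟨j, (hfull I j).1 hj⟩
      · exact Or.inl ⟨i, (hfull I i).1 hi⟩
    · refine Or.inr fun i hi => ?_
      obtain ⟨e, he, h⟩ := hall (some i) fun h => hi ((hmem i).1 h)
      exact ⟨e, he, Option.some_injective _ h⟩
    · exact hb.elim

/-- The labelling of the edges of a graph in the class `𝒢`. At most one leg is empty. -/
lemma CategoryD.exists_labelling (h : CategoryD M) :
    ∃ (ι : Type y) (q : α → ι) (T : Set ι), IsLegLabelling M.E q T ∧ Tᶜ.Finite ∧ (∃ i, i ∉ T) ∧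
      (∀ i ∉ T, ∀ j ∉ T, i ≠ j → ∃ e ∈ M.E, q e = i ∨ q e = j) ∧
      ∀ I ⊆ M.E, M.Indep I ↔ ¬ CycleDep q T I := by
  obtain ⟨V, G, hG, hM⟩ := h
  rcases hG.2 with h | h | h
  · obtain ⟨a, hV⟩ := h
    have hMI := ((isCycleMatroid_iff_of_vertexSet_eq_singleton hV M).1 hM).2
    have hT : ∀ i : Option α, i ∉ range (some : α → Option α) → i = none := by
      intro i hi
      rcases i with _ | i
      · rfl
      · exact (hi ⟨i, rfl⟩).elim
    refine ⟨Option α, some, range some, ⟨?_, ?_⟩, ?_, ⟨none, by simp⟩, ?_, fun I hI => ?_⟩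
    · intro e _ f _ g _ hef _
      exact Or.inl (Option.some_injective _ hef)
    · intro e _ f _ hef _
      exact Option.some_injective _ hef
    · exact (finite_singleton none).subset hT
    · intro i hi j hj hij
      exact (hij ((hT i hi).trans (hT j hj).symm)).elim
    · rw [hMI I hI, not_iff_not]
      constructor
      · rintro ⟨e, he⟩
        exact Or.inl ⟨some e, Or.inr (Or.inl ⟨⟨e, rfl⟩, e, he, rfl⟩)⟩
      · rintro (⟨i, hi⟩ | hall)
        · obtain ⟨e, he, -⟩ := hi.exists_mem
          exact ⟨e, he⟩
        · obtain ⟨e, he, -⟩ := hall none (by simp)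
          exact ⟨e, he⟩
  · obtain ⟨v, q, hring, ⟨i, e, he, hei⟩, -⟩ := h.exists_isRing (B := ∅) (by simp) (by simp)
    refine ⟨_, q, _, hM.1 ▸ hring.labelling, finite_compl_range_inr, ⟨Sum.inl 0, by simp⟩, ?_,
      ((hring.isCycleMatroid_iff M).1 hM).2⟩
    intro j hj l hl hjl
    refine ⟨e, hM.1 ▸ he, ?_⟩
    obtain ⟨j, rfl⟩ := hring.exists_label hj
    obtain ⟨l, rfl⟩ := hring.exists_label hl
    have hz : ∀ i j l : ZMod 2, j ≠ l → i = j ∨ i = l := by decide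
    rw [hei]
    exact (hz i j l fun h => hjl (h ▸ rfl)).imp (congrArg _) (congrArg _)
  · obtain ⟨n, v, q, hn, hring, hhit⟩ := h.exists_isRing
    have := hring.neZero
    refine ⟨_, q, _, hM.1 ▸ hring.labelling, finite_compl_range_inr, ⟨Sum.inl 0, by simp⟩, ?_,
      ((hring.isCycleMatroid_iff M).1 hM).2⟩
    intro j hj l hl hjl
    obtain ⟨j, rfl⟩ := hring.exists_label hj
    obtain ⟨e, he, h⟩ := hhit j
    exact ⟨e, hM.1 ▸ he, Or.inl h⟩

theorem CategoryD.inClassS (h : CategoryD M) : InClassS k M := by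
  obtain ⟨ι, q, T, hlab, hT, -, -, hM⟩ := h.exists_labelling
  refine (hasLegs_of_cycleDep hlab hM).inClassS ((hT.image some).subset ?_)
  rintro (_ | i) hi
  · exact (hi (Or.inr rfl)).elim
  · exact ⟨i, fun h => hi (Or.inl ⟨i, h, rfl⟩), rfl⟩

omit [M.Finite] in
/-- Independence in the dual of the cycle matroid of a doubled cycle. -/
lemma dual_indep_iff_of_cycleDep {ι : Type*} {q : α → ι} {T : Set ι}
    (hT : ∃ i, i ∉ T) (hhit : ∀ i ∉ T, ∀ j ∉ T, i ≠ j → ∃ e ∈ M.E, q e = i ∨ q e = j)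
    (hM : ∀ I ⊆ M.E, M.Indep I ↔ ¬ CycleDep q T I) {I : Set α} (hI : I ⊆ M.E) :
    M✶.Indep I ↔ ¬ ∃ i j, i ≠ j ∧ i ∉ T ∧ j ∉ T ∧ (∀ e ∈ M.E, q e = i → e ∈ I) ∧
      ∀ e ∈ M.E, q e = j → e ∈ I := by
  classical
  rw [Matroid.dual_indep_iff_exists hI]
  constructor
  · rintro ⟨X, hX, hXI⟩ ⟨i, j, hij, hi, hj, hiI, hjI⟩
    have key : ∀ i j, i ≠ j → i ∉ T → j ∉ T → (∀ e ∈ M.E, q e = i → e ∈ I) →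
        (∀ e ∈ M.E, q e = j → e ∈ I) → ∀ e ∈ M.E, q e ≠ i := by
      rintro i j hij hi hj hiI hjI e he rfl
      have hXd := (hM X hX.subset_ground).1 hX.indep
      have heI := hiI e he rfl
      have heX : e ∉ X := fun h => disjoint_left.1 hXI heI h
      have hins : M.Indep (insert e X) := by
        rw [hM _ (insert_subset he hX.subset_ground)]
        rintro (⟨l, hl⟩ | hall)
        · by_cases hle : l = q e
          · subst hle
            have hlX : ∀ f ∈ insert e X, q f = q e → f = e := fun f hf hfe =>
              hf.resolve_right fun hfX =>
                disjoint_left.1 hXI (hiI f (hX.subset_ground hfX) hfe) hfX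
            rcases hl with hl | ⟨hl, -⟩ | ⟨f, hf, g, hg, hfg, hfe, hge⟩
            · exact hl.elim
            · exact hi hl
            · exact hfg ((hlX f hf hfe).trans (hlX g hg hge).symm)
          · refine hXd (Or.inl ⟨l, hl.of_fiber_subset fun f hf hfl => hf.resolve_left ?_⟩)
            rintro rfl
            exact hle hfl.symm
        · obtain ⟨f, hf, hfj⟩ := hall j hj
          rcases hf with rfl | hfX
          · exact hij hfj
          · exact disjoint_left.1 hXI (hjI f (hX.subset_ground hfX) hfj) hfX
      have := hX.eq_of_subset_indep hins (subset_insert e X)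
      exact heX (this ▸ mem_insert e X)
    obtain ⟨e, he, h | h⟩ := hhit i hi j hj hij
    · exact key i j hij hi hj hiI hjI e he h
    · exact key j i hij.symm hj hi hjI hiI e he h
  · intro hno
    obtain ⟨l, hl, hlI⟩ : ∃ l ∉ T, ∀ j ∉ T, j ≠ l → ∃ e ∈ M.E, q e = j ∧ e ∉ I := by
      by_cases hex : ∃ l ∉ T, ∀ e ∈ M.E, q e = l → e ∈ I
      · obtain ⟨l, hl, hlI⟩ := hex
        refine ⟨l, hl, fun j hj hjl => ?_⟩
        by_contra! h
        exact hno ⟨j, l, hjl, hj, hl, h, hlI⟩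
      · obtain ⟨l, hl⟩ := hT
        refine ⟨l, hl, fun j hj _ => ?_⟩
        by_contra! h
        exact hex ⟨j, hj, h⟩
    choose g hgE hgj hgI using hlI
    set X : Set α := {e | ∃ j, ∃ hj : j ∉ T, ∃ hjl : j ≠ l, g j hj hjl = e} with hX
    have hXE : X ⊆ M.E := by
      rintro _ ⟨j, hj, hjl, rfl⟩
      exact hgE j hj hjl
    have hXq : ∀ e ∈ X, q e ∉ T ∧ q e ≠ l := by
      rintro _ ⟨j, hj, hjl, rfl⟩
      rw [hgj]
      exact ⟨hj, hjl⟩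
    have hXinj : ∀ e ∈ X, ∀ f ∈ X, q e = q f → e = f := by
      rintro _ ⟨j, hj, hjl, rfl⟩ _ ⟨j', hj', hjl', rfl⟩ hq
      rw [hgj, hgj] at hq
      subst hq
      rfl
    refine ⟨X, Matroid.Indep.isBase_of_maximal ((hM X hXE).2 ?_) fun J hJ hXJ => ?_, ?_⟩
    · rintro (⟨i, hi | ⟨hi, e, he, rfl⟩ | ⟨e, he, f, hf, hef, hei, hfi⟩⟩ | hall)
      · exact hi
      · exact (hXq e he).1 hi
      · exact hef (hXinj e he f hf (hei.trans hfi.symm))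
      · obtain ⟨e, he, hel⟩ := hall l hl
        exact (hXq e he).2 hel
    · refine hXJ.antisymm fun e he => ?_
      by_contra heX
      refine (hM J hJ.subset_ground).1 hJ ?_
      by_cases ht : q e ∈ T
      · exact Or.inl ⟨q e, Or.inr (Or.inl ⟨ht, e, he, rfl⟩)⟩
      by_cases hel : q e = l
      · refine Or.inr fun j hj => ?_
        by_cases hjl : j = l
        · exact ⟨e, he, hel.trans hjl.symm⟩
        · exact ⟨g j hj hjl, hXJ ⟨j, hj, hjl, rfl⟩, hgj j hj hjl⟩
      · refine Or.inl ⟨q e, Or.inr (Or.inr ⟨e, he, g _ ht hel, hXJ ⟨_, ht, hel, rfl⟩, ?_, rfl,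
          hgj _ ht hel⟩)⟩
        intro h
        exact heX ⟨_, ht, hel, h.symm⟩
    · rw [disjoint_left]
      rintro _ heI ⟨j, hj, hjl, rfl⟩
      exact hgI j hj hjl heI

theorem CategoryE.inClassS (h : CategoryE M) : InClassS k M := by
  have hD : CategoryD M✶ := h
  obtain ⟨ι, q, T, hlab, -, hT, hhit, hM⟩ := hD.exists_labelling
  have hME : M✶.E = M.E := rfl
  have hMI : ∀ I ⊆ M.E, M.Indep I ↔ ¬ ∃ i j, i ≠ j ∧ i ∉ T ∧ j ∉ T ∧
      (∀ e ∈ M.E, q e = i → e ∈ I) ∧ ∀ e ∈ M.E, q e = j → e ∈ I := by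
    intro I hI
    have := dual_indep_iff_of_cycleDep (M := M✶) hT hhit hM hI
    rwa [Matroid.dual_dual] at this
  rw [hME] at hlab
  let T' : Set (Option ι) := {l | ∃ i, l = some i ∧ ((∀ e ∈ M.E, q e ≠ i) ∨
    (i ∉ T ∧ ∀ e ∈ M.E, ∀ f ∈ M.E, q e = i → q f = i → e = f))}
  let D' : Set (Option ι) := {l | ∃ i, l = some i ∧ i ∉ T ∧ ∀ e ∈ M.E, q e ≠ i}
  have hnone : none ∉ T' := by rintro ⟨i, hi, -⟩; simp at hi
  have hfull : ∀ I ⊆ M.E, ∀ l, FullLeg (fun e => some (q e)) T' D' I l ↔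
      ∃ i, l = some i ∧ i ∉ T ∧ ∀ e ∈ M.E, q e = i → e ∈ I := by
    intro I hI l
    constructor
    · rintro (⟨i, rfl, hi, hiE⟩ | ⟨⟨i, rfl, hi⟩, e, he, hei⟩ | ⟨e, he, f, hf, hef, rfl, hq⟩)
      · exact ⟨i, rfl, hi, fun e he hei => (hiE e he hei).elim⟩
      · have hei := Option.some_injective _ hei
        rcases hi with hi | ⟨hi, hu⟩
        · exact (hi e (hI he) hei).elim
        · refine ⟨i, rfl, hi, fun f hf hfi => ?_⟩
          rwa [hu f hf e (hI he) hfi hei]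
      · have hq := Option.some_injective _ hq
        refine ⟨q e, rfl, fun ht => hef (hlab.fiber_one e (hI he) f (hI hf) hq.symm ht),
          fun g hg hge => ?_⟩
        rcases hlab.fiber_two e (hI he) f (hI hf) g hg hq.symm hge.symm with h | rfl | rfl
        · exact (hef h).elim
        · exact he
        · exact hf
    · rintro ⟨i, rfl, hi, hiI⟩
      by_cases h0 : ∀ e ∈ M.E, q e ≠ i
      · exact Or.inl ⟨i, rfl, hi, h0⟩
      push Not at h0
      obtain ⟨e, he, hei⟩ := h0
      by_cases h1 : ∀ e ∈ M.E, ∀ f ∈ M.E, q e = i → q f = i → e = f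
      · exact Or.inr (Or.inl ⟨⟨i, rfl, Or.inr ⟨hi, h1⟩⟩, e, hiI e he hei, congrArg some hei⟩)
      · push Not at h1
        obtain ⟨e, he, f, hf, hei, hfi, hef⟩ := h1
        exact Or.inr (Or.inr ⟨e, hiI e he hei, f, hiI f hf hfi, hef, congrArg some hei,
          congrArg some hfi⟩)
  have hlegs : HasLegs k M (fun e => some (q e)) T' D' ∅ := by
    refine ⟨⟨?_, ?_⟩, ?_, ?_, by simp, fun b hb => hb.elim, by simp, by simp, fun I hI => ?_⟩
    · intro e he f hf g hg hef heg
      exact hlab.fiber_two e he f hf g hg (Option.some_injective _ hef)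
        (Option.some_injective _ heg)
    · rintro e he f hf hef ⟨i, hi, h | ⟨-, h⟩⟩
      · exact (h e he (Option.some_injective _ hi)).elim
      · exact h e he f hf (Option.some_injective _ hi) (Option.some_injective _ (hef.symm.trans hi))
    · rintro _ ⟨i, rfl, hi, h⟩
      exact ⟨i, rfl, Or.inl h⟩
    · rintro e he ⟨i, hi, -, h⟩
      exact h e he (Option.some_injective _ hi)
    · rw [hMI I hI, not_iff_not]
      constructor
      · rintro ⟨i, j, hij, hi, hj, hiI, hjI⟩
        exact Or.inl ⟨some i, some j, by simpa using hij, (hfull I hI _).2 ⟨i, rfl, hi, hiI⟩,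
          (hfull I hI _).2 ⟨j, rfl, hj, hjI⟩⟩
      · rintro (⟨l, l', hll, hl, hl'⟩ | ⟨-, hall⟩ | ⟨b, hb, -⟩)
        · obtain ⟨i, rfl, hi, hiI⟩ := (hfull I hI l).1 hl
          obtain ⟨j, rfl, hj, hjI⟩ := (hfull I hI l').1 hl'
          exact ⟨i, j, fun h => hll (h ▸ rfl), hi, hj, hiI, hjI⟩
        · obtain ⟨e, -, he⟩ := hall none hnone
          simp at he
        · exact hb.elim
  refine hlegs.inClassS (((M.ground_finite.image fun e => some (q e)).insert none).subset ?_)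
  rintro (_ | i) hi
  · exact mem_insert _ _
  · by_contra hn
    refine hi ⟨i, rfl, Or.inl fun e he hei => hn (Or.inr ⟨e, he, congrArg some hei⟩)⟩

theorem CategoryF.inClassS (h : CategoryF M) : InClassS k M := by
  have hself : ∀ e, e ∈ component M e := fun e => Or.inl rfl
  have hpair : ∀ C, M.IsCircuit C → ∀ e ∈ C, ∀ f ∈ C, e ≠ f → component M e = {e, f} := by
    intro C hC e he f hf hef
    have heE := hC.subset_ground he
    have hsub : ({e, f} : Set α) ⊆ component M e := by
      rintro g (rfl | rfl)
      · exact hself _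
      · exact Or.inr ⟨C, hC, he, hf⟩
    refine (Finite.eq_of_subset_of_encard_le (toFinite _) hsub ?_).symm
    rw [encard_pair hef]; exact h e heE
  have hmem : ∀ e f, f ∈ component M e → component M f = component M e := by
    rintro e f (rfl | ⟨C, hC, he, hf⟩)
    · rfl
    · by_cases hef : e = f
      · rw [hef]
      · rw [hpair C hC e he f hf hef, hpair C hC f hf e he (Ne.symm hef), pair_comm]
  let q : α → Set α ⊕ Bool := fun e => Sum.inl (component M e)
  let T : Set (Set α ⊕ Bool) := {l | l = Sum.inr true ∨ ∃ S, l = Sum.inl S ∧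
    ((∀ e ∈ M.E, component M e ≠ S) ∨ ∃ e, S = {e} ∧ ¬ M.Indep {e})}
  have hfalse : Sum.inr false ∉ T := by
    rintro (h | ⟨S, h, -⟩) <;> simp at h
  have hfull : ∀ I ⊆ M.E, M.Indep I ↔ ¬ ∃ l, FullLeg q T ∅ I l := by
    intro I hI
    rw [Matroid.indep_iff_forall_subset_not_isCircuit hI]
    constructor
    · rintro hno ⟨l, hl | ⟨hl, e, he, rfl⟩ | ⟨e, he, f, hf, hef, rfl, hq⟩⟩
      · exact hl
      · rcases hl with hl | ⟨S, hS, h0 | ⟨e', rfl, hdep⟩⟩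
        · simp [q] at hl
        · exact h0 e (hI he) (Sum.inl_injective hS)
        · have he' : e ∈ ({e'} : Set α) := Sum.inl_injective hS ▸ hself e
          obtain rfl : e = e' := he'
          obtain ⟨C, hCe, hC⟩ :=
            ((Matroid.not_indep_iff (singleton_subset_iff.2 (hI he))).1 hdep).exists_isCircuit_subset
          exact hno C (hCe.trans (singleton_subset_iff.2 he)) hC
      · have hfe : f ∈ component M e := (Sum.inl_injective hq : component M f = component M e) ▸
          hself f
        rcases hfe with h | ⟨C, hC, heC, hfC⟩
        · exact hef h.symm
        · have h1 := hpair C hC e heC f hfC hef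
          refine hno C (fun g hg => ?_) hC
          have : g ∈ component M e := Or.inr ⟨C, hC, heC, hg⟩
          rw [h1] at this
          rcases this with rfl | rfl <;> assumption
    · intro hno C hCI hC
      obtain ⟨e, he⟩ := hC.nonempty
      by_cases hn : ∃ f ∈ C, e ≠ f
      · obtain ⟨f, hf, hef⟩ := hn
        refine hno ⟨q e, Or.inr (Or.inr ⟨e, hCI he, f, hCI hf, hef, rfl, ?_⟩)⟩
        exact congrArg Sum.inl (hmem e f (Or.inr ⟨C, hC, he, hf⟩))
      · push Not at hn
        have hCe : C = {e} := Subset.antisymm (fun f hf => (hn f hf).symm) (by simpa)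
        refine hno ⟨q e, Or.inr (Or.inl ⟨Or.inr ⟨_, rfl, Or.inr ⟨e, ?_, ?_⟩⟩, e, hCI he, rfl⟩)⟩
        · refine Subset.antisymm ?_ (by simpa using hself e)
          rintro f (rfl | ⟨C', hC', heC', hfC'⟩)
          · rfl
          · have : C = C' := hC.eq_of_subset_isCircuit hC' (by rw [hCe]; simpa using heC')
            rwa [← this, hCe] at hfC'
        · rw [← hCe]; exact hC.not_indep
  have hfull' : ∀ I l, l ≠ Sum.inr true →
      (FullLeg q T {Sum.inr true} I l ↔ FullLeg q T ∅ I l) := by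
    intro I l hl
    exact or_congr_left (iff_of_false hl (notMem_empty _))
  have hlegs : HasLegs k M q T {Sum.inr true} ∅ := by
    refine ⟨⟨?_, ?_⟩, ?_, ?_, by simp, fun b hb => hb.elim, by simp, by simp, fun I hI => ?_⟩
    · intro e he f hf g hg hef heg
      have hf' : f ∈ component M e := (Sum.inl_injective hef : component M e = component M f) ▸
        hself f
      have hg' : g ∈ component M e := (Sum.inl_injective heg : component M e = component M g) ▸
        hself g
      exact eq_or_eq_or_eq_of_encard_le_two (h e he) (hself e) hf' hg'
    · rintro e he f hf hef (hl | ⟨S, hS, h0 | ⟨e', rfl, -⟩⟩)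
      · simp [q] at hl
      · exact (h0 e he (Sum.inl_injective hS)).elim
      · have h1 : e ∈ ({e'} : Set α) := Sum.inl_injective hS ▸ hself e
        have h2 : f ∈ ({e'} : Set α) := Sum.inl_injective (hef.symm.trans hS) ▸ hself f
        exact h1.trans h2.symm
    · rintro l rfl
      exact Or.inl rfl
    · intro e he hl
      simp [q] at hl
    · rw [hfull I hI, not_iff_not]
      constructor
      · rintro ⟨l, hl⟩
        have hlt : l ≠ Sum.inr true := by
          rintro rfl
          obtain ⟨e, -, he⟩ := hl.exists_mem
          simp [q] at he
        exact Or.inl ⟨l, Sum.inr true, hlt, (hfull' I l hlt).2 hl, Or.inl rfl⟩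
      · rintro (⟨l, l', hll, hl, hl'⟩ | ⟨-, hall⟩ | ⟨b, hb, -⟩)
        · by_cases hlt : l = Sum.inr true
          · have hlt' : l' ≠ Sum.inr true := fun h => hll (hlt.trans h.symm)
            exact ⟨l', (hfull' I l' hlt').1 hl'⟩
          · exact ⟨l, (hfull' I l hlt).1 hl⟩
        · obtain ⟨e, -, he⟩ := hall _ hfalse
          simp [q] at he
        · exact hb.elim
  refine hlegs.inClassS (((M.ground_finite.image q).insert (Sum.inr false)).subset ?_)
  rintro (S | s) hl
  · by_contra hn
    refine hl (Or.inr ⟨S, rfl, Or.inl fun e he heS => hn (Or.inr ⟨e, he, congrArg Sum.inl heS⟩)⟩)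
  · cases s
    · exact mem_insert _ _
    · exact (hl (Or.inl rfl)).elim

end SpikeMinor

theorem proposition3p5 {α : Type*} (k : ℕ) (M : Matroid α) [M.Finite] :
    SpikeMinor.InClassS k M ↔
      SpikeMinor.CategoryA k M ∨ SpikeMinor.CategoryB k M ∨ SpikeMinor.CategoryC k M ∨
        SpikeMinor.CategoryD M ∨ SpikeMinor.CategoryE M ∨ SpikeMinor.CategoryF M := by
  constructor
  · intro h
    obtain ⟨r, q, T, D, B, hr, hlegs⟩ := h.exists_hasLegs
    have : NeZero r := ⟨by omega⟩
    exact hlegs.categories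
  · rintro (h | h | h | h | h | h)
    · exact h.inClassS
    · exact h.inClassS
    · exact h.inClassS
    · exact h.inClassS
    · exact h.inClassS
    · exact h.inClassS
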